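/- Let $U$ be a universal machine: it has a one-way read-only program tape of bits, a one-way output tape, and auxiliary tapes that hold conditions, and for every such machine $M$ there is a fixed string $r$ such that $U$ on $rp$ simulates $M$ on $p$, for all programs $p$ and all auxiliary inputs, in halting computations as well as in the (finite or infinite) sequence of outputs. Write $U_y(p)=x$ if $U$ with auxiliary input $y$ reads exactly the bits of $p$, outputs $x$ and halts. Let $\mathbf{K}(x/y)=\min\{\|p\| : U_y(p)=x\}$, $\mathbf{m}(x/y)=\sum\{2^{-\|p\|} : U_y(p)=x\}$ and $\mathbf{I}(i:j/n)=\mathbf{K}(i/n)+\mathbf{K}(j/n)-\mathbf{K}(i,j/n)$. Logarithms are binary, with $\log 0=-\infty$. Vectors and matrices are elementary if their entries have rational real and imaginary parts; elementary objects are identified with codes. A semi-density matrix is a positive semidefinite matrix of trace at most $1$. An elementary POVM on $n$ qubits is a finite or infinite sequence $E=(E_k)$ of elementary positive semidefinite $2^n\times 2^n$ matrices with $\sum_k E_k=I$, given by a program with which $U$ (without auxiliary input) outputs the sequence $E_0,E_1,\dots$ (put $E_k=0$ beyond the end of a finite sequence). For a semi-density matrix $\sigma$ let $E\sigma(k)=\operatorname{Tr}E_k\sigma$.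 Everything below is relativized to $E$: a program for $E$ is on an auxiliary tape of $U$. Let $\boldsymbol{\mu}=\sum_{|\phi\rangle}\mathbf{m}(|\phi\rangle/n)\,|\phi\rangle\langle\phi|$, the sum over elementary pure states of $n$ qubits. A program $q$ lower computes a positive semidefinite matrix $\nu$ if $U$ on $q$ reads at most $\|q\|$ bits and outputs, with or without halting, a sequence of elementary positive semidefinite matrices that increases in the Loewner order to $\nu$. Let $\underline{\mathbf m}(\nu/n)=\sum\{\mathbf{m}(q/n) : q \text{ lower computes } \nu\}$, and let $$\mathfrak{C}=\sum \underline{\mathbf m}(A\otimes B/n)\,A\otimes B,$$ the sum over all lower computable matrices $A\otimes B$, with $A,B$ of size $2^n\times 2^n$, such that $\operatorname{Tr}(A\otimes B)(\boldsymbol{\mu}\otimes\boldsymbol{\mu})\le 1$. For semi-density matrices $\sigma,\rho$ on $n$ qubits let $\mathbf{I}(\sigma:\rho)=\log\operatorname{Tr}\mathfrak{C}(\sigma\otimes\rho)$. Then there is a constant $c$, depending only on $U$, such that for all $n$, all elementary POVMs $E$ on $n$ qubits (given by any of their programs), all semi-density matrices $\sigma,\rho$ on $n$ qubits and all $i,j\in\mathbb{N}$,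 relativized to $E$, $$\mathbf{I}(i:j/n)+\log\bigl(E\sigma(i)\,E\rho(j)\bigr)-\mathbf{K}\bigl(\mathbf{I}(i:j/n)/n\bigr)\le \mathbf{I}(\sigma:\rho)+c .$$ -/

import Mathlib

open scoped ENNReal Topology Kronecker ComplexOrder

namespace AlgInfo

/-! ## Machines

A machine works on internal states, has a one-way read-only tape of program bits, a one-way output
tape on which it writes natural numbers (codes of finite objects), and auxiliary tapes, each holding
a natural number, whose contents it is given at the start. -/

/-- One instruction of a machine whose states form `α`: `none` is "halt"; `some (inl s)` is "go to
`s`"; `some (inr (inl (s₀, s₁)))` is "read the next program bit and go to `s₀` if it is `0` and to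
`s₁` if it is `1`"; `some (inr (inr (x, s)))` is "write `x` on the output tape and go to `s`". -/
abbrev Instr (α : Type) : Type := Option (α ⊕ (α × α) ⊕ (ℕ × α))

/-- A machine: computable initial state and computable transition table. -/
structure Machine where
  State : Type
  primcodable : Primcodable State
  start : List ℕ → State
  step : State → Instr State
  start_computable : Computable start
  step_computable : Computable step

attribute [instance] Machine.primcodable

/-- Instantaneous description: state, unread program bits, output so far. -/
structure Config (α : Type) where
  state : α
  input : List Bool
  output : List ℕ

namespace Machine

variable (M : Machine)

/-- One step. A halted machine, and a machine that wants a bit when none is left, stay put. -/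
def next (c : Config M.State) : Config M.State :=
  match M.step c.state with
  | none => c
  | some (Sum.inl s) => ⟨s, c.input, c.output⟩
  | some (Sum.inr (Sum.inl (s₀, s₁))) =>
    match c.input with
    | [] => c
    | b :: l => ⟨bif b then s₁ else s₀, l, c.output⟩
  | some (Sum.inr (Sum.inr (x, s))) => ⟨s, c.input, c.output ++ [x]⟩

/-- The configuration after `t` steps with program `p` and auxiliary tapes `w`. -/
def conf (w : List ℕ) (p : List Bool) (t : ℕ) : Config M.State :=
  M.next^[t] ⟨M.start w, p, []⟩

/-- The machine wants to read a program bit, and none is left. -/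
def Starved (c : Config M.State) : Prop :=
  c.input = [] ∧ ∃ s₀ s₁, M.step c.state = some (Sum.inr (Sum.inl (s₀, s₁)))

/-- `M_w(p) = x`: with auxiliary input `w`, the machine reads exactly the bits of `p`, writes `x`,
and halts. -/
def Outputs (w : List ℕ) (p : List Bool) (x : ℕ) : Prop :=
  ∃ t, M.step (M.conf w p t).state = none ∧ (M.conf w p t).input = [] ∧
    (M.conf w p t).output = [x]

/-- With program `p`, the `k`-th number (from `0`) that the machine writes is `x`. -/
def Emits (w : List ℕ) (p : List Bool) (k x : ℕ) : Prop :=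
  ∃ t, (M.conf w p t).output[k]? = some x

/-- The machine never tries to read beyond the end of `p`, whether or not it halts. -/
def ReadsWithin (w : List ℕ) (p : List Bool) : Prop :=
  ∀ t, ¬ M.Starved (M.conf w p t)

/-- Universality: every machine is simulated, in its halting computations and in its (finite or
infinite) output sequences, after a prefix that depends only on that machine. -/
def IsUniversal (U : Machine) : Prop :=
  ∀ M : Machine, ∃ r : List Bool, ∀ (w : List ℕ) (p : List Bool),
    (∀ x, M.Outputs w p x → U.Outputs w (r ++ p) x) ∧
    (M.ReadsWithin w p → U.ReadsWithin w (r ++ p)) ∧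
    (∀ k x, U.Emits w (r ++ p) k x ↔ M.Emits w p k x)

end Machine

/-! ## Existence of a universal machine -/

section Existence

open Nat.Partrec (Code)
open Nat.Partrec.Code

/-- Relabelling the states in an instruction. -/
def Instr.map {α β : Type} (f : α → β) : Instr α → Instr β :=
  Option.map (Sum.map f (Sum.map (Prod.map f f) (Prod.map id f)))

theorem Instr.computable_map {γ α β : Type} [Primcodable γ] [Primcodable α] [Primcodable β]
    {f : γ → α → β} (hf : Computable₂ f) {g : γ → Instr α} (hg : Computable g) :
    Computable fun c => Instr.map (f c) (g c) := by
  unfold Instr.map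
  refine Computable.option_map hg ?_
  have h : Computable fun p : γ × (α ⊕ (α × α) ⊕ (ℕ × α)) =>
      (Sum.casesOn p.2 (fun a => Sum.inl (f p.1 a)) fun b => Sum.inr
        (Sum.casesOn b (fun a => Sum.inl (f p.1 a.1, f p.1 a.2)) fun x => Sum.inr (x.1, f p.1 x.2)) :
        β ⊕ (β × β) ⊕ (ℕ × β)) := by
    refine Computable.sumCasesOn Computable.snd ?_ ?_
    · exact Computable.sumInl.comp (hf.comp (Computable.fst.comp Computable.fst) Computable.snd)
    · refine Computable.sumInr.comp (Computable.sumCasesOn Computable.snd ?_ ?_)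
      · refine Computable.sumInl.comp (Computable.pair (hf.comp ?_ ?_) (hf.comp ?_ ?_))
        · exact Computable.fst.comp (Computable.fst.comp Computable.fst)
        · exact Computable.fst.comp Computable.snd
        · exact Computable.fst.comp (Computable.fst.comp Computable.fst)
        · exact Computable.snd.comp Computable.snd
      · refine Computable.sumInr.comp (Computable.pair ?_ (hf.comp ?_ ?_))
        · exact Computable.fst.comp Computable.snd
        · exact Computable.fst.comp (Computable.fst.comp Computable.fst)
        · exact Computable.snd.comp Computable.snd
  refine h.of_eq ?_
  rintro ⟨c, a | a | a⟩ <;> rfl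

theorem Instr.decode_encode {α : Type} [Encodable α] (i : Instr α) :
    (Encodable.decode (Encodable.encode i) : Option (Instr ℕ)) = some (Instr.map Encodable.encode i) := by
  have : Encodable.encode i = Encodable.encode (Instr.map Encodable.encode i : Instr ℕ) := by
    rcases i with _ | a | ⟨a, b⟩ | ⟨x, a⟩ <;> simp [Instr.map, Encodable.encode_none]
  rw [this, Encodable.encodek]

/-- States of the universal machine: collecting the index of the machine to be simulated, or
simulating (index, coded state, time allowed for computing the next instruction). -/
abbrev UState : Type := (List ℕ × ℕ) ⊕ (ℕ × ℕ × ℕ)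

/-- Transition table of the universal machine. -/
def ustep : UState → Instr UState
  | Sum.inl (w, k) =>
    some (Sum.inr (Sum.inl (Sum.inr (k, Encodable.encode (Sum.inl w : List ℕ ⊕ ℕ), 0),
      Sum.inl (w, k + 1))))
  | Sum.inr (k, s, t) =>
    Option.elim (evaln t (Denumerable.ofNat Code k) s) (some (Sum.inl (Sum.inr (k, s, t + 1))))
      fun v => Instr.map (fun s' => Sum.inr (k, s', 0)) ((Encodable.decode v : Option (Instr ℕ)).bind id)

theorem ustep_computable : Computable ustep := by
  have h1 : Computable fun a : List ℕ × ℕ =>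
      (some (Sum.inr (Sum.inl (Sum.inr (a.2, Encodable.encode (Sum.inl a.1 : List ℕ ⊕ ℕ), 0),
        Sum.inl (a.1, a.2 + 1)))) : Instr UState) := by
    refine Computable.option_some.comp (Computable.sumInr.comp (Computable.sumInl.comp ?_))
    refine Computable.pair (Computable.sumInr.comp ?_) (Computable.sumInl.comp ?_)
    · refine Computable.pair Computable.snd (Computable.pair ?_ (Computable.const 0))
      exact Computable.encode.comp (Computable.sumInl.comp Computable.fst)
    · exact Computable.pair Computable.fst (Computable.succ.comp Computable.snd)
  have h2 : Computable fun a : ℕ × ℕ × ℕ =>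
      (Option.casesOn (evaln a.2.2 (Denumerable.ofNat Code a.1) a.2.1)
        (some (Sum.inl (Sum.inr (a.1, a.2.1, a.2.2 + 1))))
        fun v => Instr.map (fun s' => Sum.inr (a.1, s', 0))
          ((Encodable.decode v : Option (Instr ℕ)).bind id) : Instr UState) := by
    refine Computable.option_casesOn ?_ ?_ ?_
    · have e := primrec_evaln.to_comp
      refine Computable.comp (f := fun a : (ℕ × Code) × ℕ => evaln a.1.1 a.1.2 a.2) (g := fun a : ℕ × ℕ × ℕ => ((a.2.2, Denumerable.ofNat Code a.1), a.2.1)) e ?_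
      refine Computable.pair (Computable.pair ?_ ?_) ?_
      · exact Computable.snd.comp Computable.snd
      · exact (Computable.ofNat Code).comp Computable.fst
      · exact Computable.fst.comp Computable.snd
    · refine Computable.option_some.comp (Computable.sumInl.comp (Computable.sumInr.comp ?_))
      refine Computable.pair Computable.fst (Computable.pair ?_ ?_)
      · exact Computable.fst.comp Computable.snd
      · exact Computable.succ.comp (Computable.snd.comp Computable.snd)
    · refine Instr.computable_map (γ := (ℕ × ℕ × ℕ) × ℕ)
        (f := fun c s' => (Sum.inr (c.1.1, s', 0) : UState)) ?_ ?_
      · refine Computable.sumInr.comp (Computable.pair ?_ (Computable.pair Computable.snd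
          (Computable.const 0)))
        exact Computable.fst.comp (Computable.fst.comp Computable.fst)
      · refine Computable.option_bind (Computable.decode.comp Computable.snd) ?_
        exact Computable.snd
  refine (Computable.sumCasesOn Computable.id (h1.comp Computable.snd).to₂
    (h2.comp Computable.snd).to₂).of_eq ?_
  rintro (⟨w, k⟩ | ⟨k, s, t⟩)
  · rfl
  · simp only [ustep, id]
    cases evaln t (Denumerable.ofNat Code k) s <;> rfl

/-- A universal machine: it reads the index `k` of a machine, as `k` ones and a zero, and then
simulates that machine. -/
def universalMachine : Machine where
  State := UState
  primcodable := inferInstance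
  start w := Sum.inl (w, 0)
  step := ustep
  start_computable := Computable.sumInl.comp (Computable.pair Computable.id (Computable.const 0))
  step_computable := ustep_computable

/-- The transition table of `M`, with one more state per auxiliary input in which it starts. -/
def Machine.step' (M : Machine) : List ℕ ⊕ M.State → Instr (List ℕ ⊕ M.State)
  | Sum.inl w => some (Sum.inl (Sum.inr (M.start w)))
  | Sum.inr s => Instr.map Sum.inr (M.step s)

theorem Machine.step'_computable (M : Machine) : Computable M.step' := by
  have h1 : Computable fun w => (some (Sum.inl (Sum.inr (M.start w))) : Instr (List ℕ ⊕ M.State)) :=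
    Computable.option_some.comp (Computable.sumInl.comp (Computable.sumInr.comp M.start_computable))
  have h2 : Computable fun s => (Instr.map Sum.inr (M.step s) : Instr (List ℕ ⊕ M.State)) :=
    Instr.computable_map (f := fun _ s => Sum.inr s) (Computable.sumInr.comp Computable.snd)
      M.step_computable
  refine (Computable.sumCasesOn Computable.id (h1.comp Computable.snd).to₂
    (h2.comp Computable.snd).to₂).of_eq ?_
  rintro (w | s) <;> rfl

/-- `M`, computing its initial state in its first step. -/
def Machine.delay (M : Machine) : Machine where
  State := List ℕ ⊕ M.State
  primcodable := inferInstance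
  start := Sum.inl
  step := M.step'
  start_computable := Computable.sumInl
  step_computable := M.step'_computable

theorem Machine.conf_succ (M : Machine) (w : List ℕ) (p : List Bool) (t : ℕ) :
    M.conf w p (t + 1) = M.next (M.conf w p t) := by
  rw [Machine.conf, Function.iterate_succ_apply', ← Machine.conf]

theorem Machine.conf_delay (M : Machine) (w : List ℕ) (p : List Bool) (t : ℕ) :
    M.delay.conf w p (t + 1) =
      ⟨Sum.inr (M.conf w p t).state, (M.conf w p t).input, (M.conf w p t).output⟩ := by
  induction t with
  | zero => rfl
  | succ t ih =>
    rw [Machine.conf_succ, ih, Machine.conf_succ M]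
    generalize M.conf w p t = c
    obtain ⟨s, l, o⟩ := c
    simp only [Machine.next, Machine.delay, Machine.step']
    rcases M.step s with _ | a | ⟨a, b⟩ | ⟨x, a⟩
    · rfl
    · rfl
    · cases l with
      | nil => rfl
      | cons b' l => cases b' <;> rfl
    · rfl

/-- Universal machines exist. -/
theorem universalMachine_isUniversal : universalMachine.IsUniversal := by
  intro M
  obtain ⟨c, hc⟩ := exists_code.1 M.step'_computable
  set k := Encodable.encode c with hk
  have hcode : Denumerable.ofNat Code k = c := Denumerable.ofNat_encode c
  have hev : ∀ s, Encodable.encode (M.step' s) ∈ eval c (Encodable.encode s) := by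
    intro s; rw [hc]; simp
  choose! fuel0 hfuel0 using fun s => evaln_complete.1 (hev s)
  have hex : ∀ s, ∃ t, (evaln t c (Encodable.encode s)).isSome := fun s =>
    ⟨fuel0 s, by rw [Option.mem_def.1 (hfuel0 s)]; rfl⟩
  classical
  let T := fun s => Nat.find (hex s)
  have hT : ∀ s, evaln (T s) c (Encodable.encode s) = some (Encodable.encode (M.step' s)) := by
    intro s
    obtain ⟨v, hv⟩ := Option.isSome_iff_exists.1 (Nat.find_spec (hex s))
    have h1 := evaln_sound (Option.mem_def.2 hv)
    have := Part.mem_unique h1 (hev s)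
    rw [← this]; exact hv
  have hTlt : ∀ s t, t < T s → evaln t c (Encodable.encode s) = none := by
    intro s t ht
    simpa using Nat.find_min (hex s) ht
  have ulo : ∀ s t, t < T s → ustep (Sum.inr (k, Encodable.encode s, t)) =
      some (Sum.inl (Sum.inr (k, Encodable.encode s, t + 1))) := by
    intro s t ht; simp [ustep, hcode, hTlt s t ht]
  have uhi : ∀ s, ustep (Sum.inr (k, Encodable.encode s, T s)) =
      Instr.map (fun s' => Sum.inr (k, Encodable.encode s', 0)) (M.step' s) := by
    intro s
    simp only [ustep, hcode, hT, Option.elim, Instr.decode_encode]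
    rcases M.step' s with _ | a | ⟨a, b⟩ | ⟨x, a⟩ <;> rfl
  let ph : ℕ → Config (List ℕ ⊕ M.State) → Config UState := fun t d =>
    ⟨Sum.inr (k, Encodable.encode d.state, t), d.input, d.output⟩
  have nlo : ∀ d t, t < T d.state → universalMachine.next (ph t d) = ph (t + 1) d := by
    intro d t ht
    simp only [Machine.next, universalMachine, ph, ulo d.state t ht]
  have nhi : ∀ d, universalMachine.next (ph (T d.state) d) = ph 0 (M.delay.next d) ∨
      (universalMachine.next (ph (T d.state) d) = ph (T d.state) d ∧ M.delay.next d = d) := by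
    intro d
    obtain ⟨s, l, o⟩ := d
    simp only [Machine.next, universalMachine, ph, uhi s, Machine.delay]
    rcases M.step' s with _ | a | ⟨a, b⟩ | ⟨x, a⟩
    · exact Or.inr ⟨rfl, rfl⟩
    · exact Or.inl rfl
    · cases l with
      | nil => exact Or.inr ⟨rfl, rfl⟩
      | cons b' l => cases b' <;> exact Or.inl rfl
    · exact Or.inl rfl
  refine ⟨List.replicate k true ++ [false], fun w p => ?_⟩
  set P := (List.replicate k true ++ [false]) ++ p with hP
  have pre : ∀ t, t ≤ k → universalMachine.conf w P t =
      ⟨Sum.inl (w, t), List.replicate (k - t) true ++ false :: p, []⟩ := by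
    intro t
    induction t with
    | zero => intro _; simp [Machine.conf, universalMachine, hP]
    | succ t ih =>
      intro ht
      rw [Machine.conf_succ, ih (by omega), show k - t = (k - (t + 1)) + 1 by omega,
        List.replicate_succ]
      rfl
  have first : universalMachine.conf w P (k + 1) = ph 0 (M.delay.conf w p 0) := by
    rw [Machine.conf_succ, pre k le_rfl, Nat.sub_self]
    rfl
  have fuelup : ∀ a d, universalMachine.conf w P a = ph 0 d → ∀ t, t ≤ T d.state →
      universalMachine.conf w P (a + t) = ph t d := by
    intro a d h t
    induction t with
    | zero => intro _; exact h
    | succ t ih =>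
      intro ht
      rw [← Nat.add_assoc, Machine.conf_succ, ih (by omega), nlo d t (by omega)]
  have fwd : ∀ t, ∃ a, universalMachine.conf w P a = ph 0 (M.delay.conf w p t) := by
    intro t
    induction t with
    | zero => exact ⟨_, first⟩
    | succ t ih =>
      obtain ⟨a, ha⟩ := ih
      have h := fuelup a _ ha _ le_rfl
      rcases nhi (M.delay.conf w p t) with h1 | ⟨_, h1⟩
      · exact ⟨_, by rw [Machine.conf_succ M.delay, ← h1, ← h, ← Machine.conf_succ]⟩
      · exact ⟨a, by rw [Machine.conf_succ M.delay, h1, ha]⟩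
  have bwd : ∀ a, (∃ t, t ≤ k ∧ universalMachine.conf w P a =
        ⟨Sum.inl (w, t), List.replicate (k - t) true ++ false :: p, []⟩) ∨
      ∃ t r, r ≤ T (M.delay.conf w p t).state ∧
        universalMachine.conf w P a = ph r (M.delay.conf w p t) := by
    intro a
    induction a with
    | zero => exact Or.inl ⟨0, Nat.zero_le _, pre 0 (Nat.zero_le _)⟩
    | succ a ih =>
      rcases ih with ⟨t, ht, h⟩ | ⟨t, r, hr, h⟩
      · rw [← pre t ht] at h
        rcases ht.lt_or_eq with ht | rfl
        · refine Or.inl ⟨t + 1, ht, ?_⟩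
          rw [Machine.conf_succ, h, ← Machine.conf_succ, pre _ ht]
        · refine Or.inr ⟨0, 0, Nat.zero_le _, ?_⟩
          rw [Machine.conf_succ, h, ← Machine.conf_succ, first]
      · right
        rcases hr.lt_or_eq with hr | rfl
        · exact ⟨t, r + 1, hr, by rw [Machine.conf_succ, h, nlo _ _ hr]⟩
        · rcases nhi (M.delay.conf w p t) with h1 | ⟨h1, _⟩
          · exact ⟨t + 1, 0, Nat.zero_le _, by rw [Machine.conf_succ, h, h1, Machine.conf_succ]⟩
          · exact ⟨t, _, le_rfl, by rw [Machine.conf_succ, h, h1]⟩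
  refine ⟨?_, ?_, ?_⟩
  · rintro x ⟨t, h1, h2, h3⟩
    obtain ⟨a, ha⟩ := fwd (t + 1)
    have h := fuelup a _ ha _ le_rfl
    refine ⟨a + T (M.delay.conf w p (t + 1)).state, ?_, ?_, ?_⟩
    · rw [h]
      refine (uhi _).trans ?_
      rw [Machine.conf_delay]
      simp only [Machine.step', Instr.map, h1, Option.map_none]
      rfl
    · rw [h, Machine.conf_delay]; exact h2
    · rw [h, Machine.conf_delay]; exact h3
  · rintro hM a ⟨h1, s₀, s₁, h2⟩
    rcases bwd a with ⟨t, ht, h⟩ | ⟨t, r, hr, h⟩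
    · rw [h] at h1; simp at h1
    · rw [h] at h1 h2
      rcases hr.lt_or_eq with hr | rfl
      · have h2 := (ulo _ _ hr).symm.trans h2
        cases h2
      · have h2 := (uhi _).symm.trans h2
        cases t with
        | zero => cases h2
        | succ t =>
          rw [Machine.conf_delay] at h1 h2
          refine hM t ⟨h1, ?_⟩
          simp only [Machine.step'] at h2
          clear h1
          rcases hs : M.step (M.conf w p t).state with _ | a | ⟨a, b⟩ | ⟨x, a⟩
          · rw [hs] at h2; cases h2
          · rw [hs] at h2; cases h2
          · exact ⟨a, b, rfl⟩
          · rw [hs] at h2; cases h2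
  · intro i x
    constructor
    · rintro ⟨a, ha⟩
      rcases bwd a with ⟨t, ht, h⟩ | ⟨t, r, hr, h⟩
      · rw [h] at ha; simp at ha
      · rw [h] at ha
        cases t with
        | zero => simp [ph, Machine.conf] at ha
        | succ t =>
          rw [Machine.conf_delay] at ha
          exact ⟨t, ha⟩
    · rintro ⟨t, ht⟩
      obtain ⟨a, ha⟩ := fwd (t + 1)
      refine ⟨a, ?_⟩
      rw [ha, Machine.conf_delay]
      exact ht

end Existence

noncomputable section

/-! ## Kolmogorov complexity and algorithmic probability

`w` is the list of contents of the auxiliary tapes (conditions and objects relativized to). -/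

namespace Machine

variable (U : Machine)

/-- Prefix complexity `K(x / w)`. For a universal machine the set is nonempty. -/
def K (w : List ℕ) (x : ℕ) : ℕ :=
  sInf {l | ∃ p : List Bool, p.length = l ∧ U.Outputs w p x}

/-- Universal probability `m(x / w)`: the sum of `2^{-|p|}` over the programs `p` of `x`. -/
def m (w : List ℕ) (x : ℕ) : ℝ≥0∞ :=
  ∑' p : {p : List Bool // U.Outputs w p x}, (2 : ℝ≥0∞)⁻¹ ^ p.1.length

/-- Algorithmic information `I(x : y / w) = K(x / w) + K(y / w) - K(x, y / w)`. -/
def info (w : List ℕ) (x y : ℕ) : ℤ :=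
  (U.K w x : ℤ) + (U.K w y : ℤ) - (U.K w (Nat.pair x y) : ℤ)

end Machine

/-! ## Elementary objects and their codes -/

/-- Complex numbers with rational real part and imaginary part. -/
abbrev GaussRat : Type := ℚ × ℚ

def GaussRat.toComplex (z : GaussRat) : ℂ := ⟨(z.1 : ℝ), (z.2 : ℝ)⟩

def ratCode (x : ℚ) : ℕ := Nat.pair (Encodable.encode x.num) x.den

def GaussRat.code (z : GaussRat) : ℕ := Nat.pair (ratCode z.1) (ratCode z.2)

def vecCode {d : ℕ} (v : Fin d → GaussRat) : ℕ :=
  Encodable.encode (List.ofFn fun k => GaussRat.code (v k))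

/-- Elementary pure states of a `d`-dimensional space with a fixed basis. -/
abbrev ElemState (d : ℕ) : Type :=
  {v : Fin d → GaussRat // ∑ k, ((v k).1 ^ 2 + (v k).2 ^ 2) = 1}

/-- The projection `|φ⟩⟨φ|`. -/
def ElemState.proj {d : ℕ} (φ : ElemState d) : Matrix (Fin d) (Fin d) ℂ :=
  Matrix.vecMulVec (fun k => (φ.1 k).toComplex) (star fun k => (φ.1 k).toComplex)

/-- Matrices with entries that have rational real and imaginary parts. -/
abbrev ElemMatrix (d : ℕ) : Type := Matrix (Fin d) (Fin d) GaussRat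

def ElemMatrix.toMatrix {d : ℕ} (A : ElemMatrix d) : Matrix (Fin d) (Fin d) ℂ :=
  fun a b => (A a b).toComplex

/-- The code of a matrix: the list of its rows. -/
def ElemMatrix.code {d : ℕ} (A : ElemMatrix d) : ℕ :=
  Encodable.encode (List.ofFn fun a => vecCode (A a))

/-! ## Matrices -/

/-- A semi-density matrix: positive semidefinite with trace at most `1`. -/
structure IsSemiDensity {d : ℕ} (σ : Matrix (Fin d) (Fin d) ℂ) : Prop where
  posSemidef : σ.PosSemidef
  trace_le : σ.trace.re ≤ 1

/-- The tensor product of matrices, on the product basis in lexicographic order. -/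
def tensor {a b : ℕ} (A : Matrix (Fin a) (Fin a) ℂ) (B : Matrix (Fin b) (Fin b) ℂ) :
    Matrix (Fin (a * b)) (Fin (a * b)) ℂ :=
  Matrix.reindex finProdFinEquiv finProdFinEquiv (A ⊗ₖ B)

/-- The binary logarithm on `[0, ∞)`, with `log 0 = -∞`. -/
def log2 (x : ℝ) : EReal :=
  if x ≤ 0 then ⊥ else ((Real.logb 2 x : ℝ) : EReal)

/-- A finite or infinite POVM `E 0, E 1, …`; a finite one is continued by zero matrices. -/
structure IsPOVM {d : ℕ} (E : ℕ → Matrix (Fin d) (Fin d) ℂ) : Prop where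
  posSemidef : ∀ k, (E k).PosSemidef
  hasSum : HasSum E 1

/-- The probability `Eσ(k) = Tr E_k σ` of the outcome `k`. -/
def outcome {d : ℕ} (E : ℕ → Matrix (Fin d) (Fin d) ℂ) (σ : Matrix (Fin d) (Fin d) ℂ) (k : ℕ) : ℝ :=
  (E k * σ).trace.re

namespace Machine

variable (U : Machine)

/-- The program `q` (without auxiliary input) outputs the enumeration `E 0, E 1, …` of elementary
matrices. If the enumeration is finite, then `E` is zero from there on. -/
def Enumerates {d : ℕ} (q : List Bool) (E : ℕ → Matrix (Fin d) (Fin d) ℂ) : Prop :=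
  U.ReadsWithin [] q ∧
    ∀ k, (∃ A : ElemMatrix d, A.toMatrix = E k ∧ U.Emits [] q k A.code) ∨
      (E k = 0 ∧ ∀ x, ¬ U.Emits [] q k x)

/-- The program `q`, with auxiliary input `e`, lower computes the positive semidefinite matrix `ν`:
it outputs, with or without halting, a nonempty finite or infinite sequence of elementary positive
semidefinite matrices that increases in the Loewner order to `ν`. A finite sequence is continued in
`ξ` by its last member. -/
def LowerComputes {d : ℕ} (e : List ℕ) (q : List Bool) (ν : Matrix (Fin d) (Fin d) ℂ) : Prop :=
  U.ReadsWithin e q ∧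
    ∃ ξ : ℕ → ElemMatrix d,
      (∀ k, (ξ k).toMatrix.PosSemidef) ∧
      (∀ k, ((ξ (k + 1)).toMatrix - (ξ k).toMatrix).PosSemidef) ∧
      Filter.Tendsto (fun k => (ξ k).toMatrix) Filter.atTop (𝓝 ν) ∧
      U.Emits e q 0 (ξ 0).code ∧
      ∀ k, U.Emits e q (k + 1) (ξ (k + 1)).code ∨
        (ξ (k + 1) = ξ k ∧ ∀ x, ¬ U.Emits e q (k + 1) x)

/-- Lower algorithmic probability of `ν` given the number `n`, relative to `e`: the sum of
`m(q / n)` over the programs `q` that lower compute `ν`. -/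
def lowerProb {d : ℕ} (e : List ℕ) (n : ℕ) (ν : Matrix (Fin d) (Fin d) ℂ) : ℝ≥0∞ :=
  ∑' q : {q : List Bool // U.LowerComputes e q ν}, U.m (n :: e) (Encodable.encode q.1)

/-- The universal matrix `μ` of the space of `n` qubits, relative to `e`: the sum of
`m(φ / n) |φ⟩⟨φ|` over the elementary pure states `φ`. -/
def mu (e : List ℕ) (n : ℕ) : Matrix (Fin (2 ^ n)) (Fin (2 ^ n)) ℂ :=
  ∑' φ : ElemState (2 ^ n), (U.m (n :: e) (vecCode φ.1)).toReal • φ.proj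

/-- The product tests for `μ ⊗ μ`: lower computable matrices `A ⊗ B` with
`Tr (A ⊗ B) (μ ⊗ μ) ≤ 1`. -/
def productTests (e : List ℕ) (n : ℕ) : Set (Matrix (Fin (2 ^ n * 2 ^ n)) (Fin (2 ^ n * 2 ^ n)) ℂ) :=
  {ν | (∃ A B : Matrix (Fin (2 ^ n)) (Fin (2 ^ n)) ℂ, ν = tensor A B) ∧
    (∃ q, U.LowerComputes e q ν) ∧
    (ν * tensor (U.mu e n) (U.mu e n)).trace.re ≤ 1}

/-- The aggregate of the product tests, weighted by their lower algorithmic probabilities. -/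
def aggregate (e : List ℕ) (n : ℕ) : Matrix (Fin (2 ^ n * 2 ^ n)) (Fin (2 ^ n * 2 ^ n)) ℂ :=
  ∑' ν : U.productTests e n, (U.lowerProb e n ν.1).toReal • ν.1

/-- Mutual information of two semi-density matrices on `n` qubits, relative to `e`. -/
def qinfo (e : List ℕ) (n : ℕ) (σ ρ : Matrix (Fin (2 ^ n)) (Fin (2 ^ n)) ℂ) : EReal :=
  log2 (U.aggregate e n * tensor σ ρ).trace.re

end Machine

end

end AlgInfo

namespace AlgInfo

/-! ## Primitive recursive arithmetic on integers and rational numbers -/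

-- Fix outcomes i, j and write I for I(i:j/n); all complexities are conditional on n and relative to
-- E. One product test suffices: ν = s · E_i ⊗ E_j with s = 2^(K(i) + K(j) - 2c₁). It has to be
-- shown that ν is a test and that its weight in the aggregate is large.
--
-- That ν is a test follows from the coding theorem. Given n and the program for E, the numbers Tr
-- E_i μ can be approximated from below. Since the E_i add up to the identity and μ is a mixture of
-- unit vectors weighted by halting programs, they are dominated by a semimeasure with computable
-- increasing approximations. Hence Tr E_i μ ≤ 2^(c₁ - K(i))
-- (`Machine.IsUniversal.exists_trace_mul_mu_le`, from `Machine.IsUniversal.exists_K_le`), and the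
-- product of two such bounds gives Tr ν(μ ⊗ μ) ≤ 1.
--
-- The weight of ν is bounded by describing ν. The complexities K(i) and K(j) are not computable,
-- but their sum is I + K(i,j). A decoder reads a shortest program for the pair (i,j), then a
-- shortest program for I. The first yields i and j, and its length is K(i,j); adding I gives the
-- exponent of s. The matrices E_i and E_j are obtained by running the program for E. So ν is an
-- explicit elementary matrix, and the decoder outputs a program that prints it, which lower
-- computes ν as a constant sequence. Halting programs are prefix-free, so the two programs need no
-- separator and the weight is at least 2^(-K(i,j) - K(I) - O(1))
-- (`Machine.IsUniversal.exists_le_lowerProb`).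
--
-- All terms of the aggregate are positive semidefinite, so its value at σ ⊗ ρ is at least that of
-- the single term of ν, namely 2^(I - K(I) - O(1)) Eσ(i) Eρ(j)
-- (`Machine.IsUniversal.exists_le_trace_aggregate`). Logarithms give the theorem.
--
-- Two further matters need care. The series for the aggregate must converge, for otherwise its
-- `tsum` would have a default value; this holds because μ dominates a positive multiple of the
-- identity, which bounds the traces of the tests. And every procedure must be an actual machine
-- before universality applies: rational arithmetic, codes and runs are shown computable, and
-- `Decision.machine` turns a computable procedure that asks for bits one at a time into a machine.

theorem encode_int_ofNat (n : ℕ) : Encodable.encode (n : ℤ) = 2 * n := rfl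

theorem encode_int_negSucc (n : ℕ) : Encodable.encode (Int.negSucc n) = 2 * n + 1 := rfl

/-- The parity of the code is the sign: `n` has the code `2n` and `-(n + 1)` has the code `2n + 1`.
-/
theorem primrec_int_toNat : Primrec Int.toNat := by
  have h : Primrec fun z : ℤ => if Encodable.encode z % 2 = 0 then Encodable.encode z / 2 else 0 :=
    Primrec.ite (Primrec.eq.comp (Primrec.nat_mod.comp Primrec.encode (Primrec.const 2))
      (Primrec.const 0)) (Primrec.nat_div.comp Primrec.encode (Primrec.const 2)) (Primrec.const 0)
  refine h.of_eq fun z => ?_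
  cases z with
  | ofNat n => simp [show Encodable.encode (n : ℤ) = 2 * n from rfl]
  | negSucc n =>
    rw [show Encodable.encode (Int.negSucc n) = 2 * n + 1 from rfl, if_neg (by omega)]
    rfl

theorem primrec_int_neg_toNat : Primrec fun z : ℤ => (-z).toNat := by
  have h : Primrec fun z : ℤ =>
      if Encodable.encode z % 2 = 0 then 0 else Encodable.encode z / 2 + 1 :=
    Primrec.ite (Primrec.eq.comp (Primrec.nat_mod.comp Primrec.encode (Primrec.const 2))
      (Primrec.const 0)) (Primrec.const 0)
      (Primrec.succ.comp (Primrec.nat_div.comp Primrec.encode (Primrec.const 2)))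
  refine h.of_eq fun z => ?_
  cases z with
  | ofNat n => simp [show Encodable.encode (n : ℤ) = 2 * n from rfl]
  | negSucc n =>
    rw [show Encodable.encode (Int.negSucc n) = 2 * n + 1 from rfl, if_neg (by omega),
      Int.neg_negSucc]
    simp only [Int.toNat_natCast]
    omega

theorem primrec_natCast_sub : Primrec₂ fun m n : ℕ => (m : ℤ) - n := by
  have h : Primrec₂ fun m n : ℕ =>
      Denumerable.ofNat ℤ (if n ≤ m then 2 * (m - n) else 2 * (n - m - 1) + 1) := by
    refine (Primrec.ofNat ℤ).comp (Primrec.ite (Primrec.nat_le.comp Primrec.snd Primrec.fst) ?_ ?_)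
    · exact Primrec.nat_double.comp (Primrec.nat_sub.comp Primrec.fst Primrec.snd)
    · exact Primrec.nat_double_succ.comp (Primrec.nat_sub.comp
        (Primrec.nat_sub.comp Primrec.snd Primrec.fst) (Primrec.const 1))
  refine h.of_eq fun m n => ?_
  split_ifs with hmn
  · rw [← encode_int_ofNat, Denumerable.ofNat_encode]
    omega
  · rw [← encode_int_negSucc, Denumerable.ofNat_encode]
    omega

theorem Primrec.int_cast {α : Type*} [Primcodable α] {f : α → ℕ} (hf : Primrec f) :
    Primrec fun a => (f a : ℤ) :=
  (primrec_natCast_sub.comp hf (Primrec.const 0)).of_eq fun a => by simp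

/-- An integer is the difference of the natural numbers `x.toNat` and `(-x).toNat`, and
`primrec_natCast_sub` turns such differences back into integers. This reduces the ring operations to
those of the natural numbers. -/
theorem primrec_int_add : Primrec₂ fun x y : ℤ => x + y := by
  have h : Primrec₂ fun x y : ℤ =>
      ((x.toNat + y.toNat : ℕ) : ℤ) - ((-x).toNat + (-y).toNat : ℕ) :=
    primrec_natCast_sub.comp
      (Primrec.nat_add.comp (primrec_int_toNat.comp Primrec.fst) (primrec_int_toNat.comp Primrec.snd))
      (Primrec.nat_add.comp (primrec_int_neg_toNat.comp Primrec.fst)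
        (primrec_int_neg_toNat.comp Primrec.snd))
  exact h.of_eq fun x y => by omega

theorem primrec_int_mul : Primrec₂ fun x y : ℤ => x * y := by
  have h : Primrec₂ fun x y : ℤ =>
      ((x.toNat * y.toNat + (-x).toNat * (-y).toNat : ℕ) : ℤ) -
        (x.toNat * (-y).toNat + (-x).toNat * y.toNat : ℕ) := by
    have a1 : Primrec fun p : ℤ × ℤ => p.1.toNat := primrec_int_toNat.comp Primrec.fst
    have a2 : Primrec fun p : ℤ × ℤ => p.2.toNat := primrec_int_toNat.comp Primrec.snd
    have b1 : Primrec fun p : ℤ × ℤ => (-p.1).toNat := primrec_int_neg_toNat.comp Primrec.fst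
    have b2 : Primrec fun p : ℤ × ℤ => (-p.2).toNat := primrec_int_neg_toNat.comp Primrec.snd
    exact primrec_natCast_sub.comp
      (Primrec.nat_add.comp (Primrec.nat_mul.comp a1 a2) (Primrec.nat_mul.comp b1 b2))
      (Primrec.nat_add.comp (Primrec.nat_mul.comp a1 b2) (Primrec.nat_mul.comp b1 a2))
  refine h.of_eq fun x y => ?_
  have hx : x = (x.toNat : ℤ) - ((-x).toNat : ℕ) := by omega
  have hy : y = (y.toNat : ℤ) - ((-y).toNat : ℕ) := by omega
  conv_rhs => rw [hx, hy]
  push_cast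
  ring

theorem primrec_int_neg : Primrec fun x : ℤ => -x := by
  have h : Primrec fun x : ℤ => ((-x).toNat : ℤ) - (x.toNat : ℕ) :=
    primrec_natCast_sub.comp primrec_int_neg_toNat primrec_int_toNat
  exact h.of_eq fun x => by omega

theorem primrec_int_natAbs : Primrec Int.natAbs := by
  have h : Primrec fun x : ℤ => x.toNat + (-x).toNat :=
    Primrec.nat_add.comp primrec_int_toNat primrec_int_neg_toNat
  exact h.of_eq fun x => by omega

theorem primrec_int_le : PrimrecRel fun x y : ℤ => x ≤ y := by
  have h : PrimrecRel fun x y : ℤ => (x + -y).toNat = 0 :=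
    Primrec.eq.comp (primrec_int_toNat.comp (primrec_int_add.comp Primrec.fst
      (primrec_int_neg.comp Primrec.snd))) (Primrec.const 0)
  exact h.of_eq fun x y => by omega

theorem primrec_nat_pow : Primrec₂ fun a b : ℕ => a ^ b :=
  Primrec₂.unpaired'.1 Nat.Primrec.pow

/-- Bounded search for the greatest common divisor below `a + b`. This bound also serves when one of
the numbers is zero, and it gives 0 when both are. -/
theorem primrec_nat_gcd : Primrec₂ Nat.gcd := by
  have h : Primrec₂ fun a b : ℕ => Nat.findGreatest (fun k => a % k = 0 ∧ b % k = 0) (a + b) := by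
    refine Primrec.nat_findGreatest (f := fun p : ℕ × ℕ => p.1 + p.2)
      (p := fun p k => p.1 % k = 0 ∧ p.2 % k = 0) (Primrec.nat_add.comp Primrec.fst Primrec.snd) ?_
    refine PrimrecPred.and ?_ ?_
    · exact Primrec.eq.comp (Primrec.nat_mod.comp (Primrec.fst.comp Primrec.fst) Primrec.snd)
        (Primrec.const 0)
    · exact Primrec.eq.comp (Primrec.nat_mod.comp (Primrec.snd.comp Primrec.fst) Primrec.snd)
        (Primrec.const 0)
  refine h.of_eq fun a b => ?_
  rcases Nat.eq_zero_or_pos (a + b) with h0 | h0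
  · obtain rfl : a = 0 := by omega
    obtain rfl : b = 0 := by omega
    rfl
  rw [Nat.findGreatest_eq_iff]
  have hg : 0 < Nat.gcd a b := by
    rcases Nat.eq_zero_or_pos a with rfl | ha
    · exact Nat.gcd_pos_of_pos_right _ (by omega)
    · exact Nat.gcd_pos_of_pos_left _ ha
  refine ⟨?_, fun _ => ⟨Nat.mod_eq_zero_of_dvd (Nat.gcd_dvd_left a b),
    Nat.mod_eq_zero_of_dvd (Nat.gcd_dvd_right a b)⟩, fun k hk _ h2 => ?_⟩
  · exact Nat.le_of_dvd h0 (Nat.dvd_add (Nat.gcd_dvd_left a b) (Nat.gcd_dvd_right a b))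
  · exact absurd (Nat.le_of_dvd hg (Nat.dvd_gcd (Nat.dvd_of_mod_eq_zero h2.1)
      (Nat.dvd_of_mod_eq_zero h2.2))) (by omega)

/-- Fractions in lowest terms. -/
abbrev LowestTerms : Type := {x : ℤ × ℕ // 0 < x.2 ∧ x.1.natAbs.gcd x.2 = 1}

theorem primrecPred_lowestTerms :
    PrimrecPred fun x : ℤ × ℕ => 0 < x.2 ∧ x.1.natAbs.gcd x.2 = 1 :=
  PrimrecPred.and (Primrec.nat_lt.comp (Primrec.const 0) Primrec.snd)
    (Primrec.eq.comp (primrec_nat_gcd.comp (primrec_int_natAbs.comp Primrec.fst) Primrec.snd)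
      (Primrec.const 1))

def ratEquivLowestTerms : ℚ ≃ LowestTerms where
  toFun x := ⟨(x.num, x.den), x.den_pos, x.reduced⟩
  invFun x := ⟨x.1.1, x.1.2, x.2.1.ne', x.2.2⟩
  left_inv _ := rfl
  right_inv _ := rfl

instance : Primcodable LowestTerms := Primcodable.subtype primrecPred_lowestTerms

/-- The code of a rational number is thereby that of the pair of its numerator and denominator,
which is `ratCode` by definition. The `Encodable` instance below makes the codes of lists of
rationals use the same encoding; `encode_ofFn_vec` depends on this. -/
instance : Primcodable ℚ := Primcodable.ofEquiv LowestTerms ratEquivLowestTerms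

instance : Encodable ℚ := Primcodable.toEncodable

theorem primrec_rat_repr : Primrec fun x : ℚ => (x.num, x.den) :=
  (Primrec.subtype_val (hp := primrecPred_lowestTerms)).comp
    (Primrec.of_equiv (e := ratEquivLowestTerms))

theorem primrec_rat_num : Primrec fun x : ℚ => x.num := Primrec.fst.comp primrec_rat_repr

theorem primrec_rat_den : Primrec fun x : ℚ => x.den := Primrec.snd.comp primrec_rat_repr

/-- `x` is a primitive recursive function if its numerator and denominator are. -/
theorem primrec_rat_of_repr {α : Type*} [Primcodable α] {f : α → ℚ}
    (h1 : Primrec fun a => (f a).num) (h2 : Primrec fun a => (f a).den) : Primrec f := by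
  have h : Primrec fun a => ratEquivLowestTerms (f a) :=
    (Primrec.subtype_mk (hp := primrecPred_lowestTerms) (h := fun a => (ratEquivLowestTerms (f a)).2)
      (h1.pair h2))
  exact (Primrec.of_equiv_iff ratEquivLowestTerms).1 h

/-- Numerator and denominator are divided by their gcd. The numerator is split into positive and
negative part, one of which is zero, so that only natural division occurs. Denominator zero gives
the value 0 on both sides. -/
theorem primrec_mkRat : Primrec₂ fun (z : ℤ) (d : ℕ) => (z : ℚ) / d := by
  have hg : Primrec fun p : ℤ × ℕ => p.1.natAbs.gcd p.2 :=
    primrec_nat_gcd.comp (primrec_int_natAbs.comp Primrec.fst) Primrec.snd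
  have hn : Primrec fun p : ℤ × ℕ => (mkRat p.1 p.2).num := by
    have : Primrec fun p : ℤ × ℕ => if p.2 = 0 then 0 else
        ((p.1.toNat / p.1.natAbs.gcd p.2 : ℕ) : ℤ) - ((-p.1).toNat / p.1.natAbs.gcd p.2 : ℕ) :=
      Primrec.ite (Primrec.eq.comp Primrec.snd (Primrec.const 0)) (Primrec.const 0)
        (primrec_natCast_sub.comp (Primrec.nat_div.comp (primrec_int_toNat.comp Primrec.fst) hg)
          (Primrec.nat_div.comp (primrec_int_neg_toNat.comp Primrec.fst) hg))
    refine this.of_eq fun p => ?_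
    rw [Rat.num_mkRat]
    split_ifs with h0
    · rfl
    rw [Nat.gcd_comm]
    rcases le_total 0 p.1 with h | h
    · rw [show (-p.1).toNat = 0 by omega, Nat.zero_div]
      push_cast
      rw [Int.toNat_of_nonneg h, sub_zero]
    · rw [show p.1.toNat = 0 by omega, Nat.zero_div]
      push_cast
      rw [Int.toNat_of_nonneg (by omega), Int.neg_ediv_of_dvd
        (Int.natCast_dvd.2 (Nat.gcd_dvd_right _ _))]
      omega
  have hd : Primrec fun p : ℤ × ℕ => (mkRat p.1 p.2).den := by
    have : Primrec fun p : ℤ × ℕ => if p.2 = 0 then 1 else p.2 / p.1.natAbs.gcd p.2 :=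
      Primrec.ite (Primrec.eq.comp Primrec.snd (Primrec.const 0)) (Primrec.const 1)
        (Primrec.nat_div.comp Primrec.snd hg)
    refine this.of_eq fun p => ?_
    rw [Rat.den_mkRat, Nat.gcd_comm]
  exact (primrec_rat_of_repr hn hd).of_eq fun p => by rw [Rat.mkRat_eq_div]

theorem primrec_rat_add : Primrec₂ fun x y : ℚ => x + y := by
  have h : Primrec₂ fun x y : ℚ => (((x.num * y.den + y.num * x.den : ℤ) : ℚ) / (x.den * y.den : ℕ)) := by
    refine primrec_mkRat.comp (primrec_int_add.comp (primrec_int_mul.comp ?_ ?_)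
      (primrec_int_mul.comp ?_ ?_)) (Primrec.nat_mul.comp ?_ ?_)
    · exact primrec_rat_num.comp Primrec.fst
    · exact Primrec.int_cast (primrec_rat_den.comp Primrec.snd)
    · exact primrec_rat_num.comp Primrec.snd
    · exact Primrec.int_cast (primrec_rat_den.comp Primrec.fst)
    · exact primrec_rat_den.comp Primrec.fst
    · exact primrec_rat_den.comp Primrec.snd
  refine h.of_eq fun x y => ?_
  conv_rhs => rw [← Rat.num_div_den x, ← Rat.num_div_den y]
  have := x.den_nz
  have := y.den_nz
  push_cast
  field_simp

theorem primrec_rat_mul : Primrec₂ fun x y : ℚ => x * y := by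
  have h : Primrec₂ fun x y : ℚ => (((x.num * y.num : ℤ) : ℚ) / (x.den * y.den : ℕ)) := by
    refine primrec_mkRat.comp (primrec_int_mul.comp ?_ ?_) (Primrec.nat_mul.comp ?_ ?_)
    · exact primrec_rat_num.comp Primrec.fst
    · exact primrec_rat_num.comp Primrec.snd
    · exact primrec_rat_den.comp Primrec.fst
    · exact primrec_rat_den.comp Primrec.snd
  refine h.of_eq fun x y => ?_
  conv_rhs => rw [← Rat.num_div_den x, ← Rat.num_div_den y]
  push_cast
  field_simp

theorem primrec_rat_neg : Primrec fun x : ℚ => -x :=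
  (primrec_rat_mul.comp (Primrec.const (-1)) Primrec.id).of_eq fun x => by simp

theorem primrec_rat_sub : Primrec₂ fun x y : ℚ => x - y :=
  (primrec_rat_add.comp Primrec.fst (primrec_rat_neg.comp Primrec.snd)).of_eq fun p =>
    (sub_eq_add_neg p.1 p.2).symm

theorem primrec_rat_le : PrimrecRel fun x y : ℚ => x ≤ y := by
  have h : PrimrecRel fun x y : ℚ => (x - y).num ≤ 0 :=
    primrec_int_le.comp (primrec_rat_num.comp primrec_rat_sub) (Primrec.const 0)
  exact h.of_eq fun x y => by rw [Rat.num_nonpos, sub_nonpos]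

theorem primrec_rat_lt : PrimrecRel fun x y : ℚ => x < y :=
  (primrec_rat_le.comp Primrec.snd Primrec.fst).not.of_eq fun p => by simp

theorem primrec_inv_two_pow : Primrec fun n : ℕ => ((2 : ℚ) ^ n)⁻¹ :=
  (primrec_mkRat.comp (Primrec.const 1) (primrec_nat_pow.comp (Primrec.const 2) Primrec.id)).of_eq
    fun n => by simp

theorem primrec_natCast_rat : Primrec fun n : ℕ => (n : ℚ) :=
  (primrec_mkRat.comp (Primrec.int_cast Primrec.id) (Primrec.const 1)).of_eq fun n => by simp

theorem computable_sum_range {α : Type*} [Primcodable α] {f : α → ℕ → ℚ} {g : α → ℕ}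
    (hf : Computable₂ f) (hg : Computable g) :
    Computable fun a => ∑ k ∈ Finset.range (g a), f a k := by
  have h : Computable fun a => Nat.rec (motive := fun _ => ℚ) 0 (fun k s => s + f a k) (g a) := by
    refine Computable.nat_rec (h := fun a (p : ℕ × ℚ) => p.2 + f a p.1) hg
      (Computable.const (0 : ℚ)) ?_
    refine primrec_rat_add.to_comp.comp (Computable.snd.comp Computable.snd) ?_
    exact hf.comp Computable.fst (Computable.fst.comp Computable.snd)
  refine h.of_eq fun a => ?_
  induction g a with
  | zero => rfl
  | succ n ih => rw [Finset.sum_range_succ, ← ih]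

/-! ## Runs of machines -/

namespace Machine

variable (M : Machine)

theorem next_of_halted {c : Config M.State} (h : M.step c.state = none) : M.next c = c := by
  simp [next, h]

theorem next_of_starved {c : Config M.State} (h : M.Starved c) : M.next c = c := by
  obtain ⟨h1, s₀, s₁, h2⟩ := h
  obtain ⟨s, l, o⟩ := c
  subst h1
  simp only at h2
  simp [next, h2]

theorem conf_add_of_next_eq {w : List ℕ} {p : List Bool} {t : ℕ}
    (h : M.next (M.conf w p t) = M.conf w p t) (k : ℕ) : M.conf w p (t + k) = M.conf w p t := by
  induction k with
  | zero => rfl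
  | succ k ih => rw [← Nat.add_assoc, conf_succ, ih, h]

theorem conf_eq_of_le {w : List ℕ} {p : List Bool} {t t' : ℕ}
    (h : M.next (M.conf w p t) = M.conf w p t) (ht : t ≤ t') : M.conf w p t' = M.conf w p t := by
  obtain ⟨k, rfl⟩ := Nat.exists_eq_add_of_le ht
  exact M.conf_add_of_next_eq h k

/-- A run comes to rest in at most one configuration. -/
theorem conf_eq_of_next_eq {w : List ℕ} {p : List Bool} {t t' : ℕ}
    (h : M.next (M.conf w p t) = M.conf w p t) (h' : M.next (M.conf w p t') = M.conf w p t') :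
    M.conf w p t = M.conf w p t' := by
  rcases le_total t t' with ht | ht
  · exact (M.conf_eq_of_le h ht).symm
  · exact M.conf_eq_of_le h' ht

/-- Halted and starved configurations are both fixed by `next`, and a run has only one configuration
of rest. -/
theorem not_starved_of_halted {w : List ℕ} {p : List Bool} {t : ℕ}
    (h : M.step (M.conf w p t).state = none) (t' : ℕ) : ¬ M.Starved (M.conf w p t') := by
  intro hs
  have := M.conf_eq_of_next_eq (M.next_of_halted h) (M.next_of_starved hs)
  obtain ⟨-, s₀, s₁, h2⟩ := hs
  rw [← this, h] at h2
  cases h2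

theorem readsWithin_of_halted {w : List ℕ} {p : List Bool} {t : ℕ}
    (h : M.step (M.conf w p t).state = none) : M.ReadsWithin w p :=
  M.not_starved_of_halted h

theorem output_prefix_next (c : Config M.State) : c.output <+: (M.next c).output := by
  obtain ⟨s, l, o⟩ := c
  simp only [next]
  rcases M.step s with _ | a | ⟨a, b⟩ | ⟨x, a⟩
  · exact List.prefix_refl o
  · exact List.prefix_refl o
  · cases l <;> exact List.prefix_refl o
  · exact List.prefix_append _ _

theorem output_prefix (w : List ℕ) (p : List Bool) {t t' : ℕ} (h : t ≤ t') :
    (M.conf w p t).output <+: (M.conf w p t').output := by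
  induction h with
  | refl => exact List.prefix_refl _
  | step _ ih => exact ih.trans (by rw [conf_succ]; exact M.output_prefix_next _)

theorem getElem?_of_prefix {α : Type*} {l l' : List α} (h : l <+: l') {k : ℕ} {x : α}
    (hx : l[k]? = some x) : l'[k]? = some x := by
  obtain ⟨r, rfl⟩ := h
  rw [List.getElem?_append_left (List.getElem?_eq_some_iff.1 hx).1, hx]

theorem output_mono {w : List ℕ} {p : List Bool} {t t' : ℕ} (h : t ≤ t') {k x : ℕ}
    (hx : (M.conf w p t).output[k]? = some x) : (M.conf w p t').output[k]? = some x :=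
  getElem?_of_prefix (M.output_prefix w p h) hx

theorem emits_unique {w : List ℕ} {p : List Bool} {k x y : ℕ} (hx : M.Emits w p k x)
    (hy : M.Emits w p k y) : x = y := by
  obtain ⟨t, ht⟩ := hx
  obtain ⟨t', ht'⟩ := hy
  have h1 := M.output_mono (le_max_left t t') ht
  rw [M.output_mono (le_max_right t t') ht'] at h1
  exact (Option.some.inj h1).symm

theorem emits_iff_of_halted {w : List ℕ} {p : List Bool} {t : ℕ}
    (h : M.step (M.conf w p t).state = none) (k x : ℕ) :
    M.Emits w p k x ↔ (M.conf w p t).output[k]? = some x := by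
  refine ⟨?_, fun hx => ⟨t, hx⟩⟩
  rintro ⟨t', ht'⟩
  have := M.output_mono (le_max_right t t') ht'
  rwa [M.conf_eq_of_le (M.next_of_halted h) (le_max_left t t')] at this

/-- Bits beyond those that the machine has read do not influence the run. -/
theorem conf_append {w : List ℕ} {p : List Bool} (r : List Bool) {t : ℕ}
    (h : ∀ t' < t, ¬ M.Starved (M.conf w p t')) :
    M.conf w (p ++ r) t =
      ⟨(M.conf w p t).state, (M.conf w p t).input ++ r, (M.conf w p t).output⟩ := by
  induction t with
  | zero => rfl
  | succ t ih =>
    have hs := h t (Nat.lt_succ_self t)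
    rw [conf_succ, ih fun t' ht' => h t' (ht'.trans (Nat.lt_succ_self t)), conf_succ M w p]
    revert hs
    generalize M.conf w p t = c
    obtain ⟨s, l, o⟩ := c
    intro hs
    simp only [next]
    rcases hst : M.step s with _ | a | ⟨a, b⟩ | ⟨x, a⟩
    · rfl
    · rfl
    · cases l with
      | nil => exact absurd ⟨rfl, a, b, hst⟩ hs
      | cons b' l => rfl
    · rfl

theorem halted_append {w : List ℕ} {p : List Bool} (r : List Bool) {t : ℕ}
    (h : M.step (M.conf w p t).state = none) : M.conf w (p ++ r) t =
      ⟨(M.conf w p t).state, (M.conf w p t).input ++ r, (M.conf w p t).output⟩ :=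
  M.conf_append r fun t' _ => M.not_starved_of_halted h t'

/-- Halting programs are prefix-free: on `p ++ r` the machine halts as it does on `p`, with `r`
unread, whereas a program has to be read to its end. -/
theorem Outputs.eq_of_append {w : List ℕ} {p r : List Bool} {x y : ℕ} (hp : M.Outputs w p x)
    (hq : M.Outputs w (p ++ r) y) : r = [] ∧ x = y := by
  obtain ⟨t, h1, h2, h3⟩ := hp
  obtain ⟨t', h1', h2', h3'⟩ := hq
  have ha := M.halted_append r h1
  have hh : M.step (M.conf w (p ++ r) t).state = none := by rw [ha]; exact h1
  have he := M.conf_eq_of_next_eq (M.next_of_halted hh) (M.next_of_halted h1')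
  rw [← he, ha] at h2' h3'
  rw [h2] at h2'
  rw [h3] at h3'
  exact ⟨h2', by simpa using h3'⟩

theorem Outputs.unique {w : List ℕ} {p : List Bool} {x y : ℕ} (hp : M.Outputs w p x)
    (hq : M.Outputs w p y) : x = y :=
  (Outputs.eq_of_append M (r := []) hp (by rwa [List.append_nil])).2

/-- On a proper initial segment of a halting program the machine starves. -/
theorem starved_of_outputs_append {w : List ℕ} {p r : List Bool} {x : ℕ}
    (h : M.Outputs w (p ++ r) x) (hr : r ≠ []) : ∃ t, M.Starved (M.conf w p t) := by
  by_contra hc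
  push Not at hc
  obtain ⟨t, -, h2, -⟩ := h
  rw [M.conf_append r fun t' _ => hc t'] at h2
  exact hr (List.append_eq_nil_iff.1 h2).2

/-! ### The run as a computable function -/

/-- A configuration as a triple. -/
def triple (c : Config M.State) : M.State × List Bool × List ℕ := (c.state, c.input, c.output)

/-- One step of a run, on triples. -/
def nextTriple (c : M.State × List Bool × List ℕ) : M.State × List Bool × List ℕ :=
  Option.casesOn (M.step c.1) c fun i =>
    Sum.casesOn i (fun s => (s, c.2)) fun j =>
      Sum.casesOn j
        (fun s => Option.casesOn c.2.1.head? c fun b => (bif b then s.2 else s.1, c.2.1.tail, c.2.2))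
        fun x => (x.2, c.2.1, c.2.2 ++ [x.1])

theorem triple_next (c : Config M.State) : M.triple (M.next c) = M.nextTriple (M.triple c) := by
  obtain ⟨s, l, o⟩ := c
  simp only [next, triple, nextTriple]
  rcases M.step s with _ | a | ⟨a, b⟩ | ⟨x, a⟩
  · rfl
  · rfl
  · cases l <;> rfl
  · rfl

theorem nextTriple_computable : Computable M.nextTriple := by
  unfold nextTriple
  refine Computable.option_casesOn (M.step_computable.comp Computable.fst) Computable.id ?_
  refine Computable.sumCasesOn Computable.snd ?_ ?_
  · exact Computable.pair Computable.snd (Computable.snd.comp (Computable.fst.comp Computable.fst))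
  · have hc : Computable fun a : (((M.State × List Bool × List ℕ) × (M.State ⊕ (M.State × M.State) ⊕ (ℕ × M.State))) ×
        ((M.State × M.State) ⊕ (ℕ × M.State))) => a.1.1 :=
      Computable.fst.comp Computable.fst
    refine Computable.sumCasesOn Computable.snd ?_ ?_
    · have hc := hc.comp (Computable.fst (β := M.State × M.State))
      refine Computable.option_casesOn (Primrec.list_head?.to_comp.comp
        (Computable.fst.comp (Computable.snd.comp hc))) hc ?_
      have hc := hc.comp (Computable.fst (β := Bool))
      refine Computable.pair (Computable.cond Computable.snd ?_ ?_) (Computable.pair ?_ ?_)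
      · exact Computable.snd.comp (Computable.snd.comp Computable.fst)
      · exact Computable.fst.comp (Computable.snd.comp Computable.fst)
      · exact Primrec.list_tail.to_comp.comp (Computable.fst.comp (Computable.snd.comp hc))
      · exact Computable.snd.comp (Computable.snd.comp hc)
    · have hc := hc.comp (Computable.fst (β := ℕ × M.State))
      refine Computable.pair (Computable.snd.comp Computable.snd) (Computable.pair ?_ ?_)
      · exact Computable.fst.comp (Computable.snd.comp hc)
      · exact Computable.list_concat.comp (Computable.snd.comp (Computable.snd.comp hc))
          (Computable.fst.comp Computable.snd)

theorem triple_conf_computable :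
    Computable fun a : List ℕ × List Bool × ℕ => M.triple (M.conf a.1 a.2.1 a.2.2) := by
  have h : Computable fun a : List ℕ × List Bool × ℕ =>
      Nat.rec (motive := fun _ => M.State × List Bool × List ℕ) (M.start a.1, a.2.1, [])
        (fun _ c => M.nextTriple c) a.2.2 := by
    refine Computable.nat_rec
      (h := fun _ (p : ℕ × (M.State × List Bool × List ℕ)) => M.nextTriple p.2)
      (Computable.snd.comp Computable.snd) ?_ ?_
    · exact Computable.pair (M.start_computable.comp Computable.fst)
        (Computable.pair (Computable.fst.comp Computable.snd) (Computable.const []))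
    · exact M.nextTriple_computable.comp (Computable.snd.comp Computable.snd)
  refine h.of_eq fun a => ?_
  induction a.2.2 with
  | zero => rfl
  | succ t ih => rw [conf_succ, triple_next, ← ih]

theorem conf_input_computable :
    Computable fun a : List ℕ × List Bool × ℕ => (M.conf a.1 a.2.1 a.2.2).input :=
  Computable.fst.comp (Computable.snd.comp M.triple_conf_computable)

theorem conf_output_computable :
    Computable fun a : List ℕ × List Bool × ℕ => (M.conf a.1 a.2.1 a.2.2).output :=
  Computable.snd.comp (Computable.snd.comp M.triple_conf_computable)

/-- The machine has halted. -/
def haltedB (s : M.State) : Bool := (M.step s).isNone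

/-- The machine wants to read a bit. -/
def readingB (s : M.State) : Bool :=
  Option.casesOn (M.step s) false fun i =>
    Sum.casesOn i (fun _ => false) fun j => Sum.casesOn j (fun _ => true) fun _ => false

theorem haltedB_iff (s : M.State) : M.haltedB s = true ↔ M.step s = none := by
  simp [haltedB]

theorem readingB_iff (s : M.State) :
    M.readingB s = true ↔ ∃ s₀ s₁, M.step s = some (Sum.inr (Sum.inl (s₀, s₁))) := by
  unfold readingB
  rcases M.step s with _ | a | ⟨a, b⟩ | ⟨x, a⟩ <;> simp

theorem halted_computable :
    Computable fun a : List ℕ × List Bool × ℕ => M.haltedB (M.conf a.1 a.2.1 a.2.2).state := by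
  have h : Computable fun s : M.State => (M.step s).isNone :=
    (Primrec.not.to_comp.comp (Primrec.option_isSome.to_comp.comp M.step_computable)).of_eq
      fun s => by cases M.step s <;> rfl
  exact h.comp (Computable.fst.comp M.triple_conf_computable)

theorem reading_computable :
    Computable fun a : List ℕ × List Bool × ℕ => M.readingB (M.conf a.1 a.2.1 a.2.2).state := by
  have h : Computable M.readingB := by
    unfold readingB
    refine Computable.option_casesOn M.step_computable (Computable.const false) ?_
    refine Computable.sumCasesOn Computable.snd (Computable.const false).to₂ ?_
    exact Computable.sumCasesOn Computable.snd (Computable.const true).to₂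
      (Computable.const false).to₂
  exact h.comp (Computable.fst.comp M.triple_conf_computable)

end Machine

/-! ## Machines given by a decision procedure -/

/-- Given the auxiliary tapes, the bits read so far and a time bound, the procedure either needs
more time (`none`), or asks for one more bit (`some none`), or gives the output. -/
abbrev Decision : Type := List ℕ × List Bool × ℕ → Option (Option ℕ)

namespace Decision

/-- Transition table of the machine that follows the procedure `D`. -/
def step (D : Decision) :
    Option (List ℕ × List Bool × ℕ) → Instr (Option (List ℕ × List Bool × ℕ)) := fun s =>
  Option.casesOn s none fun a =>
    Option.casesOn (D a) (some (Sum.inl (some (a.1, a.2.1, a.2.2 + 1)))) fun v =>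
      some (Sum.inr (Option.casesOn v
        (Sum.inl (some (a.1, a.2.1 ++ [false], 0), some (a.1, a.2.1 ++ [true], 0)))
        fun x => Sum.inr (x, none)))

theorem step_computable {D : Decision} (hD : Computable D) : Computable (step D) := by
  unfold step
  refine Computable.option_casesOn Computable.id (Computable.const none) ?_
  have ha : Computable fun b : Option (List ℕ × List Bool × ℕ) × (List ℕ × List Bool × ℕ) => b.2 :=
    Computable.snd
  have h1 : Computable fun b : Option (List ℕ × List Bool × ℕ) × (List ℕ × List Bool × ℕ) => b.2.1 :=
    Computable.fst.comp Computable.snd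
  have h2 : Computable fun b : Option (List ℕ × List Bool × ℕ) × (List ℕ × List Bool × ℕ) => b.2.2.1 :=
    Computable.fst.comp (Computable.snd.comp Computable.snd)
  have h3 : Computable fun b : Option (List ℕ × List Bool × ℕ) × (List ℕ × List Bool × ℕ) => b.2.2.2 :=
    Computable.snd.comp (Computable.snd.comp Computable.snd)
  refine Computable.option_casesOn (hD.comp ha) ?_ ?_
  · exact Computable.option_some.comp (Computable.sumInl.comp (Computable.option_some.comp
      (Computable.pair h1 (Computable.pair h2 (Computable.succ.comp h3)))))
  · refine Computable.option_some.comp (Computable.sumInr.comp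
      (Computable.option_casesOn Computable.snd ?_ ?_))
    · have h1 := h1.comp (Computable.fst (β := Option ℕ))
      have h2 := h2.comp (Computable.fst (β := Option ℕ))
      refine Computable.sumInl.comp (Computable.pair ?_ ?_)
      · exact Computable.option_some.comp (Computable.pair h1 (Computable.pair
          (Computable.list_concat.comp h2 (Computable.const false)) (Computable.const 0)))
      · exact Computable.option_some.comp (Computable.pair h1 (Computable.pair
          (Computable.list_concat.comp h2 (Computable.const true)) (Computable.const 0)))
    · exact Computable.sumInr.comp (Computable.pair Computable.snd (Computable.const none))

/-- The machine that follows the procedure `D`. -/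
def machine (D : Decision) (hD : Computable D) : Machine where
  State := Option (List ℕ × List Bool × ℕ)
  primcodable := inferInstance
  start w := some (w, [], 0)
  step := step D
  start_computable := Computable.option_some.comp (Computable.pair Computable.id
    (Computable.const ([], 0)))
  step_computable := step_computable hD

/-- On the bits `p` the procedure comes to the decision `v`. -/
def Decides (D : Decision) (w : List ℕ) (p : List Bool) (v : Option ℕ) : Prop :=
  ∃ t, D (w, p, t) = some v ∧ ∀ t' < t, D (w, p, t') = none

theorem exists_decides {D : Decision} {w : List ℕ} {p : List Bool}
    (h : ∃ t, D (w, p, t) ≠ none) : ∃ v, D.Decides w p v := by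
  classical
  obtain ⟨v, hv⟩ := Option.ne_none_iff_exists'.1 (Nat.find_spec h)
  exact ⟨v, Nat.find h, hv, fun t' ht' => not_not.1 (Nat.find_min h ht')⟩

section

variable {D : Decision} (hD : Computable D) {w : List ℕ}

theorem wait {p q r : List Bool} {t a : ℕ} (h : ∀ t' < t, D (w, p, t') = none)
    (ha : (machine D hD).conf w q a = ⟨some (w, p, 0), r, []⟩) {k : ℕ} (hk : k ≤ t) :
    (machine D hD).conf w q (a + k) = ⟨some (w, p, k), r, []⟩ := by
  induction k with
  | zero => exact ha
  | succ k ih =>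
    rw [← Nat.add_assoc, Machine.conf_succ, ih (by omega)]
    simp only [Machine.next, machine, step, h k (by omega)]

/-- Induction on the last bit. The procedure asks for a further bit on each proper initial segment,
and its clock restarts at 0 after each bit. -/
theorem exists_conf {p r : List Bool}
    (h : ∀ p' b, p' ++ [b] <+: p → D.Decides w p' none) :
    ∃ a, (machine D hD).conf w (p ++ r) a = ⟨some (w, p, 0), r, []⟩ := by
  induction p using List.reverseRecOn generalizing r with
  | nil => exact ⟨0, rfl⟩
  | append_singleton p b ih =>
    obtain ⟨a, ha⟩ := ih (r := b :: r) fun p' b' hp' => h p' b' (hp'.trans (List.prefix_append _ _))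
    obtain ⟨t, ht, ht'⟩ := h p b (List.prefix_refl _)
    have hw := wait hD ht' ha le_rfl
    refine ⟨a + t + 1, ?_⟩
    rw [List.append_assoc, List.singleton_append, Machine.conf_succ, hw]
    simp only [Machine.next, machine, step, ht]
    cases b <;> rfl

/-- The run on a program on which the procedure arrives at the output `x`. -/
theorem exists_conf_halted {p : List Bool} {x : ℕ}
    (h : ∀ p' b, p' ++ [b] <+: p → D.Decides w p' none) (hx : D.Decides w p (some x)) :
    ∃ a, (machine D hD).conf w p a = ⟨none, [], [x]⟩ := by
  obtain ⟨a, ha⟩ := exists_conf hD (r := []) h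
  rw [List.append_nil] at ha
  obtain ⟨t, ht, ht'⟩ := hx
  have hw := wait hD ht' ha le_rfl
  refine ⟨a + t + 1, ?_⟩
  rw [Machine.conf_succ, hw]
  simp only [Machine.next, machine, step, ht]
  rfl

theorem outputs {p : List Bool} {x : ℕ}
    (h : ∀ p' b, p' ++ [b] <+: p → D.Decides w p' none) (hx : D.Decides w p (some x)) :
    (machine D hD).Outputs w p x := by
  obtain ⟨a, ha⟩ := exists_conf_halted hD h hx
  refine ⟨a, ?_, ?_, ?_⟩ <;> rw [ha]
  rfl

/-- If the procedure decides on all initial segments of `p` and outputs at most `x`, then it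
outputs `x` on one of them. -/
theorem exists_outputs {p : List Bool} {x : ℕ}
    (h : ∀ p', p' <+: p → ∃ v, D.Decides w p' v ∧ (v = none ∨ v = some x))
    (hx : D.Decides w p (some x)) : ∃ p', p' <+: p ∧ (machine D hD).Outputs w p' x := by
  induction hl : p.length using Nat.strong_induction_on generalizing p with
  | _ l ih =>
    -- Descend to a shortest initial segment on which the output is decided; the machine asks for a
    -- bit on all shorter ones and therefore gets there.
    by_cases hc : ∃ p', p' <+: p ∧ p' ≠ p ∧ D.Decides w p' (some x)
    · obtain ⟨p', h1, h2, h3⟩ := hc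
      have hlt : p'.length < l := by
        rw [← hl]
        exact lt_of_le_of_ne h1.length_le fun he => h2 (h1.eq_of_length he)
      obtain ⟨p'', h4, h5⟩ := ih _ hlt (fun q hq => h q (hq.trans h1)) h3 rfl
      exact ⟨p'', h4.trans h1, h5⟩
    · refine ⟨p, List.prefix_refl p, outputs hD (fun p' b hp' => ?_) hx⟩
      have h1 : p' <+: p := (List.prefix_append _ _).trans hp'
      obtain ⟨v, hv, rfl | rfl⟩ := h p' h1
      · exact hv
      · refine absurd ⟨p', h1, ?_, hv⟩ hc
        rintro rfl
        simpa using hp'.length_le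

end

end Decision

/-! ## Printing machine -/

/-- Reads `1 ⋯ 1 0` and gives the number of ones. -/
def unaryDecision : Decision := fun a =>
  -- The default `true` makes the procedure ask for a first bit; the final zero is not counted,
  -- hence the `- 1`.
  some (bif a.2.1.reverse.head?.getD true then none else some (a.2.1.length - 1))

theorem unaryDecision_computable : Computable unaryDecision := by
  have h1 : Computable fun a : List ℕ × List Bool × ℕ => a.2.1 :=
    Computable.fst.comp Computable.snd
  refine Computable.option_some.comp (Computable.cond ?_ (Computable.const none) ?_)
  · exact Primrec.option_getD.to_comp.comp (Primrec.list_head?.to_comp.comp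
      (Computable.list_reverse.comp h1)) (Computable.const true)
  · exact Computable.option_some.comp (Computable.pred.comp (Computable.list_length.comp h1))

/-- The machine that prints a number given in unary. -/
def unaryMachine : Machine := unaryDecision.machine unaryDecision_computable

theorem unaryMachine_conf (w : List ℕ) (k : ℕ) :
    ∃ a, unaryMachine.conf w (List.replicate k true ++ [false]) a = ⟨none, [], [k]⟩ := by
  refine Decision.exists_conf_halted _ (fun p' b hp' => ⟨0, ?_, by simp⟩) ⟨0, ?_, by simp⟩
  · have h1 : p' <+: List.replicate k true := by
      obtain ⟨r, hr⟩ := hp'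
      rcases List.eq_nil_or_concat r with rfl | ⟨r, c, rfl⟩
      · rw [List.append_nil] at hr
        rw [(List.append_inj' hr rfl).1]
      · rw [List.concat_eq_append, ← List.append_assoc] at hr
        rw [← (List.append_inj' hr rfl).1, List.append_assoc]
        exact List.prefix_append _ _
    have h2 : p' = List.replicate p'.length true :=
      List.eq_replicate_iff.2 ⟨rfl, fun c hc => List.eq_of_mem_replicate (h1.subset hc)⟩
    rw [h2]
    cases p'.length <;> simp [unaryDecision, List.replicate_succ']
  · simp [unaryDecision]

namespace Machine

/-- These programs show that every number has a complexity and a positive probability. They also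
lower compute elementary matrices: a single number is written, and the sequence is continued as a
constant. Computability of `pr` allows a machine to output such programs. -/
theorem IsUniversal.exists_printer {U : Machine} (hU : U.IsUniversal) : ∃ pr : ℕ → List Bool,
    Function.Injective pr ∧ Computable pr ∧ ∀ w k, U.Outputs w (pr k) k ∧ U.ReadsWithin w (pr k) ∧
      ∀ i x, U.Emits w (pr k) i x ↔ i = 0 ∧ x = k := by
  obtain ⟨r, hr⟩ := hU unaryMachine
  have hpr : ∀ w k, U.Outputs w (r ++ (List.replicate k true ++ [false])) k ∧
      U.ReadsWithin w (r ++ (List.replicate k true ++ [false])) ∧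
      ∀ i x, U.Emits w (r ++ (List.replicate k true ++ [false])) i x ↔ i = 0 ∧ x = k := by
    intro w k
    obtain ⟨a, ha⟩ := unaryMachine_conf w k
    have hh : unaryMachine.step (unaryMachine.conf w (List.replicate k true ++ [false]) a).state =
        none := by rw [ha]; rfl
    obtain ⟨h1, h2, h3⟩ := hr w (List.replicate k true ++ [false])
    refine ⟨h1 k ⟨a, hh, by rw [ha], by rw [ha]⟩, h2 (readsWithin_of_halted _ hh), fun i x => ?_⟩
    rw [h3, emits_iff_of_halted _ hh, ha]
    cases i <;> simp [eq_comm]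
  refine ⟨fun k => r ++ (List.replicate k true ++ [false]), fun k k' h => ?_, ?_, hpr⟩
  · have := congrArg List.length h
    simpa using this
  · refine Computable.list_append.comp (Computable.const r)
      (Computable.list_append.comp ?_ (Computable.const [false]))
    have h : Computable fun k : ℕ => (List.range k).map fun _ => true :=
      (Primrec.list_map Primrec.list_range (Primrec.const true).to₂).to_comp
    exact h.of_eq fun k => by simp [List.map_const']

-- Complexity, universal probability and the Kraft inequality

variable (U : Machine)

theorem K_le {w : List ℕ} {p : List Bool} {x : ℕ} (h : U.Outputs w p x) : U.K w x ≤ p.length :=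
  Nat.sInf_le ⟨p, rfl, h⟩

/-- The complexity is the length of a shortest program. -/
theorem IsUniversal.exists_shortest {U : Machine} (hU : U.IsUniversal) (w : List ℕ) (x : ℕ) :
    ∃ p, p.length = U.K w x ∧ U.Outputs w p x := by
  obtain ⟨pr, -, -, h⟩ := hU.exists_printer
  exact Nat.sInf_mem (s := {l | ∃ p : List Bool, p.length = l ∧ U.Outputs w p x})
    ⟨_, pr x, rfl, (h w x).1⟩

theorem le_m {w : List ℕ} {p : List Bool} {x : ℕ} (h : U.Outputs w p x) :
    (2 : ℝ≥0∞)⁻¹ ^ p.length ≤ U.m w x :=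
  ENNReal.le_tsum (f := fun p : {p : List Bool // U.Outputs w p x} => (2 : ℝ≥0∞)⁻¹ ^ p.1.length)
    ⟨p, h⟩

theorem m_eq_tsum (w : List ℕ) (x : ℕ) : U.m w x =
    ∑' p : List Bool, {p | U.Outputs w p x}.indicator (fun p => (2 : ℝ≥0∞)⁻¹ ^ p.length) p :=
  tsum_subtype {p | U.Outputs w p x} fun p => (2 : ℝ≥0∞)⁻¹ ^ p.length

/-- A set of nonempty strings none of which extends another is uniquely decodable. -/
theorem uniquelyDecodable_of_prefixFree {S : Set (List Bool)} (h0 : [] ∉ S)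
    (hS : ∀ p ∈ S, ∀ q ∈ S, p <+: q → p = q) : InformationTheory.UniquelyDecodable S := by
  intro L₁
  induction L₁ with
  | nil =>
    intro L₂ _ h2 h
    cases L₂ with
    | nil => rfl
    | cons b m =>
      have : b = [] := (List.append_eq_nil_iff.1 (h.symm : b ++ m.flatten = [])).1
      exact absurd (this ▸ h2 b (by simp)) h0
  | cons a l ih =>
    intro L₂ h1 h2 h
    cases L₂ with
    | nil =>
      have : a = [] := (List.append_eq_nil_iff.1 (h : a ++ l.flatten = [])).1
      exact absurd (this ▸ h1 a (by simp)) h0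
    | cons b m =>
      rw [List.flatten_cons, List.flatten_cons] at h
      have ha := h1 a (by simp)
      have hb := h2 b (by simp)
      have hab : a = b := by
        rcases List.prefix_or_prefix_of_prefix (l₃ := b ++ m.flatten)
          (h ▸ List.prefix_append a _) (List.prefix_append b _) with hp | hp
        · exact hS a ha b hb hp
        · exact (hS b hb a ha hp).symm
      subst hab
      rw [ih m (fun w hw => h1 w (by simp [hw])) (fun w hw => h2 w (by simp [hw]))
        (List.append_cancel_left h)]

/-- The Kraft inequality for the halting programs. -/
theorem tsum_halting_le_one (w : List ℕ) : ∑' p : List Bool,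
    {p | ∃ x, U.Outputs w p x}.indicator (fun p => (2 : ℝ≥0∞)⁻¹ ^ p.length) p ≤ 1 := by
  classical
  rw [ENNReal.tsum_eq_iSup_sum]
  refine iSup_le fun F => ?_
  have hfree : ∀ p ∈ {p | ∃ x, U.Outputs w p x}, ∀ q ∈ {p | ∃ x, U.Outputs w p x},
      p <+: q → p = q := by
    rintro p ⟨x, hx⟩ q ⟨y, hy⟩ ⟨r, rfl⟩
    rw [(Outputs.eq_of_append U hx hy).1, List.append_nil]
  rw [← Finset.sum_filter_add_sum_filter_not F (fun p => p ∈ {p | ∃ x, U.Outputs w p x}),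
    Finset.sum_congr rfl fun p hp => Set.indicator_of_mem (Finset.mem_filter.1 hp).2 _,
    Finset.sum_congr (s₁ := F.filter fun p => ¬ p ∈ {p | ∃ x, U.Outputs w p x}) rfl
      fun p hp => Set.indicator_of_notMem (Finset.mem_filter.1 hp).2 _,
    Finset.sum_const_zero, add_zero]
  set S := F.filter fun p => p ∈ {p | ∃ x, U.Outputs w p x} with hS
  have hSfree : ∀ p ∈ S, ∀ q ∈ S, p <+: q → p = q := fun p hp q hq =>
    hfree p (Finset.mem_filter.1 hp).2 q (Finset.mem_filter.1 hq).2
  -- Unique decodability excludes the empty string. If the empty program halts, prefix-freeness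
  -- makes it the only halting one.
  by_cases h0 : [] ∈ S
  · have : S = {[]} := by
      ext p
      rw [Finset.mem_singleton]
      exact ⟨fun hp => (hSfree [] h0 p hp List.nil_prefix).symm, fun hp => hp ▸ h0⟩
    simp [this]
  · have h := InformationTheory.kraft_mcmillan_inequality (S := S)
      (uniquelyDecodable_of_prefixFree (by simpa using h0) (by simpa using hSfree))
    have h2 := ENNReal.ofReal_le_ofReal h
    rw [ENNReal.ofReal_one, ENNReal.ofReal_sum_of_nonneg fun p _ => by positivity] at h2
    refine le_trans (le_of_eq (Finset.sum_congr rfl fun p _ => ?_)) h2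
    rw [ENNReal.ofReal_pow (by positivity)]
    congr 1
    simp [ENNReal.ofReal_inv_of_pos]

/-- The universal probabilities of different objects add up to at most `1`. -/
theorem tsum_m_le_one (w : List ℕ) : ∑' x, U.m w x ≤ 1 := by
  refine le_trans ?_ (U.tsum_halting_le_one w)
  simp_rw [m_eq_tsum]
  -- Sum over the programs first: each has at most one output and is counted at most once.
  rw [ENNReal.tsum_comm]
  refine ENNReal.tsum_le_tsum fun p => ?_
  by_cases hp : ∃ x, U.Outputs w p x
  · obtain ⟨x, hx⟩ := hp
    rw [tsum_eq_single x]
    · rw [Set.indicator_of_mem (show p ∈ {p | U.Outputs w p x} from hx),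
        Set.indicator_of_mem (show p ∈ {p | ∃ x, U.Outputs w p x} from ⟨x, hx⟩)]
    · intro y hy
      exact Set.indicator_of_notMem (s := {p | U.Outputs w p y})
        (fun h => hy (Outputs.unique U h hx)) _
  · rw [Set.indicator_of_notMem (show p ∉ {p | ∃ x, U.Outputs w p x} from hp)]
    refine le_of_eq (ENNReal.tsum_eq_zero.2 fun x => ?_)
    exact Set.indicator_of_notMem (s := {p | U.Outputs w p x}) (fun h => hp ⟨x, h⟩) _

end Machine

/-! ## Binary intervals -/

/-- The number with the binary digits `p`. -/
def bitsVal (p : List Bool) : ℕ := p.foldl (fun a b => 2 * a + b.toNat) 0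

theorem bitsVal_concat (p : List Bool) (b : Bool) : bitsVal (p ++ [b]) = 2 * bitsVal p + b.toNat := by
  simp [bitsVal]

theorem exists_bitsVal (N : ℕ) : ∀ k < 2 ^ N, ∃ p : List Bool, p.length = N ∧ bitsVal p = k := by
  induction N with
  | zero => intro k hk; exact ⟨[], rfl, by simp at hk; simp [bitsVal, hk]⟩
  | succ N ih =>
    intro k hk
    obtain ⟨p, hp, hv⟩ := ih (k / 2) (by rw [pow_succ] at hk; omega)
    refine ⟨p ++ [decide (k % 2 = 1)], by simp [hp], ?_⟩
    rw [bitsVal_concat, hv]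
    rcases Nat.mod_two_eq_zero_or_one k with h | h <;> simp [h] <;> omega

/-- Left end of the binary interval of `p`. -/
def bitsLo (p : List Bool) : ℚ := bitsVal p * (2 ^ p.length)⁻¹

/-- Right end of the binary interval of `p`. -/
def bitsHi (p : List Bool) : ℚ := (bitsVal p + 1 : ℕ) * (2 ^ p.length)⁻¹

theorem bits_mono {p q : List Bool} (h : p <+: q) : bitsLo p ≤ bitsLo q ∧ bitsHi q ≤ bitsHi p := by
  obtain ⟨r, rfl⟩ := h
  induction r using List.reverseRecOn with
  | nil => simp
  | append_singleton r b ih =>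
    have key : ∀ q : List Bool, bitsLo q ≤ bitsLo (q ++ [b]) ∧ bitsHi (q ++ [b]) ≤ bitsHi q := by
      intro q
      have h2 : (0 : ℚ) < (2 ^ q.length)⁻¹ := by positivity
      unfold bitsLo bitsHi
      rw [bitsVal_concat, List.length_append, List.length_singleton, pow_succ, mul_inv]
      have hb : (b.toNat : ℚ) ≤ 1 := by exact_mod_cast Bool.toNat_le b
      have hb0 : (0 : ℚ) ≤ b.toNat := Nat.cast_nonneg _
      push_cast
      constructor <;> nlinarith
    rw [← List.append_assoc]
    exact ⟨ih.1.trans (key _).1, (key _).2.trans ih.2⟩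

theorem primrec_bitsVal : Primrec bitsVal := by
  refine Primrec.list_foldl (h := fun _ (p : ℕ × Bool) => 2 * p.1 + p.2.toNat) Primrec.id
    (Primrec.const 0) ?_
  exact Primrec.nat_add.comp (Primrec.nat_mul.comp (Primrec.const 2)
    (Primrec.fst.comp Primrec.snd)) ((Primrec.dom_bool Bool.toNat).comp
      (Primrec.snd.comp Primrec.snd))

theorem primrec_bitsLo : Primrec bitsLo :=
  primrec_rat_mul.comp (primrec_natCast_rat.comp primrec_bitsVal)
    (primrec_inv_two_pow.comp Primrec.list_length)

theorem primrec_bitsHi : Primrec bitsHi :=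
  primrec_rat_mul.comp (primrec_natCast_rat.comp (Primrec.succ.comp primrec_bitsVal))
    (primrec_inv_two_pow.comp Primrec.list_length)

/-! ## The coding theorem -/

section Coding

variable (f : List ℕ → ℕ → ℕ → ℚ)

/-- The measure requested at the stage `(x, l, t)`: `2^{-l-1}` if the approximation to the measure
of `x` exceeds `2^{-l}` for the first time at `t + 1`. -/
def request (w : List ℕ) (s : ℕ × ℕ × ℕ) : ℚ :=
  if f w s.2.2 s.1 ≤ (2 ^ s.2.1)⁻¹ ∧ (2 ^ s.2.1)⁻¹ < f w (s.2.2 + 1) s.1 then (2 ^ (s.2.1 + 1))⁻¹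
  else 0

theorem request_nonneg (w : List ℕ) (s : ℕ × ℕ × ℕ) : 0 ≤ request f w s := by
  unfold request
  split_ifs <;> positivity

/-- The total measure requested before the stage `s`. -/
def requested (w : List ℕ) (s : ℕ) : ℚ :=
  ∑ k ∈ Finset.range s, request f w (Denumerable.ofNat (ℕ × ℕ × ℕ) k)

theorem requested_mono (w : List ℕ) : Monotone (requested f w) := fun _ _ h =>
  Finset.sum_le_sum_of_subset_of_nonneg (Finset.range_mono h) fun _ _ _ => request_nonneg f w _

theorem requested_succ (w : List ℕ) (s : ℕ) : requested f w (s + 1) =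
    requested f w s + request f w (Denumerable.ofNat (ℕ × ℕ × ℕ) s) :=
  Finset.sum_range_succ _ _

variable {f}

theorem request_computable (hf : Computable fun a : List ℕ × ℕ × ℕ => f a.1 a.2.1 a.2.2) :
    Computable₂ (request f) := by
  have h1 : Computable fun a : List ℕ × (ℕ × ℕ × ℕ) => f a.1 a.2.2.2 a.2.1 :=
    Computable.comp (f := fun a : List ℕ × ℕ × ℕ => f a.1 a.2.1 a.2.2)
      (g := fun a : List ℕ × (ℕ × ℕ × ℕ) => (a.1, a.2.2.2, a.2.1)) hf
      (Computable.pair Computable.fst (Computable.pair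
      (Computable.snd.comp (Computable.snd.comp Computable.snd))
      (Computable.fst.comp Computable.snd)))
  have h2 : Computable fun a : List ℕ × (ℕ × ℕ × ℕ) => f a.1 (a.2.2.2 + 1) a.2.1 :=
    Computable.comp (f := fun a : List ℕ × ℕ × ℕ => f a.1 a.2.1 a.2.2)
      (g := fun a : List ℕ × (ℕ × ℕ × ℕ) => (a.1, a.2.2.2 + 1, a.2.1)) hf
      (Computable.pair Computable.fst (Computable.pair
      (Computable.succ.comp (Computable.snd.comp (Computable.snd.comp Computable.snd)))
      (Computable.fst.comp Computable.snd)))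
  have hl : Computable fun a : List ℕ × (ℕ × ℕ × ℕ) => a.2.2.1 :=
    Computable.fst.comp (Computable.snd.comp Computable.snd)
  have h3 : Computable fun a : List ℕ × (ℕ × ℕ × ℕ) => ((2 : ℚ) ^ a.2.2.1)⁻¹ :=
    primrec_inv_two_pow.to_comp.comp hl
  have h4 : Computable fun a : List ℕ × (ℕ × ℕ × ℕ) => ((2 : ℚ) ^ (a.2.2.1 + 1))⁻¹ :=
    primrec_inv_two_pow.to_comp.comp (Computable.succ.comp hl)
  have := Computable.cond (Primrec.and.to_comp.comp
    (primrec_rat_le.decide.to_comp.comp h1 h3) (primrec_rat_lt.decide.to_comp.comp h3 h2)) h4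
    (Computable.const (0 : ℚ))
  refine this.of_eq fun a => ?_
  simp only [request, ← Bool.decide_and, Bool.cond_decide]

theorem requested_computable (hf : Computable fun a : List ℕ × ℕ × ℕ => f a.1 a.2.1 a.2.2) :
    Computable₂ (requested f) := by
  refine computable_sum_range (α := List ℕ × ℕ)
    (f := fun a k => request f a.1 (Denumerable.ofNat (ℕ × ℕ × ℕ) k)) ?_ Computable.snd
  exact (request_computable hf).comp (Computable.fst.comp Computable.fst)
    ((Computable.ofNat (ℕ × ℕ × ℕ)).comp Computable.snd)

variable (f) in
/-- The decoder: the binary interval of the bits read so far has to fit into one of the intervals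
that are allotted to the requests one after the other. -/
def codingDecision : Decision := fun a =>
  -- The clock runs through the stages up to the first whose allotted interval ends beyond the left
  -- end of the interval read. That left end then lies in the allotted interval, so only the right
  -- end has to be checked; if it sticks out, one more bit is read.
  bif requested f a.1 (a.2.2 + 1) ≤ bitsLo a.2.1 then none
  else some (bif bitsHi a.2.1 ≤ requested f a.1 (a.2.2 + 1) then
    some (Denumerable.ofNat (ℕ × ℕ × ℕ) a.2.2).1 else none)

theorem codingDecision_computable (hf : Computable fun a : List ℕ × ℕ × ℕ => f a.1 a.2.1 a.2.2) :
    Computable (codingDecision f) := by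
  have hp : Computable fun a : List ℕ × List Bool × ℕ => a.2.1 :=
    Computable.fst.comp Computable.snd
  have hs : Computable fun a : List ℕ × List Bool × ℕ => a.2.2 :=
    Computable.snd.comp Computable.snd
  have hr : Computable fun a : List ℕ × List Bool × ℕ => requested f a.1 (a.2.2 + 1) :=
    (requested_computable hf).comp Computable.fst (Computable.succ.comp hs)
  refine Computable.cond (primrec_rat_le.decide.to_comp.comp hr (primrec_bitsLo.to_comp.comp hp))
    (Computable.const none) (Computable.option_some.comp (Computable.cond
      (primrec_rat_le.decide.to_comp.comp (primrec_bitsHi.to_comp.comp hp) hr)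
      (Computable.option_some.comp (Computable.fst.comp ((Computable.ofNat _).comp hs)))
      (Computable.const none)))

theorem codingDecision_eq_none {w : List ℕ} {p : List Bool} {s : ℕ} :
    codingDecision f (w, p, s) = none ↔ requested f w (s + 1) ≤ bitsLo p := by
  simp only [codingDecision, Bool.cond_decide]
  split_ifs with h <;> simp [h]

theorem codingDecision_eq_some {w : List ℕ} {p : List Bool} {s x : ℕ} :
    codingDecision f (w, p, s) = some (some x) ↔ bitsLo p < requested f w (s + 1) ∧
      bitsHi p ≤ requested f w (s + 1) ∧ (Denumerable.ofNat (ℕ × ℕ × ℕ) s).1 = x := by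
  simp only [codingDecision, Bool.cond_decide]
  split_ifs with h h' <;> simp [h] <;> simp_all

/-- If `L` is the least exponent that contributes, the sum is at most the geometric tail 2^(-L-1) +
2^(-L-2) + ⋯ = 2^(-L), which is less than `a`. -/
theorem tsum_indicator_pow_le (a : ℝ≥0∞) :
    ∑' l : ℕ, (if (2 : ℝ≥0∞)⁻¹ ^ l < a then (2 : ℝ≥0∞)⁻¹ ^ (l + 1) else 0) ≤ a := by
  classical
  by_cases h : ∃ l : ℕ, (2 : ℝ≥0∞)⁻¹ ^ l < a
  · have hL := Nat.find_spec h
    have hmin : ∀ l < Nat.find h, ¬ (2 : ℝ≥0∞)⁻¹ ^ l < a := fun l hl => Nat.find_min h hl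
    revert hL hmin
    generalize Nat.find h = L
    intro hL hmin
    set g : ℕ → ℝ≥0∞ := fun l => if (2 : ℝ≥0∞)⁻¹ ^ l < a then (2 : ℝ≥0∞)⁻¹ ^ (l + 1) else 0 with hg
    have h1 : ∑ l ∈ Finset.range L, g l = 0 :=
      Finset.sum_eq_zero fun l hl => if_neg (hmin l (Finset.mem_range.1 hl))
    have h2 : ∀ l, g (l + L) ≤ (2 : ℝ≥0∞)⁻¹ ^ (L + 1) * (2 : ℝ≥0∞)⁻¹ ^ l := by
      intro l
      rw [hg]
      dsimp only
      split_ifs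
      · rw [← pow_add, show l + L + 1 = L + 1 + l by ring]
      · exact zero_le
    have h3 := Summable.sum_add_tsum_nat_add' (f := g) (k := L) ENNReal.summable
    rw [h1, zero_add] at h3
    rw [← h3]
    refine le_trans (ENNReal.tsum_le_tsum h2) (le_trans (le_of_eq ?_) hL.le)
    rw [ENNReal.tsum_mul_left, ENNReal.tsum_geometric, ENNReal.one_sub_inv_two, inv_inv,
      pow_succ, mul_assoc, ENNReal.inv_mul_cancel (by simp) (by simp), mul_one]
  · push Not at h
    exact le_trans (le_of_eq (ENNReal.tsum_eq_zero.2 fun l => if_neg (not_lt.2 (h l)))) zero_le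

/-- Requests come from a semimeasure, so that their total measure is at most `1`. -/
theorem requested_le_one {w : List ℕ} (hmono : ∀ x, Monotone fun t => f w t x) (F : ℕ → ℝ≥0∞)
    (hF : ∀ t x, ENNReal.ofReal (f w t x) ≤ F x) (hF1 : ∑' x, F x ≤ 1) (s : ℕ) :
    requested f w s ≤ 1 := by
  have hpow : ∀ l : ℕ, ENNReal.ofReal (((2 ^ l)⁻¹ : ℚ) : ℝ) = (2 : ℝ≥0∞)⁻¹ ^ l := by
    intro l
    push_cast
    rw [← inv_pow, ENNReal.ofReal_pow (by positivity), ENNReal.ofReal_inv_of_pos (by norm_num),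
      ENNReal.ofReal_ofNat]
  have h1 : ENNReal.ofReal (requested f w s : ℝ) ≤
      ∑' a : ℕ × ℕ × ℕ, ENNReal.ofReal (request f w a : ℝ) := by
    unfold requested
    push_cast
    rw [ENNReal.ofReal_sum_of_nonneg fun k _ => by exact_mod_cast request_nonneg f w _,
      ← (Denumerable.eqv (ℕ × ℕ × ℕ)).symm.tsum_eq]
    exact ENNReal.sum_le_tsum (f := fun k => ENNReal.ofReal
      (request f w ((Denumerable.eqv (ℕ × ℕ × ℕ)).symm k) : ℝ)) (Finset.range s)
  have h2 : ∑' a : ℕ × ℕ × ℕ, ENNReal.ofReal (request f w a : ℝ) ≤ ∑' x, F x := by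
    rw [ENNReal.tsum_prod' (f := fun a : ℕ × ℕ × ℕ => ENNReal.ofReal (request f w a : ℝ))]
    refine ENNReal.tsum_le_tsum fun x => ?_
    rw [ENNReal.tsum_prod' (f := fun a : ℕ × ℕ => ENNReal.ofReal (request f w (x, a) : ℝ))]
    refine le_trans (ENNReal.tsum_le_tsum fun l => ?_) (tsum_indicator_pow_le (F x))
    -- For given `x` and `l` the level 2^(-l) is crossed at most once, because the approximations
    -- increase; so at most one `t` contributes.
    by_cases h : ∃ t, f w t x ≤ (2 ^ l)⁻¹ ∧ (2 ^ l)⁻¹ < f w (t + 1) x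
    · obtain ⟨t, ht⟩ := h
      rw [tsum_eq_single t, if_pos]
      · simp only [request, if_pos ht]
        rw [hpow]
      · refine lt_of_lt_of_le ?_ (hF (t + 1) x)
        rw [← hpow]
        refine (ENNReal.ofReal_lt_ofReal_iff (lt_trans ?_ (Rat.cast_lt.2 ht.2))).2
          (Rat.cast_lt.2 ht.2)
        positivity
      · intro t' hne
        have : ¬ (f w t' x ≤ (2 ^ l)⁻¹ ∧ (2 ^ l)⁻¹ < f w (t' + 1) x) := by
          rintro ⟨h3, h4⟩
          rcases lt_or_gt_of_ne hne with hlt | hlt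
          · exact absurd (h4.trans_le (hmono x (Nat.succ_le_of_lt hlt))) (not_lt.2 ht.1)
          · exact absurd (ht.2.trans_le (hmono x (Nat.succ_le_of_lt hlt))) (not_lt.2 h3)
        simp only [request, if_neg this, Rat.cast_zero, ENNReal.ofReal_zero]
    · push Not at h
      refine le_trans (le_of_eq (ENNReal.tsum_eq_zero.2 fun t => ?_)) zero_le
      simp only [request]
      rw [if_neg fun ht => absurd ht.2 (not_lt.2 (h t ht.1)), Rat.cast_zero, ENNReal.ofReal_zero]
  have h3 := (h1.trans h2).trans hF1
  rw [ENNReal.ofReal_le_one] at h3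
  exact_mod_cast h3

/-- When the approximation crosses 2^(-l), an interval of length 2^(-l-1) is allotted to `x`. It
contains a dyadic interval of length 2^(-l-2), whose address has `l + 2` bits. The decoder may
already be certain on an initial segment of that address, hence the inequality for the length. -/
theorem codingDecision_outputs
    (hf : Computable fun a : List ℕ × ℕ × ℕ => f a.1 a.2.1 a.2.2) {w : List ℕ}
    (h0 : ∀ x, f w 0 x = 0) (hone : ∀ s, requested f w s ≤ 1)
    {x l t : ℕ} (hx : (2 ^ l)⁻¹ < f w t x) :
    ∃ p, p.length ≤ l + 2 ∧
      ((codingDecision f).machine (codingDecision_computable hf)).Outputs w p x := by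
  classical
  have hex : ∃ t, (2 ^ l)⁻¹ < f w t x := ⟨t, hx⟩
  -- The first crossing is not at time 0, where the approximation vanishes; so it is at some `t +
  -- 1`, as `request` demands.
  obtain ⟨t, ht1, ht2⟩ : ∃ t, f w t x ≤ (2 ^ l)⁻¹ ∧ (2 ^ l)⁻¹ < f w (t + 1) x := by
    have h1 := Nat.find_spec hex
    have h2 : Nat.find hex ≠ 0 := by
      intro h
      rw [h, h0] at h1
      exact absurd h1 (not_lt.2 (by positivity))
    obtain ⟨t, ht⟩ := Nat.exists_eq_succ_of_ne_zero h2
    exact ⟨t, not_lt.1 (Nat.find_min hex (by omega)), by rwa [ht] at h1⟩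
  set s := Encodable.encode (x, l, t) with hs
  have hofs : Denumerable.ofNat (ℕ × ℕ × ℕ) s = (x, l, t) := Denumerable.ofNat_encode _
  have hreq : request f w (Denumerable.ofNat (ℕ × ℕ × ℕ) s) = (2 ^ (l + 1))⁻¹ := by
    rw [hofs]; exact if_pos ⟨ht1, ht2⟩
  have hsucc := requested_succ f w s
  rw [hreq] at hsucc
  have ha0 : 0 ≤ requested f w s := Finset.sum_nonneg fun k _ => request_nonneg f w _
  -- On the grid of mesh 2^(-N) the allotted interval has the length of two cells, so the first cell
  -- that begins at or after its left end fits into it.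
  set N := l + 2 with hN
  set k := ⌈requested f w s * 2 ^ N⌉₊ with hk
  have hk1 : requested f w s * 2 ^ N ≤ k := Nat.le_ceil _
  have hk2 : (k : ℚ) + 1 ≤ requested f w (s + 1) * 2 ^ N := by
    have := Nat.ceil_lt_add_one (a := requested f w s * 2 ^ N) (by positivity)
    rw [hsucc, add_mul, show ((2 : ℚ) ^ (l + 1))⁻¹ * 2 ^ N = 2 by
      rw [hN, pow_succ _ (l + 1)]; field_simp]
    linarith
  have hkN : k < 2 ^ N := by
    have h1 : requested f w (s + 1) * 2 ^ N ≤ 1 * 2 ^ N :=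
      mul_le_mul_of_nonneg_right (hone _) (by positivity)
    have : (k : ℚ) + 1 ≤ 2 ^ N := by linarith
    have h2 : k + 1 ≤ 2 ^ N := by exact_mod_cast this
    omega
  obtain ⟨p, hpN, hpk⟩ := exists_bitsVal N k hkN
  have hlo : requested f w s ≤ bitsLo p := by
    unfold bitsLo
    rw [hpN, hpk, ← div_eq_mul_inv, le_div_iff₀ (by positivity)]
    exact hk1
  have hhi : bitsHi p ≤ requested f w (s + 1) := by
    unfold bitsHi
    rw [hpN, hpk, ← div_eq_mul_inv, div_le_iff₀ (by positivity)]
    push_cast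
    exact hk2
  have hlohi : ∀ q, bitsLo q < bitsHi q := by
    intro q
    unfold bitsLo bitsHi
    have : (0 : ℚ) < (2 ^ q.length)⁻¹ := by positivity
    push_cast
    nlinarith
  have hlt : bitsLo p < requested f w (s + 1) := (hlohi p).trans_le hhi
  suffices h : ∃ p', p' <+: p ∧
      ((codingDecision f).machine (codingDecision_computable hf)).Outputs w p' x by
    obtain ⟨p', hp', hout⟩ := h
    exact ⟨p', hpN ▸ hp'.length_le, hout⟩
  refine Decision.exists_outputs (codingDecision_computable hf) (w := w) (p := p) (x := x) ?_ ?_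
  · intro p' hp'
    have hb := bits_mono hp'
    have hs' : codingDecision f (w, p', s) ≠ none := fun h =>
      absurd (codingDecision_eq_none.1 h) (not_le.2 (hb.1.trans_lt hlt))
    obtain ⟨v, hv⟩ := Decision.exists_decides ⟨s, hs'⟩
    refine ⟨v, hv, ?_⟩
    cases v with
    | none => exact Or.inl rfl
    | some y =>
      right
      obtain ⟨s', h1, h2⟩ := hv
      -- The decision falls at stage `s` at the latest. An output at an earlier stage is impossible:
      -- the allotted interval of that stage ends to the left of the interval of `p`, which lies in
      -- that of `p'`.
      have hle : s' ≤ s := not_lt.1 fun h => hs' (h2 s h)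
      obtain ⟨h3, h4, h5⟩ := codingDecision_eq_some.1 h1
      rcases hle.lt_or_eq with hlt' | rfl
      · exact absurd ((hb.2.trans h4).trans ((requested_mono f w (Nat.succ_le_of_lt hlt')).trans hlo))
          (not_le.2 (hlohi p))
      · rw [← h5, hofs]
  · exact ⟨s, codingDecision_eq_some.2 ⟨hlt, hhi, by rw [hofs]⟩, fun t' ht' =>
      codingDecision_eq_none.2 ((requested_mono f w (Nat.succ_le_of_lt ht')).trans hlo)⟩

/-- The coding theorem: the complexity is at most the negative logarithm of a semimeasure with
computable increasing approximations, up to a constant. -/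
theorem Machine.IsUniversal.exists_K_le {U : Machine} (hU : U.IsUniversal)
    (hf : Computable fun a : List ℕ × ℕ × ℕ => f a.1 a.2.1 a.2.2) :
    ∃ c : ℕ, ∀ w : List ℕ, (∀ x, Monotone fun t => f w t x) → (∀ x, f w 0 x = 0) →
      ∀ F : ℕ → ℝ≥0∞, (∀ t x, ENNReal.ofReal (f w t x) ≤ F x) → ∑' x, F x ≤ 1 →
      ∀ x l t, (2 ^ l)⁻¹ < f w t x → U.K w x ≤ l + c := by
  obtain ⟨r, hr⟩ := hU ((codingDecision f).machine (codingDecision_computable hf))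
  -- The prefix that simulates the decoder, and two bits for the rounding to a dyadic interval.
  refine ⟨r.length + 2, fun w hmono h0 F hF hF1 x l t hx => ?_⟩
  obtain ⟨p, hp, hout⟩ := codingDecision_outputs hf h0
    (requested_le_one hmono F hF hF1) hx
  refine (U.K_le ((hr w p).1 x hout)).trans ?_
  rw [List.length_append]
  omega

end Coding

/-! ## Codes -/

theorem encode_list_map {α : Type} [Encodable α] (l : List α) :
    Encodable.encode (l.map Encodable.encode) = Encodable.encode l := by
  induction l with
  | nil => rfl
  | cons a l ih =>
    rw [List.map_cons, Encodable.encode_list_cons, Encodable.encode_list_cons, ih,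
      Encodable.encode_nat]

/-- Identifies the codes built by hand with those of `Encodable`, so that `Encodable.decode`
recovers vectors from outputs; `encode_ofFn_matrix` does the same for matrices. -/
theorem encode_ofFn_vec {d : ℕ} (v : Fin d → GaussRat) :
    Encodable.encode (α := List (ℚ × ℚ)) (List.ofFn v) = vecCode v := by
  refine (encode_list_map _).symm.trans ?_
  rw [List.map_ofFn]
  rfl

theorem encode_ofFn_matrix {d : ℕ} (A : ElemMatrix d) :
    Encodable.encode (α := List (List (ℚ × ℚ)))
      (List.ofFn fun a => List.ofFn (A a)) = ElemMatrix.code A := by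
  refine (encode_list_map _).symm.trans ?_
  rw [List.map_ofFn, ElemMatrix.code]
  congr 2
  funext a
  exact encode_ofFn_vec (A a)

theorem vecCode_injective {d : ℕ} : Function.Injective (vecCode : (Fin d → GaussRat) → ℕ) := by
  intro v v' h
  rw [← encode_ofFn_vec, ← encode_ofFn_vec] at h
  exact List.ofFn_injective (Encodable.encode_injective h)

theorem ElemMatrix.code_injective {d : ℕ} : Function.Injective (ElemMatrix.code (d := d)) := by
  intro A A' h
  rw [← encode_ofFn_matrix, ← encode_ofFn_matrix] at h
  have := List.ofFn_injective (Encodable.encode_injective h)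
  funext a
  exact List.ofFn_injective (congrFun this a)

/-! ## Quadratic forms with rational coefficients -/

/-- An entry of a coded vector. -/
def vecEntry (v : List (ℚ × ℚ)) (a : ℕ) : ℚ × ℚ := v.getD a (0, 0)

/-- An entry of a coded matrix. -/
def matEntry (A : List (List (ℚ × ℚ))) (a b : ℕ) : ℚ × ℚ := vecEntry (A.getD a []) b

theorem vecEntry_ofFn {d : ℕ} (v : Fin d → GaussRat) (a : Fin d) :
    vecEntry (List.ofFn v) a = v a := by
  simp [vecEntry, List.getD]

theorem matEntry_ofFn {d : ℕ} (A : ElemMatrix d) (a b : Fin d) :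
    matEntry (List.ofFn fun a => List.ofFn (A a)) a b = A a b := by
  rw [matEntry, ← vecEntry_ofFn (A a) b]
  congr 1
  simp [List.getD]

theorem primrec_vecEntry : Primrec₂ vecEntry := Primrec.list_getD (0, 0)

theorem primrec_matEntry :
    Primrec fun a : List (List (ℚ × ℚ)) × ℕ × ℕ => matEntry a.1 a.2.1 a.2.2 :=
  primrec_vecEntry.comp ((Primrec.list_getD []).comp Primrec.fst (Primrec.fst.comp Primrec.snd))
    (Primrec.snd.comp Primrec.snd)

/-- The real part of `conj u * m * v`. -/
def hermTerm (u m v : ℚ × ℚ) : ℚ :=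
  m.1 * (u.1 * v.1 + u.2 * v.2) - m.2 * (u.1 * v.2 - u.2 * v.1)

theorem primrec_hermTerm :
    Primrec fun a : (ℚ × ℚ) × (ℚ × ℚ) × (ℚ × ℚ) => hermTerm a.1 a.2.1 a.2.2 := by
  have u1 : Primrec fun a : (ℚ × ℚ) × (ℚ × ℚ) × (ℚ × ℚ) => a.1.1 := Primrec.fst.comp Primrec.fst
  have u2 : Primrec fun a : (ℚ × ℚ) × (ℚ × ℚ) × (ℚ × ℚ) => a.1.2 := Primrec.snd.comp Primrec.fst
  have m1 : Primrec fun a : (ℚ × ℚ) × (ℚ × ℚ) × (ℚ × ℚ) => a.2.1.1 :=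
    Primrec.fst.comp (Primrec.fst.comp Primrec.snd)
  have m2 : Primrec fun a : (ℚ × ℚ) × (ℚ × ℚ) × (ℚ × ℚ) => a.2.1.2 :=
    Primrec.snd.comp (Primrec.fst.comp Primrec.snd)
  have v1 : Primrec fun a : (ℚ × ℚ) × (ℚ × ℚ) × (ℚ × ℚ) => a.2.2.1 :=
    Primrec.fst.comp (Primrec.snd.comp Primrec.snd)
  have v2 : Primrec fun a : (ℚ × ℚ) × (ℚ × ℚ) × (ℚ × ℚ) => a.2.2.2 :=
    Primrec.snd.comp (Primrec.snd.comp Primrec.snd)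
  exact primrec_rat_sub.comp
    (primrec_rat_mul.comp m1 (primrec_rat_add.comp (primrec_rat_mul.comp u1 v1)
      (primrec_rat_mul.comp u2 v2)))
    (primrec_rat_mul.comp m2 (primrec_rat_sub.comp (primrec_rat_mul.comp u1 v2)
      (primrec_rat_mul.comp u2 v1)))

/-- The value at `v` of the quadratic form of a coded matrix. -/
def quadForm (d : ℕ) (v : List (ℚ × ℚ)) (A : List (List (ℚ × ℚ))) : ℚ :=
  ∑ a ∈ Finset.range d, ∑ b ∈ Finset.range d,
    hermTerm (vecEntry v a) (matEntry A a b) (vecEntry v b)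

/-- The squared norm of a coded vector. -/
def normSq (d : ℕ) (v : List (ℚ × ℚ)) : ℚ :=
  ∑ a ∈ Finset.range d, ((vecEntry v a).1 * (vecEntry v a).1 + (vecEntry v a).2 * (vecEntry v a).2)

theorem quadForm_computable :
    Computable fun a : ℕ × List (ℚ × ℚ) × List (List (ℚ × ℚ)) => quadForm a.1 a.2.1 a.2.2 := by
  refine computable_sum_range (f := fun (x : ℕ × List (ℚ × ℚ) × List (List (ℚ × ℚ))) a =>
    ∑ b ∈ Finset.range x.1, hermTerm (vecEntry x.2.1 a) (matEntry x.2.2 a b) (vecEntry x.2.1 b))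
    ?_ Computable.fst
  refine computable_sum_range (α := (ℕ × List (ℚ × ℚ) × List (List (ℚ × ℚ))) × ℕ)
    (f := fun x b => hermTerm (vecEntry x.1.2.1 x.2) (matEntry x.1.2.2 x.2 b) (vecEntry x.1.2.1 b))
    ?_ (Computable.fst.comp Computable.fst)
  have hv : Primrec fun y : ((ℕ × List (ℚ × ℚ) × List (List (ℚ × ℚ))) × ℕ) × ℕ => y.1.1.2.1 :=
    Primrec.fst.comp (Primrec.snd.comp (Primrec.fst.comp Primrec.fst))
  have hA : Primrec fun y : ((ℕ × List (ℚ × ℚ) × List (List (ℚ × ℚ))) × ℕ) × ℕ => y.1.1.2.2 :=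
    Primrec.snd.comp (Primrec.snd.comp (Primrec.fst.comp Primrec.fst))
  have ha : Primrec fun y : ((ℕ × List (ℚ × ℚ) × List (List (ℚ × ℚ))) × ℕ) × ℕ => y.1.2 :=
    Primrec.snd.comp Primrec.fst
  have hb : Primrec fun y : ((ℕ × List (ℚ × ℚ) × List (List (ℚ × ℚ))) × ℕ) × ℕ => y.2 := Primrec.snd
  exact (primrec_hermTerm.comp ((primrec_vecEntry.comp hv ha).pair
    ((primrec_matEntry.comp (hA.pair (ha.pair hb))).pair (primrec_vecEntry.comp hv hb)))).to_comp

theorem normSq_computable : Computable₂ normSq := by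
  refine computable_sum_range (α := ℕ × List (ℚ × ℚ)) (f := fun x a =>
    (vecEntry x.2 a).1 * (vecEntry x.2 a).1 + (vecEntry x.2 a).2 * (vecEntry x.2 a).2)
    ?_ Computable.fst
  have h : Primrec fun y : (ℕ × List (ℚ × ℚ)) × ℕ => vecEntry y.1.2 y.2 :=
    primrec_vecEntry.comp (Primrec.snd.comp Primrec.fst) Primrec.snd
  exact (primrec_rat_add.comp
    (primrec_rat_mul.comp (Primrec.fst.comp h) (Primrec.fst.comp h))
    (primrec_rat_mul.comp (Primrec.snd.comp h) (Primrec.snd.comp h))).to_comp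

theorem normSq_ofFn {d : ℕ} (v : Fin d → GaussRat) :
    normSq d (List.ofFn v) = ∑ k, ((v k).1 ^ 2 + (v k).2 ^ 2) := by
  rw [normSq, Finset.sum_range]
  refine Finset.sum_congr rfl fun a _ => ?_
  rw [vecEntry_ofFn]
  ring

/-- Tr A|φ⟩⟨φ| = ⟨φ|A|φ⟩. For elementary data its real part is computed exactly in `ℚ`, so no
rounding occurs in the approximations to Tr E_i μ. -/
theorem quadForm_ofFn {d : ℕ} (φ : ElemState d) (A : ElemMatrix d) :
    ((quadForm d (List.ofFn φ.1) (List.ofFn fun a => List.ofFn (A a)) : ℚ) : ℝ) =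
      (A.toMatrix * φ.proj).trace.re := by
  simp only [Matrix.trace, Matrix.diag, Matrix.mul_apply, Complex.re_sum]
  rw [quadForm, Finset.sum_range]
  push_cast
  refine Finset.sum_congr rfl fun a _ => ?_
  rw [Finset.sum_range]
  refine Finset.sum_congr rfl fun b _ => ?_
  rw [vecEntry_ofFn, vecEntry_ofFn, matEntry_ofFn]
  simp only [hermTerm, ElemMatrix.toMatrix, ElemState.proj, Matrix.vecMulVec_apply,
    GaussRat.toComplex, Pi.star_apply, Complex.mul_re, Complex.mul_im, Complex.star_def,
    Complex.conj_re, Complex.conj_im]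
  push_cast
  ring

/-! ## Approximations to the probabilities of the outcomes -/

namespace Machine

variable (U : Machine)

/-- The output and the unread bits, if by the time `t` the machine has halted with one number on
the output tape. -/
def haltVal (a : List ℕ × List Bool × ℕ) : Option (ℕ × List Bool) :=
  bif U.haltedB (U.conf a.1 a.2.1 a.2.2).state && decide ((U.conf a.1 a.2.1 a.2.2).output.length = 1)
  then (U.conf a.1 a.2.1 a.2.2).output.head?.map fun x => (x, (U.conf a.1 a.2.1 a.2.2).input)
  else none

theorem haltVal_computable : Computable U.haltVal := by
  refine Computable.cond (Primrec.and.to_comp.comp U.halted_computable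
    ((Primrec.eq (α := ℕ)).decide.to_comp.comp (Computable.list_length.comp U.conf_output_computable)
      (Computable.const 1))) ?_ (Computable.const none)
  exact Computable.option_map (Primrec.list_head?.to_comp.comp U.conf_output_computable)
    (Computable.pair Computable.snd (U.conf_input_computable.comp Computable.fst))

theorem haltVal_eq_some {w : List ℕ} {p r : List Bool} {t x : ℕ} :
    U.haltVal (w, p, t) = some (x, r) ↔ U.step (U.conf w p t).state = none ∧
      (U.conf w p t).output = [x] ∧ (U.conf w p t).input = r := by
  simp only [haltVal]
  generalize U.conf w p t = c
  obtain ⟨s, l, o⟩ := c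
  have hh := U.haltedB_iff s
  cases h : U.haltedB s
  · simp [← hh, h]
  · rw [h] at hh
    rcases o with _ | ⟨y, _ | ⟨z, o⟩⟩ <;> simp [hh.1 rfl]

theorem haltVal_mono {w : List ℕ} {p : List Bool} {t t' : ℕ} (h : t ≤ t') {v : ℕ × List Bool}
    (hv : U.haltVal (w, p, t) = some v) : U.haltVal (w, p, t') = some v := by
  obtain ⟨x, r⟩ := v
  rw [haltVal_eq_some] at hv ⊢
  rwa [U.conf_eq_of_le (U.next_of_halted hv.1) h]

theorem outputs_iff_haltVal {w : List ℕ} {p : List Bool} {x : ℕ} :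
    U.Outputs w p x ↔ ∃ t, U.haltVal (w, p, t) = some (x, []) := by
  simp only [haltVal_eq_some, Outputs]
  exact exists_congr fun t => by tauto

/-- The coded matrix with the number `i` that a program without auxiliary input has written by the
time `t`. -/
def matrixAt (a : List Bool × ℕ × ℕ) : Option (List (List (ℚ × ℚ))) :=
  (U.conf [] a.1 a.2.1).output[a.2.2]?.bind fun x =>
    Encodable.decode (α := List (List (ℚ × ℚ))) x

theorem matrixAt_computable : Computable U.matrixAt := by
  refine Computable.option_bind ?_ (Computable.decode.comp Computable.snd)
  refine Computable.list_getElem?.comp ?_ (Computable.snd.comp Computable.snd)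
  exact Computable.comp (g := fun a : List Bool × ℕ × ℕ => (([] : List ℕ), a.1, a.2.1))
    U.conf_output_computable (Computable.pair (Computable.const []) (Computable.pair Computable.fst
      (Computable.fst.comp Computable.snd)))

theorem matrixAt_mono {q : List Bool} {t t' i : ℕ} (h : t ≤ t') {A : List (List (ℚ × ℚ))}
    (hA : U.matrixAt (q, t, i) = some A) : U.matrixAt (q, t', i) = some A := by
  simp only [matrixAt, Option.bind_eq_some_iff] at hA ⊢
  obtain ⟨x, hx, hA⟩ := hA
  exact ⟨x, U.output_mono h hx, hA⟩

theorem exists_matrixAt {d : ℕ} {q : List Bool} {i : ℕ} {A : ElemMatrix d}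
    (h : U.Emits [] q i A.code) :
    ∃ t, U.matrixAt (q, t, i) = some (List.ofFn fun a => List.ofFn (A a)) := by
  obtain ⟨t, ht⟩ := h
  refine ⟨t, ?_⟩
  simp only [matrixAt, ht, Option.bind_some]
  rw [← encode_ofFn_matrix, Encodable.encodek]

theorem matrixAt_of_enumerates {d : ℕ} {q : List Bool} {E : ℕ → Matrix (Fin d) (Fin d) ℂ}
    (hq : U.Enumerates q E) {t i : ℕ} {B : List (List (ℚ × ℚ))}
    (hB : U.matrixAt (q, t, i) = some B) :
    ∃ A : ElemMatrix d, A.toMatrix = E i ∧ B = List.ofFn fun a => List.ofFn (A a) := by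
  have hB' := hB
  simp only [matrixAt, Option.bind_eq_some_iff] at hB'
  obtain ⟨x, hx, -⟩ := hB'
  rcases hq.2 i with ⟨A, h1, h2⟩ | ⟨-, h2⟩
  · refine ⟨A, h1, ?_⟩
    obtain ⟨t', ht'⟩ := U.exists_matrixAt h2
    have h3 := U.matrixAt_mono (le_max_left t t') hB
    rw [U.matrixAt_mono (le_max_right t t') ht'] at h3
    exact (Option.some.inj h3).symm
  · exact absurd ⟨t, hx⟩ (h2 x)

/-- The coded vector that a program has given as its output by the time `t`. -/
def vectorAt (a : List ℕ × List Bool × ℕ) : Option (List (ℚ × ℚ)) :=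
  (U.haltVal a).bind fun v => bif decide (v.2.length = 0) then
    Encodable.decode (α := List (ℚ × ℚ)) v.1 else none

theorem vectorAt_computable : Computable U.vectorAt := by
  refine Computable.option_bind U.haltVal_computable (Computable.cond ?_ ?_ (Computable.const none))
  · exact (Primrec.eq (α := ℕ)).decide.to_comp.comp (Computable.list_length.comp
      (Computable.snd.comp Computable.snd)) (Computable.const 0)
  · exact Computable.decode.comp (Computable.fst.comp Computable.snd)

theorem vectorAt_eq_some {w : List ℕ} {p : List Bool} {t : ℕ} {v : List (ℚ × ℚ)} :
    U.vectorAt (w, p, t) = some v ↔ ∃ x, U.haltVal (w, p, t) = some (x, []) ∧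
      Encodable.decode (α := List (ℚ × ℚ)) x = some v := by
  simp only [vectorAt, Option.bind_eq_some_iff, Prod.exists]
  constructor
  · rintro ⟨x, r, h1, h2⟩
    cases r with
    | nil => exact ⟨x, h1, h2⟩
    | cons b r => simp at h2
  · rintro ⟨x, h1, h2⟩
    exact ⟨x, [], h1, h2⟩

theorem vectorAt_mono {w : List ℕ} {p : List Bool} {t t' : ℕ} (h : t ≤ t') {v : List (ℚ × ℚ)}
    (hv : U.vectorAt (w, p, t) = some v) : U.vectorAt (w, p, t') = some v := by
  rw [vectorAt_eq_some] at hv ⊢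
  obtain ⟨x, hx, h2⟩ := hv
  exact ⟨x, U.haltVal_mono h hx, h2⟩

/-- The weight of a program that outputs a unit vector `v` of dimension `d`, times the value of the
quadratic form at `v`. -/
def stateWeight (d : ℕ) (p : List Bool) (v : List (ℚ × ℚ)) (A : List (List (ℚ × ℚ))) : ℚ :=
  -- Both checks are exact, so only elementary states of the right dimension are counted.
  bif decide (v.length = d) && decide (normSq d v = 1) then (2 ^ p.length)⁻¹ * quadForm d v A else 0

/-- The program with a given code. -/
def decodeProgram (k : ℕ) : List Bool := (Encodable.decode (α := List Bool) k).getD []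

theorem decodeProgram_computable : Computable decodeProgram :=
  Computable.option_getD Computable.decode (Computable.const [])

theorem decodeProgram_encode (q : List Bool) : decodeProgram (Encodable.encode q) = q := by
  simp [decodeProgram]

/-- What the program `p` has contributed by the time `t` to the probability of the outcome `i`. -/
def contribution (a : (List ℕ × List Bool) × ℕ × ℕ) : ℚ :=
  -- The auxiliary tapes hold `n` and the code of the program for `E`, in this order.
  (Option.bind (U.vectorAt (a.1.1, a.1.2, a.2.1)) fun v => Option.map
    (fun A => stateWeight (2 ^ a.1.1.getD 0 0) a.1.2 v A)
    (U.matrixAt (decodeProgram (a.1.1.getD 1 0), a.2.1, a.2.2))).getD 0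

theorem stateWeight_computable :
    Computable fun a : ℕ × List Bool × List (ℚ × ℚ) × List (List (ℚ × ℚ)) =>
      stateWeight a.1 a.2.1 a.2.2.1 a.2.2.2 := by
  have hv : Computable fun a : ℕ × List Bool × List (ℚ × ℚ) × List (List (ℚ × ℚ)) => a.2.2.1 :=
    Computable.fst.comp (Computable.snd.comp Computable.snd)
  have hA : Computable fun a : ℕ × List Bool × List (ℚ × ℚ) × List (List (ℚ × ℚ)) => a.2.2.2 :=
    Computable.snd.comp (Computable.snd.comp Computable.snd)
  refine Computable.cond (Primrec.and.to_comp.comp ?_ ?_) ?_ (Computable.const 0)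
  · exact (Primrec.eq (α := ℕ)).decide.to_comp.comp (Computable.list_length.comp hv) Computable.fst
  · exact (Primrec.eq (α := ℚ)).decide.to_comp.comp (normSq_computable.comp Computable.fst hv)
      (Computable.const 1)
  · have h1 : Computable fun a : ℕ × List Bool × List (ℚ × ℚ) × List (List (ℚ × ℚ)) =>
        ((2 : ℚ) ^ a.2.1.length)⁻¹ :=
      primrec_inv_two_pow.to_comp.comp (Computable.list_length.comp
        (Computable.fst.comp Computable.snd))
    have h2 : Computable fun a : ℕ × List Bool × List (ℚ × ℚ) × List (List (ℚ × ℚ)) =>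
        quadForm a.1 a.2.2.1 a.2.2.2 :=
      Computable.comp (f := fun a : ℕ × List (ℚ × ℚ) × List (List (ℚ × ℚ)) =>
        quadForm a.1 a.2.1 a.2.2) (g := fun a : ℕ × List Bool × List (ℚ × ℚ) × List (List (ℚ × ℚ)) =>
        (a.1, a.2.2.1, a.2.2.2)) quadForm_computable (Computable.pair Computable.fst (hv.pair hA))
    exact primrec_rat_mul.to_comp.comp h1 h2

theorem contribution_computable : Computable U.contribution := by
  have hw : Computable fun a : (List ℕ × List Bool) × ℕ × ℕ => a.1.1 :=
    Computable.fst.comp Computable.fst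
  have hp : Computable fun a : (List ℕ × List Bool) × ℕ × ℕ => a.1.2 :=
    Computable.snd.comp Computable.fst
  have ht : Computable fun a : (List ℕ × List Bool) × ℕ × ℕ => a.2.1 :=
    Computable.fst.comp Computable.snd
  have hi : Computable fun a : (List ℕ × List Bool) × ℕ × ℕ => a.2.2 :=
    Computable.snd.comp Computable.snd
  have hd : Computable fun a : (List ℕ × List Bool) × ℕ × ℕ => 2 ^ a.1.1.getD 0 0 :=
    primrec_nat_pow.to_comp.comp (Computable.const 2)
      ((Primrec.list_getD 0).to_comp.comp hw (Computable.const 0))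
  have hq : Computable fun a : (List ℕ × List Bool) × ℕ × ℕ =>
      decodeProgram (a.1.1.getD 1 0) :=
    decodeProgram_computable.comp
      ((Primrec.list_getD 0).to_comp.comp hw (Computable.const 1))
  have hv : Computable fun a : (List ℕ × List Bool) × ℕ × ℕ =>
      U.vectorAt (a.1.1, a.1.2, a.2.1) :=
    Computable.comp (g := fun a : (List ℕ × List Bool) × ℕ × ℕ => (a.1.1, a.1.2, a.2.1))
      U.vectorAt_computable (hw.pair (hp.pair ht))
  have hA : Computable fun a : (List ℕ × List Bool) × ℕ × ℕ =>
      U.matrixAt (decodeProgram (a.1.1.getD 1 0), a.2.1, a.2.2) :=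
    Computable.comp (g := fun a : (List ℕ × List Bool) × ℕ × ℕ =>
      (decodeProgram (a.1.1.getD 1 0), a.2.1, a.2.2))
      U.matrixAt_computable (hq.pair (ht.pair hi))
  have hs : Computable fun b : (((List ℕ × List Bool) × ℕ × ℕ) × List (ℚ × ℚ)) ×
      List (List (ℚ × ℚ)) => stateWeight (2 ^ b.1.1.1.1.getD 0 0) b.1.1.1.2 b.1.2 b.2 :=
    Computable.comp (f := fun a : ℕ × List Bool × List (ℚ × ℚ) × List (List (ℚ × ℚ)) =>
      stateWeight a.1 a.2.1 a.2.2.1 a.2.2.2) (g := fun b : (((List ℕ × List Bool) × ℕ × ℕ) × List (ℚ × ℚ)) ×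
      List (List (ℚ × ℚ)) => (2 ^ b.1.1.1.1.getD 0 0, b.1.1.1.2, b.1.2, b.2)) stateWeight_computable
      ((hd.comp (Computable.fst.comp Computable.fst)).pair
        ((hp.comp (Computable.fst.comp Computable.fst)).pair
          ((Computable.snd.comp Computable.fst).pair Computable.snd)))
  exact Computable.option_getD (Computable.option_bind hv
    (Computable.option_map (hA.comp Computable.fst) hs)) (Computable.const 0)

/-- What the program with the code `k` has contributed by the time `t` to the probability of the
outcome `i`. -/
def codeContribution (w : List ℕ) (t i k : ℕ) : ℚ :=
  ((Encodable.decode (α := List Bool) k).map fun p =>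
    -- Counts each program only at its own code, even if other numbers should decode to it.
    bif decide (Encodable.encode p = k) then U.contribution ((w, p), t, i) else 0).getD 0

theorem codeContribution_computable :
    Computable₂ fun (a : List ℕ × ℕ × ℕ) k => U.codeContribution a.1 a.2.1 a.2.2 k := by
  refine Computable.option_getD (Computable.option_map (Computable.decode.comp Computable.snd) ?_)
    (Computable.const 0)
  refine Computable.cond ((Primrec.eq (α := ℕ)).decide.to_comp.comp
    (Computable.encode.comp Computable.snd) (Computable.snd.comp Computable.fst)) ?_
    (Computable.const 0)
  have h : Computable fun a : ((List ℕ × ℕ × ℕ) × ℕ) × List Bool => a.1.1 :=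
    Computable.fst.comp Computable.fst
  exact U.contribution_computable.comp
    (((Computable.fst.comp h).pair Computable.snd).pair (Computable.snd.comp h))

theorem codeContribution_encode (w : List ℕ) (t i : ℕ) (p : List Bool) :
    U.codeContribution w t i (Encodable.encode p) = U.contribution ((w, p), t, i) := by
  simp [codeContribution]

theorem codeContribution_eq_zero (w : List ℕ) (t i : ℕ) {k : ℕ}
    (hk : k ∉ Set.range (Encodable.encode : List Bool → ℕ)) : U.codeContribution w t i k = 0 := by
  unfold codeContribution
  cases h : Encodable.decode (α := List Bool) k with
  | none => rfl
  | some p =>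
    have : ¬ Encodable.encode p = k := fun h => hk ⟨p, h⟩
    simp [this]

/-- Approximation from below to the probability of the outcome `i` in the universal matrix. -/
def outcomeApprox (w : List ℕ) (t i : ℕ) : ℚ :=
  -- Only the finitely many codes below `t` enter; in particular the value at time 0 is 0, as the
  -- coding theorem requires.
  ∑ k ∈ Finset.range t, U.codeContribution w t i k

theorem outcomeApprox_computable :
    Computable fun a : List ℕ × ℕ × ℕ => U.outcomeApprox a.1 a.2.1 a.2.2 :=
  computable_sum_range U.codeContribution_computable (Computable.fst.comp Computable.snd)

end Machine

/-! ## Positive semidefinite matrices -/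

section Matrices

variable {n : Type*} [Fintype n]

open scoped MatrixOrder in
theorem posSemidef_exists_star_mul [DecidableEq n] {A : Matrix n n ℂ} (hA : A.PosSemidef) :
    ∃ B : Matrix n n ℂ, A = B.conjTranspose * B :=
  CStarAlgebra.nonneg_iff_eq_star_mul_self.mp hA.nonneg

theorem trace_re_nonneg {A : Matrix n n ℂ} (hA : A.PosSemidef) : 0 ≤ A.trace.re :=
  (Complex.nonneg_iff.1 hA.trace_nonneg).1

/-- With A = C*C the trace is that of C B C*, which is positive semidefinite. -/
theorem trace_mul_re_nonneg [DecidableEq n] {A B : Matrix n n ℂ} (hA : A.PosSemidef) (hB : B.PosSemidef) :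
    0 ≤ (A * B).trace.re := by
  obtain ⟨C, rfl⟩ := posSemidef_exists_star_mul hA
  rw [Matrix.mul_assoc, Matrix.trace_mul_comm]
  exact trace_re_nonneg (hB.mul_mul_conjTranspose_same C)

/-- With A = B*B, an entry is an inner product of two columns of B, and |xy| ≤ (|x|² + |y|²)/2
bounds it by the mean of two diagonal entries. Bounds on traces thus give entrywise convergence of
series of positive matrices. -/
theorem norm_entry_le_trace [DecidableEq n] {A : Matrix n n ℂ} (hA : A.PosSemidef) (a b : n) :
    ‖A a b‖ ≤ A.trace.re := by
  obtain ⟨B, rfl⟩ := posSemidef_exists_star_mul hA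
  have hdiag : ∀ a, ((B.conjTranspose * B) a a).re = ∑ k, ‖B k a‖ ^ 2 := by
    intro a
    simp only [Matrix.mul_apply, Matrix.conjTranspose_apply, Complex.re_sum]
    refine Finset.sum_congr rfl fun k _ => ?_
    rw [Complex.star_def, ← Complex.normSq_eq_conj_mul_self, Complex.ofReal_re,
      Complex.normSq_eq_norm_sq]
  have hle : ∀ a, ∑ k, ‖B k a‖ ^ 2 ≤ (B.conjTranspose * B).trace.re := by
    intro a
    rw [Matrix.trace, Complex.re_sum, ← hdiag]
    refine Finset.single_le_sum (f := fun a => ((B.conjTranspose * B) a a).re) (fun c _ => ?_)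
      (Finset.mem_univ a)
    rw [hdiag]
    positivity
  calc ‖(B.conjTranspose * B) a b‖ ≤ ∑ k, ‖B k a‖ * ‖B k b‖ := by
        rw [Matrix.mul_apply]
        refine (norm_sum_le _ _).trans (le_of_eq (Finset.sum_congr rfl fun k _ => ?_))
        rw [norm_mul, Matrix.conjTranspose_apply, norm_star]
    _ ≤ ∑ k, (‖B k a‖ ^ 2 + ‖B k b‖ ^ 2) / 2 :=
        Finset.sum_le_sum fun k _ => by nlinarith [sq_nonneg (‖B k a‖ - ‖B k b‖)]
    _ = (∑ k, ‖B k a‖ ^ 2 + ∑ k, ‖B k b‖ ^ 2) / 2 := by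
        rw [← Finset.sum_div, Finset.sum_add_distrib]
    _ ≤ (B.conjTranspose * B).trace.re := by linarith [hle a, hle b]

theorem isClosed_posSemidef : IsClosed {A : Matrix n n ℂ | A.PosSemidef} := by
  simp only [Matrix.posSemidef_iff_dotProduct_mulVec, Set.ofPred_and, Set.ofPred_forall]
  refine IsClosed.inter ?_ (isClosed_iInter fun x => ?_)
  · exact isClosed_eq (continuous_id.matrix_conjTranspose) continuous_id
  · refine isClosed_le continuous_const ?_
    exact Continuous.dotProduct continuous_const (Continuous.matrix_mulVec continuous_id continuous_const)

theorem posSemidef_real_smul {n : Type*} {A : Matrix n n ℂ} (hA : A.PosSemidef) {c : ℝ} (hc : 0 ≤ c) :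
    (c • A).PosSemidef := by
  have : c • A = (c : ℂ) • A := by ext; simp
  rw [this]
  exact hA.smul (by exact_mod_cast hc)

theorem trace_real_smul_re (c : ℝ) (A : Matrix n n ℂ) : (c • A).trace.re = c * A.trace.re := by
  rw [Matrix.trace_smul, Complex.smul_re, smul_eq_mul]

/-- Weighted sums of positive semidefinite matrices with bounded traces converge. -/
theorem summable_smul_posSemidef [DecidableEq n] {ι : Type*} {c : ι → ℝ} (hc : Summable c) (hc0 : ∀ k, 0 ≤ c k)
    {P : ι → Matrix n n ℂ} (hP : ∀ k, (P k).PosSemidef) {B : ℝ} (hB : ∀ k, (P k).trace.re ≤ B) :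
    Summable fun k => c k • P k := by
  refine Pi.summable.2 fun a => Pi.summable.2 fun b => ?_
  refine Summable.of_norm_bounded (hc.mul_right B) fun k => ?_
  rw [Matrix.smul_apply, norm_smul, Real.norm_of_nonneg (hc0 k)]
  exact mul_le_mul_of_nonneg_left ((norm_entry_le_trace (hP k) a b).trans (hB k)) (hc0 k)

/-- The linear functional `S ↦ Re Tr M S`. -/
def traceMulRe (M : Matrix n n ℂ) : Matrix n n ℂ →+ ℝ where
  toFun S := (M * S).trace.re
  map_zero' := by simp
  map_add' S T := by simp [Matrix.mul_add]

theorem continuous_traceMulRe (M : Matrix n n ℂ) : Continuous (traceMulRe M) :=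
  Complex.continuous_re.comp (Continuous.matrix_trace (continuous_const.matrix_mul continuous_id))

theorem hasSum_trace_mul {ι : Type*} {f : ι → Matrix n n ℂ} {S : Matrix n n ℂ} (h : HasSum f S)
    (M : Matrix n n ℂ) : HasSum (fun k => (M * f k).trace.re) (M * S).trace.re :=
  h.map (traceMulRe M) (continuous_traceMulRe M)

theorem hasSum_posSemidef {ι : Type*} {f : ι → Matrix n n ℂ} {S : Matrix n n ℂ} (h : HasSum f S)
    (hf : ∀ k, (f k).PosSemidef) : S.PosSemidef :=
  isClosed_posSemidef.mem_of_tendsto h (Filter.Eventually.of_forall fun s =>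
    Matrix.posSemidef_sum s fun k _ => hf k)

end Matrices

/-! ## Tensor products -/

section Tensor

variable {a b : ℕ}

theorem tensor_posSemidef {A : Matrix (Fin a) (Fin a) ℂ} {B : Matrix (Fin b) (Fin b) ℂ}
    (hA : A.PosSemidef) (hB : B.PosSemidef) : (tensor A B).PosSemidef :=
  (hA.kronecker hB).submatrix _

theorem tensor_one : tensor (1 : Matrix (Fin a) (Fin a) ℂ) (1 : Matrix (Fin b) (Fin b) ℂ) = 1 := by
  rw [tensor, Matrix.one_kronecker_one, Matrix.reindex_apply, Matrix.submatrix_one_equiv]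

theorem trace_tensor_mul_tensor (A C : Matrix (Fin a) (Fin a) ℂ) (B D : Matrix (Fin b) (Fin b) ℂ) :
    (tensor A B * tensor C D).trace = (A * C).trace * (B * D).trace := by
  rw [← Matrix.trace_kronecker, Matrix.mul_kronecker_mul]
  simp only [tensor, Matrix.reindex_apply, Matrix.submatrix_mul_equiv]
  simp only [Matrix.trace, Matrix.diag, Matrix.submatrix_apply]
  exact Equiv.sum_comp finProdFinEquiv.symm fun x => ((A ⊗ₖ B) * (C ⊗ₖ D)) x x

theorem trace_im_eq_zero {A B : Matrix (Fin a) (Fin a) ℂ} (hA : A.IsHermitian)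
    (hB : B.IsHermitian) : (A * B).trace.im = 0 := by
  have h : star (A * B).trace = (A * B).trace := by
    rw [← Matrix.trace_conjTranspose, Matrix.conjTranspose_mul, hA.eq, hB.eq, Matrix.trace_mul_comm]
  exact Complex.conj_eq_iff_im.1 h

/-- The real part is multiplicative here since the first trace, of a product of two Hermitian
matrices, is real. -/
theorem trace_tensor_mul_tensor_re {A C : Matrix (Fin a) (Fin a) ℂ} {B D : Matrix (Fin b) (Fin b) ℂ}
    (hA : A.IsHermitian) (hC : C.IsHermitian) :
    (tensor A B * tensor C D).trace.re = (A * C).trace.re * (B * D).trace.re := by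
  rw [trace_tensor_mul_tensor, Complex.mul_re, trace_im_eq_zero hA hC, zero_mul, sub_zero]

end Tensor

/-! ## Elementary states -/

section States

variable {d : ℕ}

theorem ElemState.proj_posSemidef (φ : ElemState d) : φ.proj.PosSemidef :=
  Matrix.posSemidef_vecMulVec_self_star _

theorem ElemState.trace_proj (φ : ElemState d) : φ.proj.trace.re = 1 := by
  have h : ((∑ k, ((φ.1 k).1 ^ 2 + (φ.1 k).2 ^ 2) : ℚ) : ℝ) = 1 := by rw [φ.2]; simp
  rw [← h]
  simp only [Matrix.trace, Matrix.diag, Complex.re_sum, ElemState.proj, Matrix.vecMulVec_apply,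
    Pi.star_apply, GaussRat.toComplex, Complex.mul_re, Complex.star_def, Complex.conj_re,
    Complex.conj_im]
  push_cast
  refine Finset.sum_congr rfl fun k _ => ?_
  ring

/-- The basis states. -/
def basisState (a : Fin d) : ElemState d :=
  ⟨fun k => if k = a then (1, 0) else (0, 0), by
    rw [Finset.sum_eq_single a] <;> simp +contextual⟩

theorem basisState_injective : Function.Injective (basisState (d := d)) := by
  intro a b h
  have := congrFun (congrArg Subtype.val h) a
  by_contra hne
  simp [basisState, hne] at this

theorem sum_basisState : ∑ a : Fin d, (basisState a).proj = 1 := by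
  ext i j
  rw [Matrix.sum_apply, Finset.sum_eq_single i]
  · by_cases h : i = j
    · subst h
      simp [ElemState.proj, Matrix.vecMulVec_apply, basisState, GaussRat.toComplex, Complex.ext_iff]
    · simp [ElemState.proj, Matrix.vecMulVec_apply, basisState, GaussRat.toComplex, Complex.ext_iff, h,
        Ne.symm h]
  · intro b _ hb
    simp [ElemState.proj, Matrix.vecMulVec_apply, basisState, GaussRat.toComplex, Complex.ext_iff,
      Ne.symm hb]
  · simp

end States

/-! ## The universal matrix -/

namespace Machine

variable (U : Machine)

theorem m_le_one (w : List ℕ) (x : ℕ) : U.m w x ≤ 1 :=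
  (ENNReal.le_tsum x).trans (U.tsum_m_le_one w)

theorem m_ne_top (w : List ℕ) (x : ℕ) : U.m w x ≠ ∞ :=
  ne_top_of_le_ne_top ENNReal.one_ne_top (U.m_le_one w x)

/-- Distinct states have distinct codes, so this is part of the sum over all numbers. -/
theorem tsum_m_state_le_one (w : List ℕ) (d : ℕ) :
    ∑' φ : ElemState d, U.m w (vecCode φ.1) ≤ 1 :=
  (ENNReal.tsum_comp_le_tsum_of_injective (f := fun φ : ElemState d => vecCode φ.1)
    (fun _ _ h => Subtype.ext (vecCode_injective h)) (U.m w)).trans (U.tsum_m_le_one w)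

theorem summable_m_state (w : List ℕ) (d : ℕ) :
    Summable fun φ : ElemState d => (U.m w (vecCode φ.1)).toReal :=
  ENNReal.summable_toReal (ne_top_of_le_ne_top ENNReal.one_ne_top (U.tsum_m_state_le_one w d))

theorem hasSum_mu (e : List ℕ) (n : ℕ) :
    HasSum (fun φ : ElemState (2 ^ n) => (U.m (n :: e) (vecCode φ.1)).toReal • φ.proj) (U.mu e n) :=
  (summable_smul_posSemidef (U.summable_m_state (n :: e) (2 ^ n)) (fun _ => ENNReal.toReal_nonneg)
    (fun φ => φ.proj_posSemidef) (fun φ => φ.trace_proj.le)).hasSum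

theorem mu_posSemidef (e : List ℕ) (n : ℕ) : (U.mu e n).PosSemidef :=
  hasSum_posSemidef (U.hasSum_mu e n) fun φ =>
    posSemidef_real_smul φ.proj_posSemidef ENNReal.toReal_nonneg

theorem hasSum_trace_mul_mu (e : List ℕ) (n : ℕ) (M : Matrix (Fin (2 ^ n)) (Fin (2 ^ n)) ℂ) :
    HasSum (fun φ : ElemState (2 ^ n) =>
      (U.m (n :: e) (vecCode φ.1)).toReal * (M * φ.proj).trace.re) (M * U.mu e n).trace.re := by
  have h := hasSum_trace_mul (U.hasSum_mu e n) M
  simp only [Matrix.mul_smul, trace_real_smul_re] at h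
  exact h

theorem trace_mul_mu_eq_tsum (e : List ℕ) (n : ℕ) {M : Matrix (Fin (2 ^ n)) (Fin (2 ^ n)) ℂ}
    (hM : M.PosSemidef) : ENNReal.ofReal (M * U.mu e n).trace.re =
      ∑' φ : ElemState (2 ^ n), U.m (n :: e) (vecCode φ.1) *
        ENNReal.ofReal (M * φ.proj).trace.re := by
  have h := U.hasSum_trace_mul_mu e n M
  rw [← h.tsum_eq, ENNReal.ofReal_tsum_of_nonneg (fun φ => mul_nonneg ENNReal.toReal_nonneg
    (trace_mul_re_nonneg hM φ.proj_posSemidef)) h.summable]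
  refine tsum_congr fun φ => ?_
  rw [ENNReal.ofReal_mul ENNReal.toReal_nonneg, ENNReal.ofReal_toReal (U.m_ne_top _ _)]

theorem IsUniversal.m_pos {U : Machine} (hU : U.IsUniversal) (w : List ℕ) (x : ℕ) :
    0 < (U.m w x).toReal := by
  obtain ⟨pr, -, -, h⟩ := hU.exists_printer
  refine ENNReal.toReal_pos (fun h0 => ?_) (U.m_ne_top w x)
  have := U.le_m (h w x).1
  rw [h0] at this
  simp at this

/-- The universal matrix is bounded from below by a multiple of the identity. -/
theorem IsUniversal.exists_mu_sub_posSemidef {U : Machine} (hU : U.IsUniversal) (e : List ℕ) (n : ℕ) :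
    ∃ δ : ℝ, 0 < δ ∧ (U.mu e n - δ • (1 : Matrix (Fin (2 ^ n)) (Fin (2 ^ n)) ℂ)).PosSemidef := by
  classical
  obtain ⟨a₀, -, h₀⟩ := Finset.exists_min_image Finset.univ
    (fun a : Fin (2 ^ n) => (U.m (n :: e) (vecCode (basisState a).1)).toReal)
    ⟨⟨0, by positivity⟩, Finset.mem_univ _⟩
  set δ := (U.m (n :: e) (vecCode (basisState a₀).1)).toReal with hδ
  refine ⟨δ, hU.m_pos _ _, ?_⟩
  -- `δ • 1` is the series with weight `δ` on the basis states and 0 elsewhere. As `δ` is the least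
  -- probability of a basis state, the difference of the two series has nonnegative weights.
  set g : ElemState (2 ^ n) → ℝ := fun φ => if φ ∈ Finset.univ.image (basisState (d := 2 ^ n))
    then δ else 0 with hg
  have hsum : HasSum (fun φ : ElemState (2 ^ n) => g φ • φ.proj)
      (δ • (1 : Matrix (Fin (2 ^ n)) (Fin (2 ^ n)) ℂ)) := by
    have h1 : δ • (1 : Matrix (Fin (2 ^ n)) (Fin (2 ^ n)) ℂ) =
        ∑ φ ∈ Finset.univ.image (basisState (d := 2 ^ n)), g φ • φ.proj := by
      rw [← sum_basisState, Finset.smul_sum, Finset.sum_image basisState_injective.injOn]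
      refine Finset.sum_congr rfl fun a _ => ?_
      rw [hg]
      simp
    rw [h1]
    refine hasSum_sum_of_ne_finset_zero fun φ hφ => ?_
    rw [hg]
    simp only [if_neg hφ, zero_smul]
  refine hasSum_posSemidef ((U.hasSum_mu e n).sub hsum) fun φ => ?_
  rw [← sub_smul]
  refine posSemidef_real_smul φ.proj_posSemidef ?_
  rw [hg]
  dsimp only
  split_ifs with h
  · obtain ⟨a, -, rfl⟩ := Finset.mem_image.1 h
    exact sub_nonneg.2 (h₀ a (Finset.mem_univ a))
  · rw [sub_zero]; exact ENNReal.toReal_nonneg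

/-- The product tests have bounded traces. -/
theorem IsUniversal.exists_trace_le {U : Machine} (hU : U.IsUniversal) (e : List ℕ) (n : ℕ) :
    ∃ B : ℝ, ∀ ν : Matrix (Fin (2 ^ n * 2 ^ n)) (Fin (2 ^ n * 2 ^ n)) ℂ, ν.PosSemidef →
      (ν * tensor (U.mu e n) (U.mu e n)).trace.re ≤ 1 → ν.trace.re ≤ B := by
  obtain ⟨δ, hδ, hR⟩ := hU.exists_mu_sub_posSemidef e n
  refine ⟨(δ * δ)⁻¹, fun ν hν h1 => ?_⟩
  -- μ ⊗ μ - δ²·1 = (μ - δ·1) ⊗ μ + δ·1 ⊗ (μ - δ·1), a sum of positive semidefinite matrices. Hence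
  -- δ² Tr ν ≤ Tr ν(μ ⊗ μ) ≤ 1.
  have hpos : (tensor (U.mu e n) (U.mu e n) - (δ * δ) • 1).PosSemidef := by
    have h2 := (tensor_posSemidef hR (U.mu_posSemidef e n)).add
      (posSemidef_real_smul (tensor_posSemidef (Matrix.PosSemidef.one (n := Fin (2 ^ n)) (R := ℂ)) hR)
        hδ.le)
    convert h2 using 1
    rw [← tensor_one]
    ext x y
    simp only [tensor, Matrix.reindex_apply, Matrix.submatrix_apply, Matrix.kroneckerMap_apply,
      Matrix.sub_apply, Matrix.add_apply, Matrix.smul_apply, Complex.real_smul]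
    push_cast
    ring
  have h3 := trace_mul_re_nonneg hν hpos
  rw [Matrix.mul_sub, Matrix.trace_sub, Complex.sub_re, Matrix.mul_smul, Matrix.mul_one,
    trace_real_smul_re] at h3
  rw [inv_eq_one_div, le_div_iff₀ (by positivity)]
  linarith

end Machine

namespace Machine

variable (U : Machine)

/-! ## Probabilities of outcomes in the universal matrix -/

/-- The program `p` outputs a code of the state `φ`. -/
def OutputsState {d : ℕ} (w : List ℕ) (p : List Bool) (φ : ElemState d) : Prop :=
  ∃ x, U.Outputs w p x ∧ Encodable.decode (α := List (ℚ × ℚ)) x = some (List.ofFn φ.1)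

theorem OutputsState.unique {U : Machine} {d : ℕ} {w : List ℕ} {p : List Bool} {φ ψ : ElemState d}
    (h : U.OutputsState w p φ) (h' : U.OutputsState w p ψ) : φ = ψ := by
  obtain ⟨x, h1, h2⟩ := h
  obtain ⟨y, h3, h4⟩ := h'
  rw [Outputs.unique U h1 h3, h4] at h2
  exact Subtype.ext (List.ofFn_injective (Option.some.inj h2).symm)

theorem Outputs.outputsState {U : Machine} {d : ℕ} {w : List ℕ} {p : List Bool} {φ : ElemState d}
    (h : U.Outputs w p (vecCode φ.1)) : U.OutputsState w p φ :=
  ⟨_, h, by rw [← encode_ofFn_vec, Encodable.encodek]⟩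

open Classical in
/-- The contribution of the program `p` to the value of `Tr M μ`. -/
noncomputable def weightedTrace {d : ℕ} (w : List ℕ) (M : Matrix (Fin d) (Fin d) ℂ) (p : List Bool) : ℝ :=
  if h : ∃ φ : ElemState d, U.OutputsState w p φ then
    (2 ^ p.length)⁻¹ * (M * h.choose.proj).trace.re else 0

theorem weightedTrace_eq {d : ℕ} {w : List ℕ} {M : Matrix (Fin d) (Fin d) ℂ} {p : List Bool}
    {φ : ElemState d} (h : U.OutputsState w p φ) :
    U.weightedTrace w M p = (2 ^ p.length)⁻¹ * (M * φ.proj).trace.re := by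
  have hex : ∃ φ : ElemState d, U.OutputsState w p φ := ⟨φ, h⟩
  rw [weightedTrace, dif_pos hex, hex.choose_spec.unique h]

theorem weightedTrace_nonneg {d : ℕ} (w : List ℕ) {M : Matrix (Fin d) (Fin d) ℂ}
    (hM : M.PosSemidef) (p : List Bool) : 0 ≤ U.weightedTrace w M p := by
  unfold weightedTrace
  split_ifs with h
  · exact mul_nonneg (by positivity) (trace_mul_re_nonneg hM (ElemState.proj_posSemidef _))
  · exact le_rfl

theorem ofReal_inv_two_pow_mul (l : ℕ) (x : ℝ) :
    ENNReal.ofReal ((2 ^ l)⁻¹ * x) = (2 : ℝ≥0∞)⁻¹ ^ l * ENNReal.ofReal x := by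
  rw [ENNReal.ofReal_mul (by positivity), ← inv_pow, ENNReal.ofReal_pow (by positivity),
    ENNReal.ofReal_inv_of_pos (by norm_num), ENNReal.ofReal_ofNat]

/-- `OutputsState` accepts every output that decodes to the state, whether or not it is the code of
the state; so the sum over programs is only claimed to dominate. That is enough, as it still is a
semimeasure by `tsum_weightedTrace_le_one`. -/
theorem ofReal_trace_mul_mu_le (e : List ℕ) (n : ℕ) {M : Matrix (Fin (2 ^ n)) (Fin (2 ^ n)) ℂ}
    (hM : M.PosSemidef) : ENNReal.ofReal (M * U.mu e n).trace.re ≤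
      ∑' p, ENNReal.ofReal (U.weightedTrace (n :: e) M p) := by
  rw [trace_mul_mu_eq_tsum U e n hM]
  simp_rw [m_eq_tsum, ← ENNReal.tsum_mul_right]
  rw [ENNReal.tsum_comm]
  refine ENNReal.tsum_le_tsum fun p => ?_
  by_cases h : ∃ φ : ElemState (2 ^ n), U.Outputs (n :: e) p (vecCode φ.1)
  · obtain ⟨φ, hφ⟩ := h
    rw [tsum_eq_single φ]
    · rw [U.weightedTrace_eq hφ.outputsState, ofReal_inv_two_pow_mul,
        Set.indicator_of_mem (show p ∈ {p | U.Outputs (n :: e) p (vecCode φ.1)} from hφ)]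
    · intro ψ hψ
      rw [Set.indicator_of_notMem, zero_mul]
      exact fun h : U.Outputs (n :: e) p (vecCode ψ.1) =>
        hψ (h.outputsState.unique hφ.outputsState)
  · push Not at h
    refine le_trans (le_of_eq (ENNReal.tsum_eq_zero.2 fun φ => ?_)) zero_le
    rw [Set.indicator_of_notMem (show p ∉ {p | U.Outputs (n :: e) p (vecCode φ.1)} from h φ), zero_mul]

/-- A program that outputs φ contributes 2^(-|p|) Σ_i ⟨φ|E_i|φ⟩ = 2^(-|p|), because the POVM adds up
to the identity. The Kraft inequality bounds the total. -/
theorem tsum_weightedTrace_le_one {d : ℕ} (w : List ℕ) {E : ℕ → Matrix (Fin d) (Fin d) ℂ}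
    (hE : IsPOVM E) : ∑' i, ∑' p, ENNReal.ofReal (U.weightedTrace w (E i) p) ≤ 1 := by
  rw [ENNReal.tsum_comm]
  refine le_trans (ENNReal.tsum_le_tsum fun p => ?_) (U.tsum_halting_le_one w)
  by_cases h : ∃ φ : ElemState d, U.OutputsState w p φ
  · obtain ⟨φ, hφ⟩ := h
    have hx : p ∈ {p | ∃ x, U.Outputs w p x} := by
      obtain ⟨x, hx, -⟩ := hφ
      exact ⟨x, hx⟩
    rw [Set.indicator_of_mem hx]
    simp_rw [U.weightedTrace_eq hφ, ofReal_inv_two_pow_mul]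
    rw [ENNReal.tsum_mul_left]
    have hs : HasSum (fun i => (E i * φ.proj).trace.re) 1 := by
      have h := hasSum_trace_mul hE.hasSum φ.proj
      rw [Matrix.mul_one, φ.trace_proj] at h
      exact h.congr_fun fun i => by rw [Matrix.trace_mul_comm]
    rw [← ENNReal.ofReal_tsum_of_nonneg (fun i => trace_mul_re_nonneg (hE.posSemidef i)
      φ.proj_posSemidef) hs.summable, hs.tsum_eq, ENNReal.ofReal_one, mul_one]
  · have : ∀ i, U.weightedTrace w (E i) p = 0 := fun i => dif_neg h
    simp [this]

section Approx

variable {U} {n : ℕ} {q : List Bool} {E : ℕ → Matrix (Fin (2 ^ n)) (Fin (2 ^ n)) ℂ}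

theorem stateWeight_ofFn {d : ℕ} (p : List Bool) (φ : ElemState d) (A : ElemMatrix d) :
    ((stateWeight d p (List.ofFn φ.1) (List.ofFn fun a => List.ofFn (A a)) : ℚ) : ℝ) =
      (2 ^ p.length)⁻¹ * (A.toMatrix * φ.proj).trace.re := by
  have h1 : normSq d (List.ofFn φ.1) = 1 := by rw [normSq_ofFn]; exact φ.2
  rw [stateWeight, h1, ← quadForm_ofFn]
  simp

/-- A contribution does not grow gradually: it is 0 until the vector and the matrix are both known,
and then has its exact final value. Nonnegativity and the upper bound are read off from this. -/
theorem contribution_eq (hq : U.Enumerates q E) (p : List Bool) (t i : ℕ) :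
    U.contribution (([n, Encodable.encode q], p), t, i) = 0 ∨
      ((U.contribution (([n, Encodable.encode q], p), t, i) : ℚ) : ℝ) =
        U.weightedTrace [n, Encodable.encode q] (E i) p := by
  have hgetn : [n, Encodable.encode q].getD 0 0 = n := rfl
  have hgetq : [n, Encodable.encode q].getD 1 0 = Encodable.encode q := rfl
  simp only [contribution, hgetn, hgetq, decodeProgram_encode]
  cases hv : U.vectorAt ([n, Encodable.encode q], p, t) with
  | none => exact Or.inl rfl
  | some v =>
    cases hA : U.matrixAt (q, t, i) with
    | none => exact Or.inl rfl
    | some B =>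
      simp only [Option.bind_some, Option.map_some, Option.getD_some]
      obtain ⟨A, hAE, rfl⟩ := U.matrixAt_of_enumerates hq hA
      by_cases hcond : v.length = 2 ^ n ∧ normSq (2 ^ n) v = 1
      · obtain ⟨hl, hnorm⟩ := hcond
        obtain ⟨φ, rfl⟩ : ∃ φ : Fin (2 ^ n) → GaussRat, v = List.ofFn φ := by
          refine ⟨fun k => v.get (k.cast hl.symm), List.ext_getElem (by simp [hl]) fun k h1 h2 => ?_⟩
          simp
        rw [normSq_ofFn] at hnorm
        right
        rw [U.vectorAt_eq_some] at hv
        obtain ⟨x, hx1, hx2⟩ := hv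
        rw [U.weightedTrace_eq (φ := ⟨φ, hnorm⟩) ⟨x, U.outputs_iff_haltVal.2 ⟨t, hx1⟩, hx2⟩, ← hAE,
          ← stateWeight_ofFn]
      · left
        rw [stateWeight, ← Bool.decide_and, decide_eq_false hcond]
        rfl

theorem contribution_nonneg (hE : IsPOVM E) (hq : U.Enumerates q E) (p : List Bool) (t i : ℕ) :
    0 ≤ U.contribution (([n, Encodable.encode q], p), t, i) := by
  rcases contribution_eq hq p t i with h | h
  · exact h.ge
  · have := U.weightedTrace_nonneg [n, Encodable.encode q] (hE.posSemidef i) p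
    rw [← h] at this
    exact_mod_cast this

theorem contribution_le (hE : IsPOVM E) (hq : U.Enumerates q E) (p : List Bool) (t i : ℕ) :
    ((U.contribution (([n, Encodable.encode q], p), t, i) : ℚ) : ℝ) ≤
      U.weightedTrace [n, Encodable.encode q] (E i) p := by
  rcases contribution_eq hq p t i with h | h
  · rw [h, Rat.cast_zero]
    exact U.weightedTrace_nonneg _ (hE.posSemidef i) p
  · exact h.le

theorem contribution_mono (hE : IsPOVM E) (hq : U.Enumerates q E) (p : List Bool) {t t' : ℕ}
    (h : t ≤ t') (i : ℕ) : U.contribution (([n, Encodable.encode q], p), t, i) ≤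
      U.contribution (([n, Encodable.encode q], p), t', i) := by
  have h0 := contribution_nonneg hE hq p t' i
  revert h0
  simp only [contribution]
  intro h0
  cases hv : U.vectorAt ([n, Encodable.encode q], p, t) with
  | none => exact h0
  | some v =>
    cases hA : U.matrixAt (decodeProgram ([n, Encodable.encode q].getD 1 0), t, i) with
    | none => exact h0
    | some B => rw [U.vectorAt_mono h hv, U.matrixAt_mono h hA]

theorem exists_contribution_eq (hE : IsPOVM E) (hq : U.Enumerates q E) (p : List Bool) (i : ℕ) :
    ∃ T, ∀ t ≥ T, ((U.contribution (([n, Encodable.encode q], p), t, i) : ℚ) : ℝ) =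
      U.weightedTrace [n, Encodable.encode q] (E i) p := by
  by_cases h : ∃ φ : ElemState (2 ^ n), U.OutputsState [n, Encodable.encode q] p φ
  · obtain ⟨φ, hφ⟩ := h
    have hφ' := hφ
    obtain ⟨x, hx1, hx2⟩ := hφ
    obtain ⟨t₁, ht₁⟩ := U.outputs_iff_haltVal.1 hx1
    rcases hq.2 i with ⟨A, hA1, hA2⟩ | ⟨h0, -⟩
    · obtain ⟨t₂, ht₂⟩ := U.exists_matrixAt hA2
      refine ⟨max t₁ t₂, fun t ht => ?_⟩
      have h1 := U.vectorAt_mono (le_of_max_le_left ht) (U.vectorAt_eq_some.2 ⟨x, ht₁, hx2⟩)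
      have h2 := U.matrixAt_mono (le_of_max_le_right ht) ht₂
      rw [U.weightedTrace_eq hφ', ← hA1, ← stateWeight_ofFn]
      have hgetn : [n, Encodable.encode q].getD 0 0 = n := rfl
      have hgetq : [n, Encodable.encode q].getD 1 0 = Encodable.encode q := rfl
      simp only [contribution, hgetn, hgetq, decodeProgram_encode, h1, h2, Option.bind_some,
        Option.map_some, Option.getD_some]
    -- Beyond the end of a finite sequence no matrix ever appears, and the value to be reached is 0.
    · refine ⟨0, fun t _ => ?_⟩
      have hz : U.weightedTrace [n, Encodable.encode q] (E i) p = 0 := by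
        rw [U.weightedTrace_eq hφ', h0]; simp
      rw [hz]
      refine le_antisymm ?_ (by exact_mod_cast contribution_nonneg hE hq p t i)
      rw [← hz]
      exact contribution_le hE hq p t i
  · refine ⟨0, fun t _ => ?_⟩
    have hz : U.weightedTrace [n, Encodable.encode q] (E i) p = 0 := dif_neg h
    rcases contribution_eq hq p t i with h | h
    · rw [h, hz, Rat.cast_zero]
    · exact h

theorem codeContribution_nonneg (hE : IsPOVM E) (hq : U.Enumerates q E) (t i k : ℕ) :
    0 ≤ U.codeContribution [n, Encodable.encode q] t i k := by
  by_cases hk : k ∈ Set.range (Encodable.encode : List Bool → ℕ)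
  · obtain ⟨p, rfl⟩ := hk
    rw [codeContribution_encode]
    exact contribution_nonneg hE hq p t i
  · rw [U.codeContribution_eq_zero _ t i hk]

theorem outcomeApprox_mono (hE : IsPOVM E) (hq : U.Enumerates q E) (i : ℕ) :
    Monotone fun t => U.outcomeApprox [n, Encodable.encode q] t i := by
  intro t t' h
  refine (Finset.sum_le_sum fun k _ => ?_).trans (Finset.sum_le_sum_of_subset_of_nonneg
    (Finset.range_mono h) fun k _ _ => codeContribution_nonneg hE hq t' i k)
  by_cases hk : k ∈ Set.range (Encodable.encode : List Bool → ℕ)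
  · obtain ⟨p, rfl⟩ := hk
    rw [codeContribution_encode, codeContribution_encode]
    exact contribution_mono hE hq p h i
  · rw [U.codeContribution_eq_zero _ t i hk, U.codeContribution_eq_zero _ t' i hk]

theorem outcomeApprox_le (hE : IsPOVM E) (hq : U.Enumerates q E) (t i : ℕ) :
    ENNReal.ofReal (U.outcomeApprox [n, Encodable.encode q] t i) ≤
      ∑' p, ENNReal.ofReal (U.weightedTrace [n, Encodable.encode q] (E i) p) := by
  have h1 : ∑' k, ENNReal.ofReal (U.codeContribution [n, Encodable.encode q] t i k) =
      ∑' p : List Bool,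
        ENNReal.ofReal (U.codeContribution [n, Encodable.encode q] t i (Encodable.encode p)) := by
    refine (Function.Injective.tsum_eq (Encodable.encode_injective (α := List Bool))
      (f := fun k => ENNReal.ofReal (U.codeContribution [n, Encodable.encode q] t i k)) ?_).symm
    intro k hk
    by_contra hk'
    exact hk (by simp [U.codeContribution_eq_zero _ t i hk'])
  calc ENNReal.ofReal (U.outcomeApprox [n, Encodable.encode q] t i)
      = ∑ k ∈ Finset.range t,
          ENNReal.ofReal (U.codeContribution [n, Encodable.encode q] t i k) := by
        rw [outcomeApprox, Rat.cast_sum, ENNReal.ofReal_sum_of_nonneg fun k _ => by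
          exact_mod_cast codeContribution_nonneg hE hq t i k]
    _ ≤ ∑' k, ENNReal.ofReal (U.codeContribution [n, Encodable.encode q] t i k) :=
        ENNReal.sum_le_tsum _
    _ ≤ _ := by
        rw [h1]
        refine ENNReal.tsum_le_tsum fun p => ENNReal.ofReal_le_ofReal ?_
        rw [codeContribution_encode]
        exact contribution_le hE hq p t i

/-- Finitely many programs already bring the sum above `c`. It remains to wait until each of them
has made its final contribution and has a code within the range of summation. -/
theorem exists_lt_outcomeApprox (hE : IsPOVM E) (hq : U.Enumerates q E) {i : ℕ} {c : ℚ} (hc : 0 ≤ c)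
    (h : (c : ℝ) < (E i * U.mu [Encodable.encode q] n).trace.re) :
    ∃ t, c < U.outcomeApprox [n, Encodable.encode q] t i := by
  classical
  have h1 : ENNReal.ofReal (c : ℝ) <
      ∑' p, ENNReal.ofReal (U.weightedTrace [n, Encodable.encode q] (E i) p) := by
    refine lt_of_lt_of_le ?_ (U.ofReal_trace_mul_mu_le [Encodable.encode q] n (hE.posSemidef i))
    exact (ENNReal.ofReal_lt_ofReal_iff (lt_of_le_of_lt (by exact_mod_cast hc) h)).2 h
  rw [ENNReal.tsum_eq_iSup_sum, lt_iSup_iff] at h1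
  obtain ⟨S, hS⟩ := h1
  rw [← ENNReal.ofReal_sum_of_nonneg fun p _ => U.weightedTrace_nonneg _ (hE.posSemidef i) p,
    ENNReal.ofReal_lt_ofReal_iff_of_nonneg (by exact_mod_cast hc)] at hS
  choose T hT using fun p => exists_contribution_eq hE hq p i
  set t := (S.sup T) ⊔ (S.sup fun p => Encodable.encode p + 1) with ht
  refine ⟨t, ?_⟩
  have h2 : ((∑ p ∈ S, U.contribution (([n, Encodable.encode q], p), t, i) : ℚ) : ℝ) =
      ∑ p ∈ S, U.weightedTrace [n, Encodable.encode q] (E i) p := by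
    rw [Rat.cast_sum]
    exact Finset.sum_congr rfl fun p hp => hT p t ((Finset.le_sup hp).trans le_sup_left)
  rw [← h2] at hS
  have h3 : c < ∑ p ∈ S, U.contribution (([n, Encodable.encode q], p), t, i) := by
    exact_mod_cast hS
  refine h3.trans_le ?_
  have h4 : ∑ p ∈ S, U.contribution (([n, Encodable.encode q], p), t, i) =
      ∑ k ∈ S.image Encodable.encode, U.codeContribution [n, Encodable.encode q] t i k := by
    rw [Finset.sum_image Encodable.encode_injective.injOn]
    exact Finset.sum_congr rfl fun p _ => (U.codeContribution_encode _ t i p).symm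
  rw [h4]
  refine Finset.sum_le_sum_of_subset_of_nonneg ?_ fun k _ _ => codeContribution_nonneg hE hq t i k
  intro k hk
  obtain ⟨p, hp, rfl⟩ := Finset.mem_image.1 hk
  have : Encodable.encode p + 1 ≤ t :=
    (Finset.le_sup (f := fun p => Encodable.encode p + 1) hp).trans le_sup_right
  exact Finset.mem_range.2 this

theorem trace_mul_mu_le_one (hE : IsPOVM E) (e : List ℕ) (i : ℕ) :
    (E i * U.mu e n).trace.re ≤ 1 := by
  rw [← ENNReal.ofReal_le_one]
  exact (U.ofReal_trace_mul_mu_le e n (hE.posSemidef i)).trans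
    ((ENNReal.le_tsum i).trans (U.tsum_weightedTrace_le_one (n :: e) hE))

end Approx

/-- The probability of the outcome `i` in the universal matrix is at most `2^{-K(i)}`, up to a
constant factor. -/
theorem IsUniversal.exists_trace_mul_mu_le {U : Machine} (hU : U.IsUniversal) :
    ∃ c : ℕ, ∀ (n : ℕ) (E : ℕ → Matrix (Fin (2 ^ n)) (Fin (2 ^ n)) ℂ) (q : List Bool),
      IsPOVM E → U.Enumerates q E → ∀ i : ℕ,
        (E i * U.mu [Encodable.encode q] n).trace.re * 2 ^ U.K [n, Encodable.encode q] i ≤ 2 ^ c := by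
  classical
  obtain ⟨c, hc⟩ := hU.exists_K_le U.outcomeApprox_computable
  refine ⟨c + 1, fun n E q hE hq i => ?_⟩
  have hK := hc [n, Encodable.encode q] (outcomeApprox_mono hE hq) (fun _ => rfl) _
    (outcomeApprox_le hE hq) (U.tsum_weightedTrace_le_one _ hE) i
  set T := (E i * U.mu [Encodable.encode q] n).trace.re with hT
  rcases le_or_gt T 0 with h0 | h0
  · exact (mul_nonpos_of_nonpos_of_nonneg h0 (by positivity)).trans (by positivity)
  have hex : ∃ l : ℕ, ((2 : ℝ) ^ l)⁻¹ < T := by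
    obtain ⟨l, hl⟩ := exists_pow_lt_of_lt_one h0 (show (2 : ℝ)⁻¹ < 1 by norm_num)
    exact ⟨l, by rwa [← inv_pow]⟩
  -- Rounding to powers of two; such an `l ≥ 0` exists because the probability is at most 1. The
  -- strict lower bound is what the approximations eventually exceed, and it costs the additional 1
  -- in the constant.
  obtain ⟨l, hl1, hl2⟩ : ∃ l : ℕ, ((2 : ℝ) ^ (l + 1))⁻¹ < T ∧ T ≤ ((2 : ℝ) ^ l)⁻¹ := by
    have h1 := Nat.find_spec hex
    have h2 : Nat.find hex ≠ 0 := by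
      intro h
      rw [h] at h1
      have := trace_mul_mu_le_one (U := U) hE [Encodable.encode q] i
      simp at h1
      linarith
    obtain ⟨l, hl⟩ := Nat.exists_eq_succ_of_ne_zero h2
    exact ⟨l, by rwa [hl] at h1, not_lt.1 (Nat.find_min hex (by omega))⟩
  obtain ⟨t, ht⟩ := exists_lt_outcomeApprox (c := ((2 : ℚ) ^ (l + 1))⁻¹) hE hq (by positivity)
    (by push_cast; exact hl1)
  calc T * 2 ^ U.K [n, Encodable.encode q] i ≤ ((2 : ℝ) ^ l)⁻¹ * 2 ^ (l + (c + 1)) := by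
        refine mul_le_mul hl2 (pow_le_pow_right₀ (by norm_num) ?_) (by positivity) (by positivity)
        have := hK (l + 1) t ht
        omega
    _ = 2 ^ (c + 1) := by
        rw [pow_add, inv_mul_cancel_left₀ (by positivity)]

end Machine

/-! ## Coded tensor products -/

/-- The entry `s • x * y` of a scaled tensor product. -/
def scaledMul (s : ℚ) (x y : ℚ × ℚ) : ℚ × ℚ :=
  (s * (x.1 * y.1 - x.2 * y.2), s * (x.1 * y.2 + x.2 * y.1))

theorem primrec_scaledMul :
    Primrec fun a : ℚ × (ℚ × ℚ) × (ℚ × ℚ) => scaledMul a.1 a.2.1 a.2.2 := by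
  have x1 : Primrec fun a : ℚ × (ℚ × ℚ) × (ℚ × ℚ) => a.2.1.1 :=
    Primrec.fst.comp (Primrec.fst.comp Primrec.snd)
  have x2 : Primrec fun a : ℚ × (ℚ × ℚ) × (ℚ × ℚ) => a.2.1.2 :=
    Primrec.snd.comp (Primrec.fst.comp Primrec.snd)
  have y1 : Primrec fun a : ℚ × (ℚ × ℚ) × (ℚ × ℚ) => a.2.2.1 :=
    Primrec.fst.comp (Primrec.snd.comp Primrec.snd)
  have y2 : Primrec fun a : ℚ × (ℚ × ℚ) × (ℚ × ℚ) => a.2.2.2 :=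
    Primrec.snd.comp (Primrec.snd.comp Primrec.snd)
  exact (primrec_rat_mul.comp Primrec.fst (primrec_rat_sub.comp (primrec_rat_mul.comp x1 y1)
    (primrec_rat_mul.comp x2 y2))).pair (primrec_rat_mul.comp Primrec.fst
      (primrec_rat_add.comp (primrec_rat_mul.comp x1 y2) (primrec_rat_mul.comp x2 y1)))

/-- The matrix `s • A ⊗ B`. -/
def ElemMatrix.scaledTensor {d : ℕ} (s : ℚ) (A B : ElemMatrix d) : ElemMatrix (d * d) :=
  -- `divNat` and `modNat` are the coordinates of the inverse of `finProdFinEquiv`, in agreement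
  -- with `tensor`.
  fun x y => scaledMul s (A x.divNat y.divNat) (B x.modNat y.modNat)

theorem ElemMatrix.toMatrix_scaledTensor {d : ℕ} (s : ℚ) (A B : ElemMatrix d) :
    (A.scaledTensor s B).toMatrix = tensor ((s : ℝ) • A.toMatrix) B.toMatrix := by
  ext x y
  simp only [ElemMatrix.toMatrix, ElemMatrix.scaledTensor, tensor, Matrix.reindex_apply,
    Matrix.submatrix_apply, Matrix.kroneckerMap_apply, Matrix.smul_apply, finProdFinEquiv_symm_apply,
    GaussRat.toComplex, scaledMul, Complex.ext_iff, Complex.mul_re, Complex.mul_im, Complex.smul_re,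
    Complex.smul_im, smul_eq_mul]
  push_cast
  constructor <;> ring

/-- The code of `s • A ⊗ B`, computed from the rows of `A` and `B`. -/
def scaledTensorRows (d : ℕ) (s : ℚ) (A B : List (List (ℚ × ℚ))) : List (List (ℚ × ℚ)) :=
  (List.range (d * d)).map fun x => (List.range (d * d)).map fun y =>
    scaledMul s (matEntry A (x / d) (y / d)) (matEntry B (x % d) (y % d))

theorem scaledTensorRows_ofFn {d : ℕ} (s : ℚ) (A B : ElemMatrix d) :
    scaledTensorRows d s (List.ofFn fun a => List.ofFn (A a)) (List.ofFn fun a => List.ofFn (B a)) =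
      List.ofFn fun x => List.ofFn (A.scaledTensor s B x) := by
  have hmap : ∀ {α : Type} (m : ℕ) (f : ℕ → α), (List.range m).map f = List.ofFn fun k : Fin m => f k :=
    fun m f => List.ext_getElem (by simp) fun k h1 h2 => by simp
  rw [scaledTensorRows, hmap]
  congr 1
  funext x
  rw [hmap]
  congr 1
  funext y
  rw [ElemMatrix.scaledTensor, ← matEntry_ofFn A, ← matEntry_ofFn B]
  rfl

theorem primrec_scaledTensorRows :
    Primrec fun a : ℕ × ℚ × List (List (ℚ × ℚ)) × List (List (ℚ × ℚ)) =>
      scaledTensorRows a.1 a.2.1 a.2.2.1 a.2.2.2 := by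
  have hr : Primrec fun a : ℕ × ℚ × List (List (ℚ × ℚ)) × List (List (ℚ × ℚ)) =>
      List.range (a.1 * a.1) :=
    Primrec.list_range.comp (Primrec.nat_mul.comp Primrec.fst Primrec.fst)
  refine Primrec.list_map hr (Primrec.list_map (hr.comp Primrec.fst) ?_)
  have hd : Primrec fun b : ((ℕ × ℚ × List (List (ℚ × ℚ)) × List (List (ℚ × ℚ))) × ℕ) × ℕ =>
      b.1.1.1 := Primrec.fst.comp (Primrec.fst.comp Primrec.fst)
  have hs : Primrec fun b : ((ℕ × ℚ × List (List (ℚ × ℚ)) × List (List (ℚ × ℚ))) × ℕ) × ℕ =>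
      b.1.1.2.1 := Primrec.fst.comp (Primrec.snd.comp (Primrec.fst.comp Primrec.fst))
  have hA : Primrec fun b : ((ℕ × ℚ × List (List (ℚ × ℚ)) × List (List (ℚ × ℚ))) × ℕ) × ℕ =>
      b.1.1.2.2.1 :=
    Primrec.fst.comp (Primrec.snd.comp (Primrec.snd.comp (Primrec.fst.comp Primrec.fst)))
  have hB : Primrec fun b : ((ℕ × ℚ × List (List (ℚ × ℚ)) × List (List (ℚ × ℚ))) × ℕ) × ℕ =>
      b.1.1.2.2.2 :=
    Primrec.snd.comp (Primrec.snd.comp (Primrec.snd.comp (Primrec.fst.comp Primrec.fst)))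
  have hx : Primrec fun b : ((ℕ × ℚ × List (List (ℚ × ℚ)) × List (List (ℚ × ℚ))) × ℕ) × ℕ =>
      b.1.2 := Primrec.snd.comp Primrec.fst
  have hy : Primrec fun b : ((ℕ × ℚ × List (List (ℚ × ℚ)) × List (List (ℚ × ℚ))) × ℕ) × ℕ =>
      b.2 := Primrec.snd
  have eA : Primrec fun b : ((ℕ × ℚ × List (List (ℚ × ℚ)) × List (List (ℚ × ℚ))) × ℕ) × ℕ =>
      matEntry b.1.1.2.2.1 (b.1.2 / b.1.1.1) (b.2 / b.1.1.1) :=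
    Primrec.comp (f := fun a : List (List (ℚ × ℚ)) × ℕ × ℕ => matEntry a.1 a.2.1 a.2.2)
      (g := fun b : ((ℕ × ℚ × List (List (ℚ × ℚ)) × List (List (ℚ × ℚ))) × ℕ) × ℕ =>
        (b.1.1.2.2.1, b.1.2 / b.1.1.1, b.2 / b.1.1.1)) primrec_matEntry
      (hA.pair ((Primrec.nat_div.comp hx hd).pair (Primrec.nat_div.comp hy hd)))
  have eB : Primrec fun b : ((ℕ × ℚ × List (List (ℚ × ℚ)) × List (List (ℚ × ℚ))) × ℕ) × ℕ =>
      matEntry b.1.1.2.2.2 (b.1.2 % b.1.1.1) (b.2 % b.1.1.1) :=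
    Primrec.comp (f := fun a : List (List (ℚ × ℚ)) × ℕ × ℕ => matEntry a.1 a.2.1 a.2.2)
      (g := fun b : ((ℕ × ℚ × List (List (ℚ × ℚ)) × List (List (ℚ × ℚ))) × ℕ) × ℕ =>
        (b.1.1.2.2.2, b.1.2 % b.1.1.1, b.2 % b.1.1.1)) primrec_matEntry
      (hB.pair ((Primrec.nat_mod.comp hx hd).pair (Primrec.nat_mod.comp hy hd)))
  exact Primrec.comp (f := fun a : ℚ × (ℚ × ℚ) × (ℚ × ℚ) => scaledMul a.1 a.2.1 a.2.2)
    (g := fun b : ((ℕ × ℚ × List (List (ℚ × ℚ)) × List (List (ℚ × ℚ))) × ℕ) × ℕ =>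
      (b.1.1.2.1, matEntry b.1.1.2.2.1 (b.1.2 / b.1.1.1) (b.2 / b.1.1.1),
        matEntry b.1.1.2.2.2 (b.1.2 % b.1.1.1) (b.2 % b.1.1.1)))
    primrec_scaledMul (hs.pair (eA.pair eB))

-- A decoder from descriptions of a pair and of its information to a test

namespace Machine

variable (U : Machine)

/-- The machine wants to read beyond the end of its program. -/
def starvedB (a : List ℕ × List Bool × ℕ) : Bool :=
  U.readingB (U.conf a.1 a.2.1 a.2.2).state && decide ((U.conf a.1 a.2.1 a.2.2).input.length = 0)

theorem starvedB_computable : Computable U.starvedB :=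
  Primrec.and.to_comp.comp U.reading_computable ((Primrec.eq (α := ℕ)).decide.to_comp.comp
    (Computable.list_length.comp U.conf_input_computable) (Computable.const 0))

theorem starvedB_iff {w : List ℕ} {p : List Bool} {t : ℕ} :
    U.starvedB (w, p, t) = true ↔ U.Starved (U.conf w p t) := by
  rw [starvedB, Bool.and_eq_true, readingB_iff, decide_eq_true_eq, List.length_eq_zero_iff, Starved,
    and_comm]

theorem haltVal_append {w : List ℕ} {p r : List Bool} {t x : ℕ} (s : List Bool)
    (h : U.haltVal (w, p, t) = some (x, r)) : U.haltVal (w, p ++ s, t) = some (x, r ++ s) := by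
  rw [haltVal_eq_some] at h ⊢
  rw [U.halted_append s h.1, h.2.1, h.2.2]
  exact ⟨h.1, rfl, rfl⟩

theorem haltVal_unique {w : List ℕ} {p : List Bool} {t t' : ℕ} {v v' : ℕ × List Bool}
    (h : U.haltVal (w, p, t) = some v) (h' : U.haltVal (w, p, t') = some v') : v = v' := by
  have h1 := U.haltVal_mono (le_max_left t t') h
  rw [U.haltVal_mono (le_max_right t t') h'] at h1
  exact (Option.some.inj h1).symm

theorem starved_mono {w : List ℕ} {p : List Bool} {t t' : ℕ} (h : t ≤ t')
    (hs : U.Starved (U.conf w p t)) : U.Starved (U.conf w p t') := by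
  rwa [U.conf_eq_of_le (U.next_of_starved hs) h]

theorem haltVal_eq_none_of_starved {w : List ℕ} {p : List Bool} {t : ℕ}
    (h : U.Starved (U.conf w p t)) (t' : ℕ) : U.haltVal (w, p, t') = none := by
  cases hv : U.haltVal (w, p, t') with
  | none => rfl
  | some v => exact absurd h (U.not_starved_of_halted (U.haltVal_eq_some.1 hv).1 t)

/-- Runs the machine on the bits `p` and continues with `f` after it has halted. -/
def runThen (f : ℕ × List Bool → Option (Option ℕ)) (a : List ℕ × List Bool × ℕ) :
    Option (Option ℕ) :=
  -- A starved run means that the bits so far do not suffice, so one more is requested; an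
  -- unfinished run only needs more time.
  Option.casesOn (U.haltVal a) (bif U.starvedB a then some none else none) f

theorem runThen_of_starved {f : ℕ × List Bool → Option (Option ℕ)} {w : List ℕ} {p : List Bool}
    {t : ℕ} (h : U.Starved (U.conf w p t)) : U.runThen f (w, p, t) = some none := by
  rw [runThen, U.haltVal_eq_none_of_starved h]
  simp only [U.starvedB_iff.2 h, cond_true]

theorem runThen_of_haltVal {f : ℕ × List Bool → Option (Option ℕ)} {a : List ℕ × List Bool × ℕ}
    {v : ℕ × List Bool} (h : U.haltVal a = some v) : U.runThen f a = f v := by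
  rw [runThen, h]

/-- Where the simulated run halts it never starves, so no spurious request for a bit can occur at
any time. -/
theorem runThen_eq_none_or {f : ℕ × List Bool → Option (Option ℕ)} {w : List ℕ} {p : List Bool}
    {t : ℕ} {v : ℕ × List Bool} (h : U.haltVal (w, p, t) = some v) (t' : ℕ) :
    U.runThen f (w, p, t') = none ∨ U.runThen f (w, p, t') = f v := by
  cases hv : U.haltVal (w, p, t') with
  | none =>
    left
    have hs : U.starvedB (w, p, t') = false := by
      rw [Bool.eq_false_iff]
      intro hs
      rw [U.haltVal_eq_none_of_starved (U.starvedB_iff.1 hs)] at h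
      cases h
    rw [runThen, hv]
    simp only [hs, cond_false]
  | some v' =>
    right
    rw [U.runThen_of_haltVal hv, U.haltVal_unique hv h]

theorem runThen_eq_some {f : ℕ × List Bool → Option (Option ℕ)} {a : List ℕ × List Bool × ℕ} {y : ℕ}
    (h : U.runThen f a = some (some y)) : ∃ v, U.haltVal a = some v ∧ f v = some (some y) := by
  unfold runThen at h
  cases hv : U.haltVal a with
  | none =>
    rw [hv] at h
    cases hs : U.starvedB a <;> simp [hs] at h
  | some v => rw [hv] at h; exact ⟨v, rfl, h⟩

theorem runThen_computable {β : Type} [Primcodable β] {f : β → ℕ × List Bool → Option (Option ℕ)}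
    {a : β → List ℕ × List Bool × ℕ} (hf : Computable₂ f) (ha : Computable a) :
    Computable fun b => U.runThen (f b) (a b) :=
  Computable.option_casesOn (U.haltVal_computable.comp ha)
    (Computable.cond (U.starvedB_computable.comp ha) (Computable.const (some none))
      (Computable.const none)) hf

variable (pr : ℕ → List Bool) (C : ℕ)

/-- The scaling factor of the test for `i` and `j`, computed from their mutual information and from
the length of a program for the pair. -/
def testScale (z l : ℕ) : ℚ := (2 ^ (Denumerable.ofNat ℤ z + l).toNat : ℕ) * (2 ^ C)⁻¹

theorem testScale_computable : Computable₂ (testScale C) := by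
  refine (primrec_rat_mul.comp (primrec_natCast_rat.comp (primrec_nat_pow.comp (Primrec.const 2)
    (primrec_int_toNat.comp (primrec_int_add.comp ((Primrec.ofNat ℤ).comp Primrec.fst)
      (Primrec.int_cast Primrec.snd))))) (Primrec.const _)).to_comp

/-- The code of a program that prints the test for the pair with the code `a.1`, on the basis of the
mutual information with the code `a.2.1` and of the length `a.2.2` of a program for the pair. -/
def testProgram (w : List ℕ) (t : ℕ) (a : ℕ × ℕ × ℕ) : Option (Option ℕ) :=
  (U.matrixAt (decodeProgram (w.getD 1 0), t, a.1.unpair.1)).bind fun A =>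
    (U.matrixAt (decodeProgram (w.getD 1 0), t, a.1.unpair.2)).map fun B =>
      some (Encodable.encode (pr (Encodable.encode (α := List (List (ℚ × ℚ)))
        (scaledTensorRows (2 ^ w.getD 0 0) (testScale C a.2.1 a.2.2) A B))))

variable {pr} in
theorem testProgram_computable (hpr : Computable pr) :
    Computable fun b : (List ℕ × ℕ) × ℕ × ℕ × ℕ => U.testProgram pr C b.1.1 b.1.2 b.2 := by
  have hw : Computable fun b : (List ℕ × ℕ) × ℕ × ℕ × ℕ => b.1.1 := Computable.fst.comp Computable.fst
  have ht : Computable fun b : (List ℕ × ℕ) × ℕ × ℕ × ℕ => b.1.2 := Computable.snd.comp Computable.fst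
  have hx : Computable fun b : (List ℕ × ℕ) × ℕ × ℕ × ℕ => b.2.1.unpair :=
    Computable.unpair.comp (Computable.fst.comp Computable.snd)
  have hd : Computable fun b : (List ℕ × ℕ) × ℕ × ℕ × ℕ => 2 ^ b.1.1.getD 0 0 :=
    primrec_nat_pow.to_comp.comp (Computable.const 2)
      ((Primrec.list_getD 0).to_comp.comp hw (Computable.const 0))
  have hq : Computable fun b : (List ℕ × ℕ) × ℕ × ℕ × ℕ => decodeProgram (b.1.1.getD 1 0) :=
    decodeProgram_computable.comp ((Primrec.list_getD 0).to_comp.comp hw (Computable.const 1))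
  have hs : Computable fun b : (List ℕ × ℕ) × ℕ × ℕ × ℕ => testScale C b.2.2.1 b.2.2.2 :=
    (testScale_computable C).comp (Computable.fst.comp (Computable.snd.comp Computable.snd))
      (Computable.snd.comp (Computable.snd.comp Computable.snd))
  have hA : Computable fun b : (List ℕ × ℕ) × ℕ × ℕ × ℕ =>
      U.matrixAt (decodeProgram (b.1.1.getD 1 0), b.1.2, b.2.1.unpair.1) :=
    Computable.comp (g := fun b : (List ℕ × ℕ) × ℕ × ℕ × ℕ =>
      (decodeProgram (b.1.1.getD 1 0), b.1.2, b.2.1.unpair.1)) U.matrixAt_computable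
      (hq.pair (ht.pair (Computable.fst.comp hx)))
  have hB : Computable fun b : (List ℕ × ℕ) × ℕ × ℕ × ℕ =>
      U.matrixAt (decodeProgram (b.1.1.getD 1 0), b.1.2, b.2.1.unpair.2) :=
    Computable.comp (g := fun b : (List ℕ × ℕ) × ℕ × ℕ × ℕ =>
      (decodeProgram (b.1.1.getD 1 0), b.1.2, b.2.1.unpair.2)) U.matrixAt_computable
      (hq.pair (ht.pair (Computable.snd.comp hx)))
  refine Computable.option_bind hA (Computable.option_map (hB.comp Computable.fst)
    (Computable.option_some.comp (Computable.encode.comp (hpr.comp (Computable.encode.comp ?_)))))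
  exact Computable.comp (f := fun a : ℕ × ℚ × List (List (ℚ × ℚ)) × List (List (ℚ × ℚ)) =>
      scaledTensorRows a.1 a.2.1 a.2.2.1 a.2.2.2)
    (g := fun c : (((List ℕ × ℕ) × ℕ × ℕ × ℕ) × List (List (ℚ × ℚ))) × List (List (ℚ × ℚ)) =>
      (2 ^ c.1.1.1.1.getD 0 0, testScale C c.1.1.2.2.1 c.1.1.2.2.2, c.1.2, c.2))
    primrec_scaledTensorRows.to_comp
    ((hd.comp (Computable.fst.comp Computable.fst)).pair
      ((hs.comp (Computable.fst.comp Computable.fst)).pair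
        ((Computable.snd.comp Computable.fst).pair Computable.snd)))

/-- Reads a program for a pair and a program for the mutual information, and gives the code of a
program that prints the test. -/
def testDecision : Decision := fun a =>
  -- The bits `v.2` left unread by the first run are the program of the second; their number,
  -- subtracted from the total, gives the length of the first program.
  U.runThen (fun v => U.runThen (fun v' =>
    U.testProgram pr C a.1 a.2.2 (v.1, v'.1, a.2.1.length - v.2.length)) (a.1, v.2, a.2.2)) a

variable {pr} in
theorem testDecision_computable (hpr : Computable pr) : Computable (U.testDecision pr C) := by
  refine U.runThen_computable (β := List ℕ × List Bool × ℕ) ?_ Computable.id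
  refine U.runThen_computable (β := (List ℕ × List Bool × ℕ) × (ℕ × List Bool)) ?_ ?_
  · have ha : Computable fun b : ((List ℕ × List Bool × ℕ) × (ℕ × List Bool)) × (ℕ × List Bool) =>
        b.1.1 := Computable.fst.comp Computable.fst
    have hv : Computable fun b : ((List ℕ × List Bool × ℕ) × (ℕ × List Bool)) × (ℕ × List Bool) =>
        b.1.2 := Computable.snd.comp Computable.fst
    refine Computable.comp (f := fun b : (List ℕ × ℕ) × ℕ × ℕ × ℕ =>
        U.testProgram pr C b.1.1 b.1.2 b.2)
      (g := fun b : ((List ℕ × List Bool × ℕ) × (ℕ × List Bool)) ×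
      (ℕ × List Bool) => ((b.1.1.1, b.1.1.2.2), b.1.2.1, b.2.1, b.1.1.2.1.length - b.1.2.2.length))
      (U.testProgram_computable C hpr) ?_
    refine ((Computable.fst.comp ha).pair (Computable.snd.comp (Computable.snd.comp ha))).pair
      ((Computable.fst.comp hv).pair ((Computable.fst.comp Computable.snd).pair ?_))
    exact Primrec.nat_sub.to_comp.comp
      (Computable.list_length.comp (Computable.fst.comp (Computable.snd.comp ha)))
      (Computable.list_length.comp (Computable.snd.comp hv))
  · exact (Computable.fst.comp Computable.fst).pair ((Computable.snd.comp Computable.snd).pair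
      (Computable.snd.comp (Computable.snd.comp Computable.fst)))

variable {U pr C} in
-- Prefix-freeness makes `p₁ ++ p₂` parse in only one way. On each of its initial segments the
-- procedure reaches a decision, which is either the request for a bit or the one possible output,
-- so `Decision.exists_outputs` applies.
theorem testDecision_outputs (hpr : Computable pr) {w : List ℕ} {p₁ p₂ : List Bool} {x₁ x₂ : ℕ}
    (h₁ : U.Outputs w p₁ x₁) (h₂ : U.Outputs w p₂ x₂) {A B : List (List (ℚ × ℚ))} {tA tB : ℕ}
    (hA : U.matrixAt (decodeProgram (w.getD 1 0), tA, x₁.unpair.1) = some A)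
    (hB : U.matrixAt (decodeProgram (w.getD 1 0), tB, x₁.unpair.2) = some B) :
    ∃ p, p.length ≤ p₁.length + p₂.length ∧
      ((U.testDecision pr C).machine (U.testDecision_computable C hpr)).Outputs w p
        (Encodable.encode (pr (Encodable.encode (α := List (List (ℚ × ℚ)))
          (scaledTensorRows (2 ^ w.getD 0 0) (testScale C x₂ p₁.length) A B)))) := by
  set y := Encodable.encode (pr (Encodable.encode (α := List (List (ℚ × ℚ)))
    (scaledTensorRows (2 ^ w.getD 0 0) (testScale C x₂ p₁.length) A B))) with hy
  obtain ⟨t₁, ht₁⟩ := U.outputs_iff_haltVal.1 h₁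
  obtain ⟨t₂, ht₂⟩ := U.outputs_iff_haltVal.1 h₂
  have hprog : ∀ t, U.testProgram pr C w t (x₁, x₂, p₁.length) = none ∨
      U.testProgram pr C w t (x₁, x₂, p₁.length) = some (some y) := by
    intro t
    simp only [testProgram]
    cases hA' : U.matrixAt (decodeProgram (w.getD 1 0), t, x₁.unpair.1) with
    | none => exact Or.inl rfl
    | some A' =>
      cases hB' : U.matrixAt (decodeProgram (w.getD 1 0), t, x₁.unpair.2) with
      | none => exact Or.inl rfl
      | some B' =>
        have e1 := U.matrixAt_mono (le_max_left t tA) hA'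
        rw [U.matrixAt_mono (le_max_right t tA) hA] at e1
        have e2 := U.matrixAt_mono (le_max_left t tB) hB'
        rw [U.matrixAt_mono (le_max_right t tB) hB] at e2
        obtain rfl := Option.some.inj e1
        obtain rfl := Option.some.inj e2
        exact Or.inr rfl
  -- whatever the procedure outputs on an initial segment is `y`
  have huniq : ∀ p' s, p' ++ s = p₁ ++ p₂ → ∀ t y', U.testDecision pr C (w, p', t) = some (some y') →
      y' = y := by
    intro p' s hs t y' h
    obtain ⟨⟨x₁', r'⟩, hv, h⟩ := U.runThen_eq_some h
    obtain ⟨⟨x₂', r''⟩, hv', h⟩ := U.runThen_eq_some h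
    have e1 := U.haltVal_append s hv
    rw [hs] at e1
    have e2 := U.haltVal_unique e1 (U.haltVal_append p₂ ht₁)
    rw [List.nil_append, Prod.mk.injEq] at e2
    obtain ⟨rfl, hr⟩ := e2
    have e3 := U.haltVal_append s hv'
    rw [hr] at e3
    have e4 := U.haltVal_unique e3 ht₂
    rw [Prod.mk.injEq] at e4
    obtain ⟨rfl, -⟩ := e4
    have hlen : p'.length - r'.length = p₁.length := by
      have l1 := congrArg List.length hs
      have l2 := congrArg List.length hr
      simp only [List.length_append] at l1 l2
      omega
    simp only [hlen] at h
    rcases hprog t with h0 | h0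
    · rw [h0] at h; cases h
    · rw [h0] at h; exact (Option.some.inj (Option.some.inj h)).symm
  -- At this time both runs have halted and both matrices have been written.
  have hdone : ∃ t, U.testDecision pr C (w, p₁ ++ p₂, t) = some (some y) := by
    refine ⟨max (max t₁ t₂) (max tA tB), ?_⟩
    set t := max (max t₁ t₂) (max tA tB) with ht
    have b1 : t₁ ≤ t := (le_max_left _ _).trans (le_max_left _ _)
    have b2 : t₂ ≤ t := (le_max_right _ _).trans (le_max_left _ _)
    have b3 : tA ≤ t := (le_max_left _ _).trans (le_max_right _ _)
    have b4 : tB ≤ t := (le_max_right _ _).trans (le_max_right _ _)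
    rw [testDecision, U.runThen_of_haltVal (U.haltVal_mono b1 (U.haltVal_append p₂ ht₁)),
      List.nil_append, U.runThen_of_haltVal (U.haltVal_mono b2 ht₂)]
    simp only [testProgram, U.matrixAt_mono b3 hA, U.matrixAt_mono b4 hB, List.length_append,
      Nat.add_sub_cancel, Option.bind_some, Option.map_some, hy]
  have hpart : ∀ r s, r ++ s = p₂ → ∃ t, U.testDecision pr C (w, p₁ ++ r, t) ≠ none := by
    intro r s hs
    by_cases h0 : s = []
    · rw [h0, List.append_nil] at hs
      obtain ⟨t, ht⟩ := hdone
      exact ⟨t, by rw [hs, ht]; simp⟩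
    · rw [← hs] at h₂
      obtain ⟨t, ht⟩ := U.starved_of_outputs_append h₂ h0
      refine ⟨max t₁ t, ?_⟩
      rw [testDecision, U.runThen_of_haltVal (U.haltVal_mono (le_max_left t₁ t)
        (U.haltVal_append r ht₁)), List.nil_append,
        U.runThen_of_starved (U.starved_mono (le_max_right t₁ t) ht)]
      simp
  -- On a proper initial segment of `p₁` the first run starves. Otherwise `hpart` applies: the
  -- second run starves, or the input is complete.
  have hdec : ∀ p' s, p' ++ s = p₁ ++ p₂ → ∃ t, U.testDecision pr C (w, p', t) ≠ none := by
    intro p' s hs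
    rcases List.append_eq_append_iff.1 hs with ⟨a, ha, ha'⟩ | ⟨a, ha, ha'⟩
    · by_cases h0 : a = []
      · subst h0
        rw [List.append_nil] at ha
        subst ha
        simpa using hpart [] s ha'
      · rw [ha] at h₁
        obtain ⟨t, ht⟩ := U.starved_of_outputs_append h₁ h0
        exact ⟨t, by rw [testDecision, U.runThen_of_starved ht]; simp⟩
    · subst ha
      exact hpart a s ha'.symm
  have hcases : ∀ p' s, p' ++ s = p₁ ++ p₂ → ∃ v, (U.testDecision pr C).Decides w p' v ∧
      (v = none ∨ v = some y) := by
    intro p' s hs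
    obtain ⟨v, hv⟩ := Decision.exists_decides (hdec p' s hs)
    refine ⟨v, hv, ?_⟩
    cases v with
    | none => exact Or.inl rfl
    | some y' =>
      obtain ⟨t, ht, -⟩ := hv
      exact Or.inr (congrArg some (huniq p' s hs t y' ht))
  obtain ⟨p, hp, hout⟩ : ∃ p, p <+: p₁ ++ p₂ ∧
      ((U.testDecision pr C).machine (U.testDecision_computable C hpr)).Outputs w p y := by
    refine Decision.exists_outputs (U.testDecision_computable C hpr)
      (fun p' ⟨s, hs⟩ => hcases p' s hs) ?_
    -- On the whole input neither run starves, so the decision cannot be the request for a bit.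
    obtain ⟨v, hv, rfl | rfl⟩ := hcases (p₁ ++ p₂) [] (List.append_nil _)
    · exfalso
      obtain ⟨t, ht, -⟩ := hv
      rw [testDecision] at ht
      rcases U.runThen_eq_none_or (U.haltVal_append p₂ ht₁) t with h | h
      · rw [h] at ht; cases ht
      · rw [h] at ht
        simp only [List.nil_append, List.length_append, Nat.add_sub_cancel] at ht
        rcases U.runThen_eq_none_or ht₂ t with h | h
        · rw [h] at ht; cases ht
        · rw [h] at ht
          rcases hprog t with h | h <;> (rw [h] at ht; cases ht)
    · exact hv
  exact ⟨p, by simpa using hp.length_le, hout⟩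

end Machine

namespace Machine

variable (U : Machine)

/-! ## Lower computable matrices -/

variable {U} in
-- The emitted codes determine the sequence term by term, including the constant continuation of a
-- finite one, and limits are unique.
theorem LowerComputes.unique {d : ℕ} {e : List ℕ} {q : List Bool} {ν ν' : Matrix (Fin d) (Fin d) ℂ}
    (h : U.LowerComputes e q ν) (h' : U.LowerComputes e q ν') : ν = ν' := by
  obtain ⟨-, ξ, -, -, hlim, h0, hs⟩ := h
  obtain ⟨-, ξ', -, -, hlim', h0', hs'⟩ := h'
  have : ξ = ξ' := by
    funext k
    induction k with
    | zero => exact ElemMatrix.code_injective (U.emits_unique h0 h0')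
    | succ k ih =>
      rcases hs k with h1 | ⟨h1, h2⟩ <;> rcases hs' k with h1' | ⟨h1', h2'⟩
      · exact ElemMatrix.code_injective (U.emits_unique h1 h1')
      · exact absurd h1 (h2' _)
      · exact absurd h1' (h2 _)
      · rw [h1, h1', ih]
  subst this
  exact tendsto_nhds_unique hlim hlim'

variable {U} in
theorem LowerComputes.posSemidef {d : ℕ} {e : List ℕ} {q : List Bool} {ν : Matrix (Fin d) (Fin d) ℂ}
    (h : U.LowerComputes e q ν) : ν.PosSemidef := by
  obtain ⟨-, ξ, hξ, -, hlim, -⟩ := h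
  exact isClosed_posSemidef.mem_of_tendsto hlim (Filter.Eventually.of_forall hξ)

/-- Each program lower computes at most one matrix, so the sum is at most that of the probabilities
of all programs. -/
theorem tsum_lowerProb_le_one {d : ℕ} (e : List ℕ) (n : ℕ) (S : Set (Matrix (Fin d) (Fin d) ℂ)) :
    ∑' ν : S, U.lowerProb e n ν.1 ≤ 1 := by
  have h1 : ∀ ν : Matrix (Fin d) (Fin d) ℂ, U.lowerProb e n ν = ∑' q : List Bool,
      {q | U.LowerComputes e q ν}.indicator (fun q => U.m (n :: e) (Encodable.encode q)) q :=
    fun ν => tsum_subtype {q | U.LowerComputes e q ν} fun q => U.m (n :: e) (Encodable.encode q)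
  simp_rw [h1]
  rw [ENNReal.tsum_comm]
  refine le_trans (ENNReal.tsum_le_tsum fun q => ?_)
    ((ENNReal.tsum_comp_le_tsum_of_injective (Encodable.encode_injective (α := List Bool))
      (U.m (n :: e))).trans (U.tsum_m_le_one (n :: e)))
  by_cases h : ∃ ν : S, U.LowerComputes e q ν.1
  · obtain ⟨ν, hν⟩ := h
    rw [tsum_eq_single ν]
    · exact Set.indicator_le_self' (fun _ _ => zero_le) q
    · intro ν' hne
      exact Set.indicator_of_notMem (s := {q | U.LowerComputes e q ν'.1})
        (fun h => hne (Subtype.ext (LowerComputes.unique h hν))) _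
  · push Not at h
    refine le_trans (le_of_eq (ENNReal.tsum_eq_zero.2 fun ν => ?_)) zero_le
    exact Set.indicator_of_notMem (s := {q | U.LowerComputes e q ν.1}) (h ν) _

theorem lowerProb_ne_top {d : ℕ} (e : List ℕ) (n : ℕ) (ν : Matrix (Fin d) (Fin d) ℂ) :
    U.lowerProb e n ν ≠ ∞ := by
  refine ne_top_of_le_ne_top ENNReal.one_ne_top (le_trans ?_ (U.tsum_lowerProb_le_one e n {ν}))
  exact ENNReal.le_tsum (f := fun ν' : ({ν} : Set (Matrix (Fin d) (Fin d) ℂ)) =>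
    U.lowerProb e n ν'.1) ⟨ν, rfl⟩

theorem posSemidef_of_mem_productTests {e : List ℕ} {n : ℕ}
    {ν : Matrix (Fin (2 ^ n * 2 ^ n)) (Fin (2 ^ n * 2 ^ n)) ℂ} (h : ν ∈ U.productTests e n) :
    ν.PosSemidef := by
  obtain ⟨-, ⟨q, hq⟩, -⟩ := h
  exact hq.posSemidef

variable {U} in
/-- The sum that defines the aggregate of the product tests converges. -/
theorem IsUniversal.hasSum_aggregate (hU : U.IsUniversal) (e : List ℕ) (n : ℕ) :
    HasSum (fun ν : U.productTests e n => (U.lowerProb e n ν.1).toReal • ν.1) (U.aggregate e n) := by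
  obtain ⟨B, hB⟩ := hU.exists_trace_le e n
  refine (summable_smul_posSemidef (ENNReal.summable_toReal (ne_top_of_le_ne_top ENNReal.one_ne_top
    (U.tsum_lowerProb_le_one e n (U.productTests e n)))) (fun _ => ENNReal.toReal_nonneg)
    (P := fun ν : U.productTests e n => ν.1) (fun ν => U.posSemidef_of_mem_productTests ν.2)
    (B := B) fun ν => hB _ (U.posSemidef_of_mem_productTests ν.2) ν.2.2.2).hasSum

variable {U} in
-- All terms of the series are nonnegative against a positive semidefinite `T`, so a single term is
-- a lower bound.
theorem IsUniversal.le_trace_aggregate_mul (hU : U.IsUniversal) {e : List ℕ} {n : ℕ}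
    {ν T : Matrix (Fin (2 ^ n * 2 ^ n)) (Fin (2 ^ n * 2 ^ n)) ℂ} (hν : ν ∈ U.productTests e n)
    (hT : T.PosSemidef) :
    (U.lowerProb e n ν).toReal * (ν * T).trace.re ≤ (U.aggregate e n * T).trace.re := by
  have h := hasSum_trace_mul (hU.hasSum_aggregate e n) T
  simp only [Matrix.mul_smul, trace_real_smul_re] at h
  rw [Matrix.trace_mul_comm (U.aggregate e n), Matrix.trace_mul_comm ν]
  exact le_hasSum h ⟨ν, hν⟩ fun ν' _ => mul_nonneg ENNReal.toReal_nonneg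
    (trace_mul_re_nonneg hT (U.posSemidef_of_mem_productTests ν'.2))

/-- The tests for pairs of outcomes have large lower probabilities. -/
theorem IsUniversal.exists_le_lowerProb {U : Machine} (hU : U.IsUniversal) (C : ℕ) :
    ∃ c : ℕ, ∀ (n : ℕ) (E : ℕ → Matrix (Fin (2 ^ n)) (Fin (2 ^ n)) ℂ) (q : List Bool) (i j : ℕ),
      IsPOVM E → U.Enumerates q E → E i ≠ 0 → E j ≠ 0 →
      ∀ k : ℕ, (k : ℤ) = U.K [n, Encodable.encode q] i + U.K [n, Encodable.encode q] j →
      ∀ ν, ν = tensor ((2 ^ k * (2 ^ C)⁻¹ : ℝ) • E i) (E j) →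
        (∃ p, U.LowerComputes [Encodable.encode q] p ν) ∧
        ((2 : ℝ) ^ (c + U.K [n, Encodable.encode q] (Nat.pair i j) + U.K [n, Encodable.encode q]
          (Encodable.encode (U.info [n, Encodable.encode q] i j))))⁻¹ ≤
            (U.lowerProb [Encodable.encode q] n ν).toReal := by
  obtain ⟨pr, -, hpr, hprint⟩ := hU.exists_printer
  obtain ⟨r, hr⟩ := hU ((U.testDecision pr C).machine (U.testDecision_computable C hpr))
  refine ⟨r.length, fun n E q i j hE hq hi hj k hk ν hν => ?_⟩
  set w := [n, Encodable.encode q] with hw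
  have hgetn : w.getD 0 0 = n := rfl
  have hgetq : w.getD 1 0 = Encodable.encode q := rfl
  obtain ⟨p₁, hl₁, h₁⟩ := hU.exists_shortest w (Nat.pair i j)
  obtain ⟨p₂, hl₂, h₂⟩ := hU.exists_shortest w (Encodable.encode (U.info w i j))
  -- A nonzero matrix is not beyond the end of the enumeration, so the program for `E` does write
  -- it.
  have hemit : ∀ i, E i ≠ 0 → ∃ A : ElemMatrix (2 ^ n), A.toMatrix = E i ∧ U.Emits [] q i A.code :=
    fun i hi => (hq.2 i).resolve_right fun h => hi h.1
  obtain ⟨A, hAE, hA⟩ := hemit i hi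
  obtain ⟨B, hBE, hB⟩ := hemit j hj
  obtain ⟨tA, htA⟩ := U.exists_matrixAt hA
  obtain ⟨tB, htB⟩ := U.exists_matrixAt hB
  obtain ⟨p, hp, hout⟩ := testDecision_outputs (C := C) hpr h₁ h₂
    (A := List.ofFn fun a => List.ofFn (A a)) (B := List.ofFn fun a => List.ofFn (B a))
    (tA := tA) (tB := tB)
    (by rw [hgetq, decodeProgram_encode, Nat.unpair_pair]; exact htA)
    (by rw [hgetq, decodeProgram_encode, Nat.unpair_pair]; exact htB)
  -- The length of a shortest program for the pair is K(i,j), and I + K(i,j) = K(i) + K(j). The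
  -- exponent is therefore nonnegative and `toNat` changes nothing.
  have hscale : testScale C (Encodable.encode (U.info w i j)) p₁.length = 2 ^ k * (2 ^ C)⁻¹ := by
    rw [testScale, Denumerable.ofNat_encode, hl₁, info]
    have : ((U.K w i : ℤ) + U.K w j - U.K w (Nat.pair i j) + U.K w (Nat.pair i j)).toNat = k := by
      omega
    rw [this]
    push_cast
    rfl
  rw [hgetn, hscale, scaledTensorRows_ofFn, encode_ofFn_matrix] at hout
  set N := A.scaledTensor (2 ^ k * (2 ^ C)⁻¹) B with hN
  have hNν : N.toMatrix = ν := by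
    rw [hN, ElemMatrix.toMatrix_scaledTensor, hAE, hBE, hν]
    push_cast
    rfl
  have hpsd : ν.PosSemidef := by
    rw [hν]
    exact tensor_posSemidef (posSemidef_real_smul (hE.posSemidef i) (by positivity)) (hE.posSemidef j)
  -- The test is itself elementary: the printing program writes it once, and the sequence is
  -- constant from there on.
  have hlow : U.LowerComputes [Encodable.encode q] (pr N.code) ν := by
    obtain ⟨-, h2, h3⟩ := hprint [Encodable.encode q] N.code
    refine ⟨h2, fun _ => N, fun _ => by rw [hNν]; exact hpsd, fun _ => ?_, ?_, ?_, fun k => ?_⟩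
    · rw [sub_self]; exact Matrix.PosSemidef.zero
    · exact hNν ▸ tendsto_const_nhds
    · exact (h3 0 _).2 ⟨rfl, rfl⟩
    · exact Or.inr ⟨rfl, fun x hx => absurd ((h3 _ _).1 hx).1 (Nat.succ_ne_zero k)⟩
  refine ⟨⟨_, hlow⟩, ?_⟩
  have hle : (2 : ℝ≥0∞)⁻¹ ^ (r ++ p).length ≤ U.lowerProb [Encodable.encode q] n ν :=
    (U.le_m ((hr w p).1 _ hout)).trans
      (ENNReal.le_tsum (f := fun q' : {q' : List Bool // U.LowerComputes [Encodable.encode q] q' ν} =>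
        U.m (n :: [Encodable.encode q]) (Encodable.encode q'.1)) ⟨_, hlow⟩)
  have hle' := ENNReal.toReal_mono (U.lowerProb_ne_top _ _ _) hle
  rw [ENNReal.toReal_pow, ENNReal.toReal_inv, ENNReal.toReal_ofNat, inv_pow] at hle'
  refine le_trans (inv_anti₀ (by positivity) (pow_le_pow_right₀ (by norm_num) ?_)) hle'
  rw [List.length_append]
  omega

/-- The lower estimate for the value of the aggregate of the product tests. -/
theorem IsUniversal.exists_le_trace_aggregate {U : Machine} (hU : U.IsUniversal) :
    ∃ c : ℕ, ∀ (n : ℕ) (E : ℕ → Matrix (Fin (2 ^ n)) (Fin (2 ^ n)) ℂ) (q : List Bool)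
      (σ ρ : Matrix (Fin (2 ^ n)) (Fin (2 ^ n)) ℂ) (i j : ℕ),
      IsPOVM E → U.Enumerates q E → σ.PosSemidef → ρ.PosSemidef →
      0 < outcome E σ i * outcome E ρ j →
      (2 : ℝ) ^ (U.info [n, Encodable.encode q] i j - U.K [n, Encodable.encode q]
          (Encodable.encode (U.info [n, Encodable.encode q] i j)) - c) *
        (outcome E σ i * outcome E ρ j) ≤
      (U.aggregate [Encodable.encode q] n * tensor σ ρ).trace.re := by
  obtain ⟨c₁, hc₁⟩ := hU.exists_trace_mul_mu_le
  obtain ⟨c₂, hc₂⟩ := hU.exists_le_lowerProb (2 * c₁)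
  refine ⟨2 * c₁ + c₂, fun n E q σ ρ i j hE hq hσ hρ hpos => ?_⟩
  set w := [n, Encodable.encode q] with hw
  have hi : E i ≠ 0 := by
    intro h
    simp [outcome, h] at hpos
  have hj : E j ≠ 0 := by
    intro h
    simp [outcome, h] at hpos
  -- Each of the two factors Tr E_i μ and Tr E_j μ exceeds 2^(-K) by a factor of at most 2^c₁,
  -- whence the correction 2^(-2c₁).
  set s : ℝ := 2 ^ (U.K w i + U.K w j) * (2 ^ (2 * c₁))⁻¹ with hs
  have hs0 : 0 ≤ s := by positivity
  obtain ⟨hlow, hprob⟩ := hc₂ n E q i j hE hq hi hj (U.K w i + U.K w j) (by push_cast; rfl) _ rfl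
  rw [← hs] at hlow hprob
  set ν := tensor (s • E i) (E j) with hν
  have hherm : (s • E i).IsHermitian := (posSemidef_real_smul (hE.posSemidef i) hs0).isHermitian
  have htr : ∀ S T : Matrix (Fin (2 ^ n)) (Fin (2 ^ n)) ℂ, S.IsHermitian →
      (ν * tensor S T).trace.re = s * ((E i * S).trace.re * (E j * T).trace.re) := by
    intro S T hS
    rw [hν, trace_tensor_mul_tensor_re hherm hS, Matrix.smul_mul, trace_real_smul_re, mul_assoc]
  have hmem : ν ∈ U.productTests [Encodable.encode q] n := by
    refine ⟨⟨_, _, hν⟩, hlow, ?_⟩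
    rw [htr _ _ (U.mu_posSemidef _ _).isHermitian]
    have hi' := hc₁ n E q hE hq i
    have hj' := hc₁ n E q hE hq j
    have hj0 := trace_mul_re_nonneg (hE.posSemidef j) (U.mu_posSemidef [Encodable.encode q] n)
    have h := mul_le_mul hi' hj' (by positivity) (by positivity)
    have e : s * ((E i * U.mu [Encodable.encode q] n).trace.re *
        (E j * U.mu [Encodable.encode q] n).trace.re) =
        ((E i * U.mu [Encodable.encode q] n).trace.re * 2 ^ U.K w i *
          ((E j * U.mu [Encodable.encode q] n).trace.re * 2 ^ U.K w j)) * (2 ^ (2 * c₁))⁻¹ := by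
      rw [hs, pow_add]; ring
    rw [e]
    refine (mul_le_mul_of_nonneg_right h (by positivity)).trans (le_of_eq ?_)
    rw [← pow_add, ← two_mul, mul_inv_cancel₀ (by positivity)]
  have hfin := hU.le_trace_aggregate_mul hmem (tensor_posSemidef hσ hρ)
  rw [htr _ _ hσ.isHermitian] at hfin
  refine le_trans ?_ ((mul_le_mul_of_nonneg_right hprob (mul_nonneg hs0 hpos.le)).trans hfin)
  refine le_trans (mul_le_mul_of_nonneg_right (le_of_eq ?_) hpos.le) (le_of_eq (mul_assoc _ _ _))
  rw [hs]
  -- Comparison of exponents: K(i) + K(j) - 2c₁ - c₂ - K(i,j) - K(I) = I - K(I) - (2c₁ + c₂).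
  -- Integer powers are needed because `I` may be negative.
  simp only [← zpow_natCast, ← zpow_neg]
  rw [← zpow_add₀ two_ne_zero, ← zpow_add₀ two_ne_zero]
  congr 1
  simp only [info]
  push_cast
  ring

end Machine

end AlgInfo

-- The inequality in logarithmic form

theorem theorem9 (U : AlgInfo.Machine) (hU : U.IsUniversal) :
    ∃ c : ℝ, ∀ (n : ℕ) (E : ℕ → Matrix (Fin (2 ^ n)) (Fin (2 ^ n)) ℂ) (q : List Bool)
      (σ ρ : Matrix (Fin (2 ^ n)) (Fin (2 ^ n)) ℂ) (i j : ℕ),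
      AlgInfo.IsPOVM E → U.Enumerates q E →
      AlgInfo.IsSemiDensity σ → AlgInfo.IsSemiDensity ρ →
      (((U.info [n, Encodable.encode q] i j : ℤ) : ℝ) : EReal)
          + AlgInfo.log2 (AlgInfo.outcome E σ i * AlgInfo.outcome E ρ j)
          - (((U.K [n, Encodable.encode q]
                (Encodable.encode (U.info [n, Encodable.encode q] i j)) : ℕ) : ℝ) : EReal)
        ≤ U.qinfo [Encodable.encode q] n σ ρ + (c : EReal) := by
  obtain ⟨c, hc⟩ := hU.exists_le_trace_aggregate
  refine ⟨c, fun n E q σ ρ i j hE hq hσ hρ => ?_⟩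
  have h := hc n E q σ ρ i j hE hq hσ.posSemidef hρ.posSemidef
  rw [AlgInfo.Machine.qinfo]
  generalize AlgInfo.outcome E σ i * AlgInfo.outcome E ρ j = P at h ⊢
  generalize (U.aggregate [Encodable.encode q] n * AlgInfo.tensor σ ρ).trace.re = T at h ⊢
  generalize U.info [n, Encodable.encode q] i j = I at h ⊢
  generalize U.K [n, Encodable.encode q] (Encodable.encode I) = k at h ⊢
  -- If an outcome has probability 0, the left side is `⊥`. Otherwise the lower estimate makes the
  -- value of the aggregate positive, and both logarithms are finite.
  rcases le_or_gt P 0 with hP | hP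
  · rw [AlgInfo.log2, if_pos hP, EReal.add_bot, EReal.bot_sub]
    exact bot_le
  · have h1 := h hP
    have hT : 0 < T := lt_of_lt_of_le (by positivity) h1
    rw [AlgInfo.log2, if_neg (not_le.2 hP), AlgInfo.log2, if_neg (not_le.2 hT)]
    have h2 := Real.logb_le_logb_of_le one_lt_two (by positivity) h1
    rw [Real.logb_mul (by positivity) hP.ne', ← Real.rpow_intCast,
      Real.logb_rpow two_pos (by norm_num)] at h2
    push_cast at h2
    rw [← EReal.coe_add, ← EReal.coe_sub, ← EReal.coe_add, EReal.coe_le_coe_iff]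
    linarith
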